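/- Let $\mathbb{T}^2=(\mathbb{R}/2\pi\mathbb{Z})^2$ with the Haar measure of total mass $4\pi^2$, and let $L^{2,\mathrm{ees}}(\mathbb{T}^2)$ be the space of all $f\in L^2(\mathbb{T}^2;\mathbb{C})$ with $f(-p)=f(p)$ and $f(p_1,p_2)=f(p_2,p_1)=f(-p_1,p_2)$ for almost every $p$. For $\gamma,\lambda,\mu\in\mathbb{R}$ let $H^{\mathrm{ees}}_{\gamma\lambda\mu}(0)$ be the restriction to the invariant subspace $L^{2,\mathrm{ees}}(\mathbb{T}^2)$ of the bounded operator $H_{\gamma\lambda\mu}(0)=H_0(0)+V_{\gamma\lambda\mu}$, where $$(H_0(0)f)(p)=\mathcal{E}_0(p)f(p),\qquad \mathcal{E}_0(p)=2\sum_{i=1}^2(1-\cos p_i),$$ $$\begin{aligned}(V_{\gamma\lambda\mu}f)(p)={}&\frac{\gamma}{4\pi^2}\int_{\mathbb{T}^2}f(q)\,dq+\frac{\lambda}{4\pi^2}\sum_{i=1}^2\cos p_i\int_{\mathbb{T}^2}\cos q_i\,f(q)\,dq+\frac{\mu}{4\pi^2}\sum_{i=1}^2\cos 2p_i\int_{\mathbb{T}^2}\cos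 2q_i\,f(q)\,dq\\&+\frac{\mu}{2\pi^2}\cos p_1\cos p_2\int_{\mathbb{T}^2}\cos q_1\cos q_2\,f(q)\,dq+\frac{\mu}{2\pi^2}\sin p_1\sin p_2\int_{\mathbb{T}^2}\sin q_1\sin q_2\,f(q)\,dq.\end{aligned}$$ Put $$\mu_0^{\pm}=\frac{-80+24\pi\pm\sqrt{666\pi^2-4128\pi+6400}}{3(16-5\pi)},\qquad \mu_1^{\pm}=\frac{-80+21\pi\pm\sqrt{801\pi^2-4512\pi+6400}}{12(16-5\pi)},$$ so that $\mu_0^-=-7.7170\ldots<\mu_1^-=-7.2646\ldots<\mu_0^+=-2.7880\ldots<\mu_1^+=-0.7404\ldots$, and $$Q_0^-(\mu)=\tfrac{16-5\pi}{4\pi}(\mu-\mu_0^-)(\mu-\mu_0^+),\qquad Q_1^-(\mu)=\tfrac{2(16-5\pi)}{\pi}(\mu-\mu_1^-)(\mu-\mu_1^+),$$ $$\lambda^-(\mu)=-\frac{Q_1^-(\mu)}{Q_0^-(\mu)},\qquad \gamma^-(\lambda,\mu)=\frac{8Q_0^-(\mu)}{\lambda Q_0^-(\mu)+Q_1^-(\mu)}-4,$$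 $I_1=(\mu_0^+,\infty)$, $I_2=(\mu_0^-,\mu_0^+)$, $I_3=(-\infty,\mu_0^-)$. In the $(\lambda,\mu)$-plane let $\tau_j=\{\lambda=\lambda^-(\mu),\ \mu\in I_j\}$ for $j=1,2,3$, and $$\begin{aligned}D_1&=\{\lambda>\lambda^-(\mu),\ \mu\in I_1\},\\ D_2&=\{\lambda<\lambda^-(\mu),\ \mu\in I_1\}\cup\{\mu=\mu_0^+\}\cup\{\lambda>\lambda^-(\mu),\ \mu\in I_2\},\\ D_3&=\{\lambda<\lambda^-(\mu),\ \mu\in I_2\}\cup\{\mu=\mu_0^-\}\cup\{\lambda>\lambda^-(\mu),\ \mu\in I_3\},\\ D_4&=\{\lambda<\lambda^-(\mu),\ \mu\in I_3\}.\end{aligned}$$ In the $(\gamma,\lambda,\mu)$-space let $$\mathcal{C}^-_0=\{\gamma>\gamma^-(\lambda,\mu),\ (\lambda,\mu)\in D_1\},\qquad \mathcal{C}^-_4=\{\gamma<\gamma^-(\lambda,\mu),\ (\lambda,\mu)\in D_4\},$$ $$\mathcal{C}^-_\zeta=\{\gamma<\gamma^-(\lambda,\mu),\ (\lambda,\mu)\in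 D_\zeta\}\cup\{(\lambda,\mu)\in\tau_\zeta\}\cup\{\gamma>\gamma^-(\lambda,\mu),\ (\lambda,\mu)\in D_{\zeta+1}\}\qquad(\zeta=1,2,3),$$ and let $\mathcal{C}^+_\zeta=\{(\gamma,\lambda,\mu):(-\gamma,-\lambda,-\mu)\in\mathcal{C}^-_\zeta\}$ for $\zeta=0,\ldots,4$. **Theorem.** Let $\gamma,\lambda,\mu\in\mathbb{R}$ and $\zeta\in\{0,1,2,3,4\}$. If $(\gamma,\lambda,\mu)\in\mathcal{C}^-_\zeta$ (resp. $(\gamma,\lambda,\mu)\in\mathcal{C}^+_\zeta$), then $H^{\mathrm{ees}}_{\gamma\lambda\mu}(0)$ has exactly $\zeta$ eigenvalues, counted with multiplicity, below (resp. above) its essential spectrum. -/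

import Mathlib

open MeasureTheory
open scoped ENNReal Real

noncomputable section

namespace LatticeBosons

/-! ### The torus and its `L²` space -/

instance factTwoPiPos : Fact (0 < 2 * π) := ⟨Real.two_pi_pos⟩

/-- The one-dimensional torus `ℝ / 2πℤ`; its `volume` is the Haar measure of total mass `2π`. -/
abbrev Torus : Type := AddCircle (2 * π)

/-- The two-dimensional torus `(ℝ / 2πℤ)²`, with the product measure. -/
abbrev Torus2 : Type := Torus × Torus

/-- The Hilbert space `L²(𝕋²)` of complex square integrable functions. -/
abbrev L2 : Type := Lp ℂ 2 (volume : Measure Torus2)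

/-- The cosine as a function on the torus. -/
def cosT : Torus → ℝ := Real.cos_periodic.lift

/-- The sine as a function on the torus. -/
def sinT : Torus → ℝ := Real.sin_periodic.lift

@[simp] theorem cosT_coe (x : ℝ) : cosT (x : Torus) = Real.cos x := rfl

@[simp] theorem sinT_coe (x : ℝ) : sinT (x : Torus) = Real.sin x := rfl

@[fun_prop] theorem continuous_cosT : Continuous cosT :=
  continuous_coinduced_dom.mpr Real.continuous_cos

@[fun_prop] theorem continuous_sinT : Continuous sinT :=
  continuous_coinduced_dom.mpr Real.continuous_sin

@[simp] theorem cosT_neg (x : Torus) : cosT (-x) = cosT x := by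
  induction x using QuotientAddGroup.induction_on with
  | H x => exact Real.cos_neg x

@[simp] theorem sinT_neg (x : Torus) : sinT (-x) = -sinT x := by
  induction x using QuotientAddGroup.induction_on with
  | H x => exact Real.sin_neg x

/-! ### The functions entering the Hamiltonian -/

/-- The dispersion function `𝓔₀(p) = 2 ∑ᵢ (1 - cos pᵢ)`. -/
def dispersion : C(Torus2, ℝ) :=
  ⟨fun p => 2 * ((1 - cosT p.1) + (1 - cosT p.2)), by fun_prop⟩

/-- `cos p₁`. -/
def cosFst : C(Torus2, ℝ) := ⟨fun p => cosT p.1, by fun_prop⟩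

/-- `cos p₂`. -/
def cosSnd : C(Torus2, ℝ) := ⟨fun p => cosT p.2, by fun_prop⟩

/-- `cos 2p₁`. -/
def cosTwoFst : C(Torus2, ℝ) := ⟨fun p => cosT (2 • p.1), by fun_prop⟩

/-- `cos 2p₂`. -/
def cosTwoSnd : C(Torus2, ℝ) := ⟨fun p => cosT (2 • p.2), by fun_prop⟩

/-- `cos p₁ cos p₂`. -/
def cosCos : C(Torus2, ℝ) := ⟨fun p => cosT p.1 * cosT p.2, by fun_prop⟩

/-- `sin p₁ sin p₂`. -/
def sinSin : C(Torus2, ℝ) := ⟨fun p => sinT p.1 * sinT p.2, by fun_prop⟩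

/-- A real continuous function on the torus, regarded as complex valued. -/
def toComplex (φ : C(Torus2, ℝ)) : C(Torus2, ℂ) := ⟨fun p => (φ p : ℂ), by fun_prop⟩

/-- A real continuous function on the torus as an element of `L²(𝕋²)`. -/
def toL2 (φ : C(Torus2, ℝ)) : L2 := ContinuousMap.toLp 2 volume ℂ (toComplex φ)

/-! ### The Hamiltonian -/

/-- The operator of multiplication by `φ` in `L²(𝕋²)`. -/
def mulOp (φ : C(Torus2, ℝ)) : L2 →L[ℂ] L2 :=
  (ContinuousLinearMap.mul ℂ ℂ).holderL volume ∞ 2 2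
    (ContinuousMap.toLp ∞ volume ℂ (toComplex φ))

/-- The operator `f ↦ φ · ∫ φ(q) f(q) dq` in `L²(𝕋²)`, for a real function `φ`. -/
def intOp (φ : C(Torus2, ℝ)) : L2 →L[ℂ] L2 :=
  (innerSL ℂ (toL2 φ)).smulRight (toL2 φ)

/-- The interaction `V_{γλμ}`. -/
def potential (γ lam μ : ℝ) : L2 →L[ℂ] L2 :=
  ((γ / (4 * π ^ 2) : ℝ) : ℂ) • intOp 1
    + ((lam / (4 * π ^ 2) : ℝ) : ℂ) • (intOp cosFst + intOp cosSnd)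
    + ((μ / (4 * π ^ 2) : ℝ) : ℂ) • (intOp cosTwoFst + intOp cosTwoSnd)
    + ((μ / (2 * π ^ 2) : ℝ) : ℂ) • intOp cosCos
    + ((μ / (2 * π ^ 2) : ℝ) : ℂ) • intOp sinSin

/-- The operator `H_{γλμ}(0) = H₀(0) + V_{γλμ}` given by its formula on all of `L²(𝕋²)`. -/
def hamiltonian (γ lam μ : ℝ) : L2 →L[ℂ] L2 := mulOp dispersion + potential γ lam μ

theorem coeFn_toL2 (φ : C(Torus2, ℝ)) : toL2 φ =ᵐ[volume] fun p => (φ p : ℂ) :=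
  ContinuousMap.coeFn_toLp (p := 2) (𝕜 := ℂ) volume (toComplex φ)

theorem coeFn_mulOp (φ : C(Torus2, ℝ)) (f : L2) :
    mulOp φ f =ᵐ[volume] fun p => (φ p : ℂ) * f p := by
  have h1 := (ContinuousLinearMap.mul ℂ ℂ).coeFn_holder (r := 2)
    (ContinuousMap.toLp ∞ volume ℂ (toComplex φ)) f
  have h2 := ContinuousMap.coeFn_toLp (p := ∞) (𝕜 := ℂ) (volume : Measure Torus2) (toComplex φ)
  filter_upwards [h1, h2] with p hp1 hp2
  change ((ContinuousLinearMap.mul ℂ ℂ).holder 2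
    (ContinuousMap.toLp ∞ volume ℂ (toComplex φ)) f : L2) p = _
  rw [hp1, hp2]
  rfl

theorem inner_toL2 (φ : C(Torus2, ℝ)) (f : L2) :
    inner ℂ (toL2 φ) f = ∫ q, (φ q : ℂ) * f q := by
  rw [MeasureTheory.L2.inner_def]
  refine integral_congr_ae ?_
  filter_upwards [coeFn_toL2 φ] with q hq
  rw [hq]
  simp [mul_comm]

theorem intOp_apply (φ : C(Torus2, ℝ)) (f : L2) :
    intOp φ f = (∫ q, (φ q : ℂ) * f q) • toL2 φ := by
  rw [← inner_toL2]
  rfl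

/-! ### The subspace `L^{2,ees}` and the part of the Hamiltonian in it -/

theorem mp_neg : MeasurePreserving (fun p : Torus2 => -p) volume volume :=
  (Measure.measurePreserving_neg (volume : Measure Torus)).prod
    (Measure.measurePreserving_neg (volume : Measure Torus))

theorem mp_swap : MeasurePreserving (fun p : Torus2 => (p.2, p.1)) volume volume :=
  Measure.measurePreserving_swap

theorem mp_refl : MeasurePreserving (fun p : Torus2 => (-p.1, p.2)) volume volume :=
  (Measure.measurePreserving_neg (volume : Measure Torus)).prod (MeasurePreserving.id volume)

/-- Composition with a measure preserving map of the torus. -/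
def compOp (σ : Torus2 → Torus2) (hσ : MeasurePreserving σ volume volume) : L2 →ₗᵢ[ℂ] L2 :=
  Lp.compMeasurePreservingₗᵢ ℂ σ hσ

theorem coeFn_compOp (σ : Torus2 → Torus2) (hσ : MeasurePreserving σ volume volume) (f : L2) :
    compOp σ hσ f =ᵐ[volume] fun p => f (σ p) :=
  Lp.coeFn_compMeasurePreserving f hσ

theorem compOp_eq_iff (σ : Torus2 → Torus2) (hσ : MeasurePreserving σ volume volume) (f : L2) :
    compOp σ hσ f = f ↔ ∀ᵐ p, f (σ p) = f p := by
  constructor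
  · intro h
    filter_upwards [coeFn_compOp σ hσ f] with p hp
    rw [← hp, h]
  · intro h
    apply Lp.ext
    filter_upwards [coeFn_compOp σ hσ f, h] with p hp hq
    rw [hp, hq]

/-- The space `L^{2,ees}(𝕋²)` of the functions `f ∈ L²(𝕋²)` with
`f(-p) = f(p)` and `f(p₁,p₂) = f(p₂,p₁) = f(-p₁,p₂)`. -/
def L2ees : Submodule ℂ L2 where
  carrier := {f | (∀ᵐ p : Torus2, f (-p) = f p) ∧ (∀ᵐ p : Torus2, f (p.2, p.1) = f p) ∧
    ∀ᵐ p : Torus2, f (-p.1, p.2) = f p}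
  zero_mem' := by
    refine ⟨?_, ?_, ?_⟩
    · exact (compOp_eq_iff _ mp_neg 0).1 (map_zero _)
    · exact (compOp_eq_iff _ mp_swap 0).1 (map_zero _)
    · exact (compOp_eq_iff _ mp_refl 0).1 (map_zero _)
  add_mem' := by
    rintro f g ⟨h1, h2, h3⟩ ⟨k1, k2, k3⟩
    rw [← compOp_eq_iff _ mp_neg] at h1 k1
    rw [← compOp_eq_iff _ mp_swap] at h2 k2
    rw [← compOp_eq_iff _ mp_refl] at h3 k3
    refine ⟨?_, ?_, ?_⟩
    · exact (compOp_eq_iff _ mp_neg _).1 (by rw [map_add, h1, k1])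
    · exact (compOp_eq_iff _ mp_swap _).1 (by rw [map_add, h2, k2])
    · exact (compOp_eq_iff _ mp_refl _).1 (by rw [map_add, h3, k3])
  smul_mem' := by
    rintro c f ⟨h1, h2, h3⟩
    rw [← compOp_eq_iff _ mp_neg] at h1
    rw [← compOp_eq_iff _ mp_swap] at h2
    rw [← compOp_eq_iff _ mp_refl] at h3
    refine ⟨?_, ?_, ?_⟩
    · exact (compOp_eq_iff _ mp_neg _).1 (by rw [map_smul, h1])
    · exact (compOp_eq_iff _ mp_swap _).1 (by rw [map_smul, h2])
    · exact (compOp_eq_iff _ mp_refl _).1 (by rw [map_smul, h3])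

theorem mem_L2ees (f : L2) : f ∈ L2ees ↔
    compOp _ mp_neg f = f ∧ compOp _ mp_swap f = f ∧ compOp _ mp_refl f = f := by
  rw [compOp_eq_iff, compOp_eq_iff, compOp_eq_iff]
  rfl

theorem compOp_toL2 (σ : Torus2 → Torus2) (hσ : MeasurePreserving σ volume volume)
    (φ ψ : C(Torus2, ℝ)) (h : ∀ p, φ (σ p) = ψ p) : compOp σ hσ (toL2 φ) = toL2 ψ := by
  apply Lp.ext
  filter_upwards [coeFn_compOp σ hσ (toL2 φ), coeFn_toL2 ψ,
    hσ.quasiMeasurePreserving.ae (coeFn_toL2 φ)] with p h1 h2 h3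
  rw [h1, h2, h3, h]

theorem compOp_intOp (σ : Torus2 → Torus2) (hσ : MeasurePreserving σ volume volume)
    (φ ψ : C(Torus2, ℝ)) (h : ∀ p, φ (σ p) = ψ p) (f : L2) (hf : compOp σ hσ f = f) :
    compOp σ hσ (intOp φ f) = intOp ψ f := by
  have h1 : inner ℂ (toL2 ψ) f = inner ℂ (toL2 φ) f := by
    rw [← compOp_toL2 σ hσ φ ψ h]
    nth_rewrite 1 [← hf]
    exact (compOp σ hσ).inner_map_map _ _
  change compOp σ hσ (inner ℂ (toL2 φ) f • toL2 φ) = inner ℂ (toL2 ψ) f • toL2 ψ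
  rw [map_smul, compOp_toL2 σ hσ φ ψ h, h1]

theorem compOp_mulOp (σ : Torus2 → Torus2) (hσ : MeasurePreserving σ volume volume)
    (φ : C(Torus2, ℝ)) (h : ∀ p, φ (σ p) = φ p) (f : L2) (hf : compOp σ hσ f = f) :
    compOp σ hσ (mulOp φ f) = mulOp φ f := by
  rw [compOp_eq_iff] at hf ⊢
  filter_upwards [hf, coeFn_mulOp φ f, hσ.quasiMeasurePreserving.ae (coeFn_mulOp φ f)]
    with p h1 h2 h3
  rw [h2, h3, h, h1]

theorem intOp_neg (φ : C(Torus2, ℝ)) : intOp (-φ) = intOp φ := by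
  have h : toL2 (-φ) = -toL2 φ := by
    apply Lp.ext
    filter_upwards [coeFn_toL2 (-φ), coeFn_toL2 φ, Lp.coeFn_neg (toL2 φ)] with p h1 h2 h3
    rw [h1, h3, Pi.neg_apply, h2]
    simp
  ext1 f
  simp only [intOp, h, ContinuousLinearMap.smulRight_apply, innerSL_apply_apply, inner_neg_left,
    smul_neg, neg_smul, neg_neg]

/-- `L^{2,ees}(𝕋²)` is invariant under the Hamiltonian. -/
theorem hamiltonian_mem (γ lam μ : ℝ) (f : L2) (hf : f ∈ L2ees) :
    hamiltonian γ lam μ f ∈ L2ees := by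
  rw [mem_L2ees] at hf ⊢
  obtain ⟨h1, h2, h3⟩ := hf
  refine ⟨?_, ?_, ?_⟩
  · simp only [hamiltonian, potential, add_apply,
      smul_apply, map_add, map_smul]
    rw [compOp_mulOp _ mp_neg dispersion (by intro p; simp [dispersion]) f h1,
      compOp_intOp _ mp_neg 1 1 (by intro p; simp) f h1,
      compOp_intOp _ mp_neg cosFst cosFst (by intro p; simp [cosFst]) f h1,
      compOp_intOp _ mp_neg cosSnd cosSnd (by intro p; simp [cosSnd]) f h1,
      compOp_intOp _ mp_neg cosTwoFst cosTwoFst (by intro p; simp [cosTwoFst]) f h1,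
      compOp_intOp _ mp_neg cosTwoSnd cosTwoSnd (by intro p; simp [cosTwoSnd]) f h1,
      compOp_intOp _ mp_neg cosCos cosCos (by intro p; simp [cosCos]) f h1,
      compOp_intOp _ mp_neg sinSin sinSin (by intro p; simp [sinSin]) f h1]
  · simp only [hamiltonian, potential, add_apply,
      smul_apply, map_add, map_smul]
    rw [compOp_mulOp _ mp_swap dispersion (by intro p; simp [dispersion]; ring) f h2,
      compOp_intOp _ mp_swap 1 1 (by intro p; simp) f h2,
      compOp_intOp _ mp_swap cosFst cosSnd (by intro p; simp [cosFst, cosSnd]) f h2,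
      compOp_intOp _ mp_swap cosSnd cosFst (by intro p; simp [cosFst, cosSnd]) f h2,
      compOp_intOp _ mp_swap cosTwoFst cosTwoSnd
        (by intro p; simp [cosTwoFst, cosTwoSnd]) f h2,
      compOp_intOp _ mp_swap cosTwoSnd cosTwoFst
        (by intro p; simp [cosTwoFst, cosTwoSnd]) f h2,
      compOp_intOp _ mp_swap cosCos cosCos (by intro p; simp [cosCos, mul_comm]) f h2,
      compOp_intOp _ mp_swap sinSin sinSin (by intro p; simp [sinSin, mul_comm]) f h2,
      add_comm (intOp cosSnd f), add_comm (intOp cosTwoSnd f)]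
  · simp only [hamiltonian, potential, add_apply,
      smul_apply, map_add, map_smul]
    rw [compOp_mulOp _ mp_refl dispersion (by intro p; simp [dispersion]) f h3,
      compOp_intOp _ mp_refl 1 1 (by intro p; simp) f h3,
      compOp_intOp _ mp_refl cosFst cosFst (by intro p; simp [cosFst]) f h3,
      compOp_intOp _ mp_refl cosSnd cosSnd (by intro p; simp [cosSnd]) f h3,
      compOp_intOp _ mp_refl cosTwoFst cosTwoFst (by intro p; simp [cosTwoFst]) f h3,
      compOp_intOp _ mp_refl cosTwoSnd cosTwoSnd (by intro p; simp [cosTwoSnd]) f h3,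
      compOp_intOp _ mp_refl cosCos cosCos (by intro p; simp [cosCos]) f h3,
      compOp_intOp _ mp_refl sinSin (-sinSin) (by intro p; simp [sinSin]) f h3,
      intOp_neg]

/-- The operator `H^{ees}_{γλμ}(0)`: the restriction of the Hamiltonian to `L^{2,ees}(𝕋²)`. -/
def hamiltonianEes (γ lam μ : ℝ) : L2ees →L[ℂ] L2ees :=
  (hamiltonian γ lam μ).restrict (hamiltonian_mem γ lam μ)

/-! ### Eigenvalues outside the essential spectrum -/

section Spectrum

variable {E : Type*} [NormedAddCommGroup E] [InnerProductSpace ℂ E]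

/-- The essential spectrum: the set of `z` for which `T - z` is not Fredholm. -/
def essentialSpectrum (T : E →L[ℂ] E) : Set ℂ :=
  {z | ¬ (T - z • ContinuousLinearMap.id ℂ E).IsFredholm}

/-- The real numbers lying below the essential spectrum. -/
def belowEss (T : E →L[ℂ] E) : Set ℝ := {x | ∀ w ∈ essentialSpectrum T, x < w.re}

/-- The real numbers lying above the essential spectrum. -/
def aboveEss (T : E →L[ℂ] E) : Set ℝ := {x | ∀ w ∈ essentialSpectrum T, w.re < x}

/-- The number of eigenvalues of `T` in `S ⊆ ℝ` counted with multiplicity: the sum over `x ∈ S`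
of the dimension of the eigenspace of `x` (which is `0` if `x` is not an eigenvalue). -/
def eigenvalueCount (T : E →L[ℂ] E) (S : Set ℝ) : Cardinal :=
  Cardinal.sum fun x : S => Module.rank ℂ (Module.End.eigenspace (T : E →ₗ[ℂ] E) ((x : ℝ) : ℂ))

end Spectrum

/-! ### The components of the space of coupling constants

Points of the plane are pairs `(λ, μ)`, points of the space are triples `(γ, λ, μ)`. -/

/-- `μ₀⁻ = -7.7170…` -/
def mu0Minus : ℝ :=
  (-80 + 24 * π - √(666 * π ^ 2 - 4128 * π + 6400)) / (3 * (16 - 5 * π))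

/-- `μ₀⁺ = -2.7880…` -/
def mu0Plus : ℝ :=
  (-80 + 24 * π + √(666 * π ^ 2 - 4128 * π + 6400)) / (3 * (16 - 5 * π))

/-- `μ₁⁻ = -7.2646…` -/
def mu1Minus : ℝ :=
  (-80 + 21 * π - √(801 * π ^ 2 - 4512 * π + 6400)) / (12 * (16 - 5 * π))

/-- `μ₁⁺ = -0.7404…` -/
def mu1Plus : ℝ :=
  (-80 + 21 * π + √(801 * π ^ 2 - 4512 * π + 6400)) / (12 * (16 - 5 * π))

/-- `Q₀⁻(μ)`. -/
def Q0Minus (μ : ℝ) : ℝ := (16 - 5 * π) / (4 * π) * (μ - mu0Minus) * (μ - mu0Plus)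

/-- `Q₁⁻(μ)`. -/
def Q1Minus (μ : ℝ) : ℝ := 2 * (16 - 5 * π) / π * (μ - mu1Minus) * (μ - mu1Plus)

/-- `Q₀⁺(μ)`. -/
def Q0Plus (μ : ℝ) : ℝ := (16 - 5 * π) / (4 * π) * (μ + mu0Minus) * (μ + mu0Plus)

/-- `Q₁⁺(μ)`. -/
def Q1Plus (μ : ℝ) : ℝ := 2 * (16 - 5 * π) / π * (μ + mu1Minus) * (μ + mu1Plus)

/-- `λ⁻(μ)`, used only where `Q₀⁻(μ) ≠ 0`. -/
def lambdaMinus (μ : ℝ) : ℝ := -(Q1Minus μ / Q0Minus μ)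

/-- `λ⁺(μ)`, used only where `Q₀⁺(μ) ≠ 0`. -/
def lambdaPlus (μ : ℝ) : ℝ := Q1Plus μ / Q0Plus μ

/-- `γ⁻(λ, μ)`, used only where the denominator is nonzero. -/
def gammaMinus (lam μ : ℝ) : ℝ := 8 * Q0Minus μ / (lam * Q0Minus μ + Q1Minus μ) - 4

/-- `γ⁺(λ, μ)`, used only where the denominator is nonzero. -/
def gammaPlus (lam μ : ℝ) : ℝ := 8 * Q0Plus μ / (lam * Q0Plus μ - Q1Plus μ) + 4

/-- The intervals `I⁻₁, I⁻₂, I⁻₃` (indexed from `0`). -/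
def IMinus : Fin 3 → Set ℝ
  | 0 => Set.Ioi mu0Plus
  | 1 => Set.Ioo mu0Minus mu0Plus
  | 2 => Set.Iio mu0Minus

/-- The intervals `I⁺₁, I⁺₂, I⁺₃` (indexed from `0`). -/
def IPlus : Fin 3 → Set ℝ
  | 0 => Set.Iio (-mu0Plus)
  | 1 => Set.Ioo (-mu0Plus) (-mu0Minus)
  | 2 => Set.Ioi (-mu0Minus)

/-- The curves `τ⁻₁, τ⁻₂, τ⁻₃` (indexed from `0`). -/
def tauMinus (j : Fin 3) : Set (ℝ × ℝ) := {x | x.1 = lambdaMinus x.2 ∧ x.2 ∈ IMinus j}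

/-- The curves `τ⁺₁, τ⁺₂, τ⁺₃` (indexed from `0`). -/
def tauPlus (j : Fin 3) : Set (ℝ × ℝ) := {x | x.1 = lambdaPlus x.2 ∧ x.2 ∈ IPlus j}

/-- The plane regions `D⁻₁, D⁻₂, D⁻₃, D⁻₄` (indexed from `0`). -/
def DMinus : Fin 4 → Set (ℝ × ℝ)
  | 0 => {x | x.1 > lambdaMinus x.2 ∧ x.2 ∈ IMinus 0}
  | 1 => {x | x.1 < lambdaMinus x.2 ∧ x.2 ∈ IMinus 0} ∪ {x | x.2 = mu0Plus} ∪
      {x | x.1 > lambdaMinus x.2 ∧ x.2 ∈ IMinus 1}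
  | 2 => {x | x.1 < lambdaMinus x.2 ∧ x.2 ∈ IMinus 1} ∪ {x | x.2 = mu0Minus} ∪
      {x | x.1 > lambdaMinus x.2 ∧ x.2 ∈ IMinus 2}
  | 3 => {x | x.1 < lambdaMinus x.2 ∧ x.2 ∈ IMinus 2}

/-- The plane regions `D⁺₁, D⁺₂, D⁺₃, D⁺₄` (indexed from `0`): the images of the regions `D⁻ⱼ`
under reflection in the origin. -/
def DPlus : Fin 4 → Set (ℝ × ℝ)
  | 0 => {x | x.1 < lambdaPlus x.2 ∧ x.2 ∈ IPlus 0}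
  | 1 => {x | x.1 > lambdaPlus x.2 ∧ x.2 ∈ IPlus 0} ∪ {x | x.2 = -mu0Plus} ∪
      {x | x.1 < lambdaPlus x.2 ∧ x.2 ∈ IPlus 1}
  | 2 => {x | x.1 > lambdaPlus x.2 ∧ x.2 ∈ IPlus 1} ∪ {x | x.2 = -mu0Minus} ∪
      {x | x.1 < lambdaPlus x.2 ∧ x.2 ∈ IPlus 2}
  | 3 => {x | x.1 > lambdaPlus x.2 ∧ x.2 ∈ IPlus 2}

/-- The part of the cylinder over `D` lying above the graph of `g`. -/
def aboveGraph (g : ℝ → ℝ → ℝ) (D : Set (ℝ × ℝ)) : Set (ℝ × ℝ × ℝ) :=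
  {x | x.1 > g x.2.1 x.2.2 ∧ x.2 ∈ D}

/-- The part of the cylinder over `D` lying below the graph of `g`. -/
def belowGraph (g : ℝ → ℝ → ℝ) (D : Set (ℝ × ℝ)) : Set (ℝ × ℝ × ℝ) :=
  {x | x.1 < g x.2.1 x.2.2 ∧ x.2 ∈ D}

/-- The components `𝓒⁻₀, …, 𝓒⁻₄` of the `(γ, λ, μ)`-space. -/
def CMinus : Fin 5 → Set (ℝ × ℝ × ℝ)
  | 0 => aboveGraph gammaMinus (DMinus 0)
  | 1 => belowGraph gammaMinus (DMinus 0) ∪ {x | x.2 ∈ tauMinus 0} ∪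
      aboveGraph gammaMinus (DMinus 1)
  | 2 => belowGraph gammaMinus (DMinus 1) ∪ {x | x.2 ∈ tauMinus 1} ∪
      aboveGraph gammaMinus (DMinus 2)
  | 3 => belowGraph gammaMinus (DMinus 2) ∪ {x | x.2 ∈ tauMinus 2} ∪
      aboveGraph gammaMinus (DMinus 3)
  | 4 => belowGraph gammaMinus (DMinus 3)

/-- The components `𝓒⁺₀, …, 𝓒⁺₄` of the `(γ, λ, μ)`-space: the images of the components `𝓒⁻_ζ`
under reflection in the origin. -/
def CPlus : Fin 5 → Set (ℝ × ℝ × ℝ)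
  | 0 => belowGraph gammaPlus (DPlus 0)
  | 1 => aboveGraph gammaPlus (DPlus 0) ∪ {x | x.2 ∈ tauPlus 0} ∪
      belowGraph gammaPlus (DPlus 1)
  | 2 => aboveGraph gammaPlus (DPlus 1) ∪ {x | x.2 ∈ tauPlus 1} ∪
      belowGraph gammaPlus (DPlus 2)
  | 3 => aboveGraph gammaPlus (DPlus 2) ∪ {x | x.2 ∈ tauPlus 2} ∪
      belowGraph gammaPlus (DPlus 3)
  | 4 => aboveGraph gammaPlus (DPlus 3)

end LatticeBosons

end

/-!
The number of eigenvalues below the essential spectrum is found from a variational principle at the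
threshold `0`.

On `L^{2,ees}(𝕋²)` the kinetic energy, multiplication by `𝓔₀ ≥ 0`, is a positive operator and the
interaction has finite rank. Hence the essential spectrum lies in the right half-plane; it contains
`0`, because functions supported near the minimum of `𝓔₀` form spaces of any dimension on which the
kinetic energy is arbitrarily small. So the eigenvalues in question are the negative ones
(`belowEss_hamiltonianEes`).

By symmetry the interaction depends on `f` only through its normalized moments `u₀, u₁, u₂, u₃`
against `1`, `cos p₁`, `cos 2p₁`, `cos p₁ cos p₂`. These determine the moments of `f` against
`𝓔₀ φ` for `φ = 1`, `φ = cos p₁ + cos p₂` and `φ = (cos p₁ - cos p₂)² / 𝓔₀`, since each of these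
products is a combination of the four functions above. By the Cauchy–Schwarz inequality for the
kinetic energy, the latter is at least that of the combination of the three functions `φ` with the
same moments against `𝓔₀ φ` (`kinetic_lower_bound`). Thus the energy of `f` is bounded below by a
quadratic form in `u₀, u₁, u₂, u₃`, the threshold form (`thresholdForm_le`). The bound is sharp: in
dimension two `(𝓔₀ + ε²)⁻¹`, normalized to have mean `1`, approaches a point mass at `p = 0` while
its kinetic energy tends to `0`, because `∫ 𝓔₀⁻¹` diverges; adding multiples of it to combinations
of the three functions `φ` exhausts the four moments (`tendsto_trial`). For a finite rank
perturbation of a positive operator such a sharp lower bound forces the number of negative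
eigenvalues to be the negative index of the form (`eigenvalueCount_eq`).

The threshold form involves one number which is not elementary a priori,
`κ = (4π²)⁻¹ ∫ (cos p₁ - cos p₂)⁴ / 𝓔₀`, equal to `128 / (3π) - 13` (`integral_ratio`). Elimination
of two of the variables leaves a Schur complement with matrix
`(2 (λ - λ⁻(μ)), -4; -4, 4 + γ)`, whose index depends on the position of `γ` relative to
`γ⁻(λ, μ)`, while the index of the eliminated block is read off from the signs of its determinant, a
positive multiple of `Q₀⁻(μ)`, and of `12 + 4μ`. Where `Q₀⁻(μ) = 0` another pair of variables is
eliminated. This gives the index `ζ` on `𝓒⁻_ζ` (`hasIndex_thresholdForm`).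

The eigenvalues above the essential spectrum are reduced to those below it: translation of the torus
by `(π, π)` replaces `𝓔₀` by `8 - 𝓔₀` and preserves the interaction, so it turns `H_{γλμ}` into
`8 - H_{-γ,-λ,-μ}` (`shiftEes_hamiltonianEes`).
-/

noncomputable section

namespace LatticeBosons

/-! ### The negative index of a real symmetric matrix -/

section MatrixIndex

open Matrix

variable {ι κ : Type*} [Fintype ι] [DecidableEq ι] [Fintype κ] [DecidableEq κ]

/-- A real symmetric matrix `A` is nondegenerate with negative index `k`: after an invertible
linear change of variables its quadratic form is diagonal, with nonzero coefficients of which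
exactly `k` are negative. -/
def HasIndex (A : Matrix ι ι ℝ) (k : ℕ) : Prop :=
  ∃ (P : Matrix ι ι ℝ) (s : ι → ℝ), P.det ≠ 0 ∧ (∀ i, s i ≠ 0) ∧
    A = Pᵀ * diagonal s * P ∧ (Finset.univ.filter fun i => s i < 0).card = k

theorem HasIndex.of_submatrix {A : Matrix ι ι ℝ} {k : ℕ} (e : κ ≃ ι)
    (h : HasIndex (A.submatrix e e) k) : HasIndex A k := by
  obtain ⟨P, s, hP, hs, hA, hk⟩ := h
  refine ⟨P.submatrix e.symm e.symm, s ∘ e.symm, ?_, fun i => hs _, ?_, ?_⟩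
  · rwa [det_submatrix_equiv_self]
  · have h1 : A = (A.submatrix e e).submatrix e.symm e.symm := by
      ext i j; simp
    rw [h1, hA, ← submatrix_mul_equiv _ _ _ e.symm, ← submatrix_mul_equiv _ _ _ e.symm,
      transpose_submatrix, submatrix_diagonal_equiv]
  · rw [← hk]
    refine Finset.card_bij (fun i _ => e.symm i) ?_ ?_ ?_
    · intro i hi; simpa using hi
    · intro i _ j _ h; exact e.symm.injective h
    · intro j hj; exact ⟨e j, by simpa using hj, by simp⟩

theorem HasIndex.smul {A : Matrix ι ι ℝ} {k : ℕ} (h : HasIndex A k) {c : ℝ} (hc : 0 < c) :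
    HasIndex (c • A) k := by
  obtain ⟨P, s, hP, hs, hA, hk⟩ := h
  refine ⟨P, c • s, hP, fun i => mul_ne_zero hc.ne' (hs i), ?_, ?_⟩
  · rw [hA, Matrix.diagonal_smul, Matrix.mul_smul, Matrix.smul_mul]
  · rw [← hk]
    congr 1
    ext i
    simp [mul_neg_iff, hc, hc.not_gt]

/-- Block elimination: the index of a block matrix is the sum of the indices of its first diagonal
block and of the Schur complement of that block. -/
theorem HasIndex.fromBlocks {A : Matrix ι ι ℝ} {C : Matrix ι κ ℝ} {D : Matrix κ κ ℝ} {k l : ℕ}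
    (hA : HasIndex A k) (hS : HasIndex (D - Cᵀ * A⁻¹ * C) l) :
    HasIndex (Matrix.fromBlocks A C Cᵀ D) (k + l) := by
  obtain ⟨P, s, hP, hs, hPA, hk⟩ := hA
  obtain ⟨R, r, hR, hr, hRS, hl⟩ := hS
  have hAt : Aᵀ = A := by
    rw [hPA]; simp [transpose_mul, Matrix.mul_assoc]
  have hu : IsUnit A.det := by
    rw [hPA, det_mul, det_mul, det_transpose, det_diagonal]
    exact isUnit_iff_ne_zero.2
      (mul_ne_zero (mul_ne_zero hP (Finset.prod_ne_zero_iff.2 fun i _ => hs i)) hP)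
  have hAit : (A⁻¹)ᵀ = A⁻¹ := by rw [transpose_nonsing_inv, hAt]
  refine ⟨Matrix.fromBlocks P (P * (A⁻¹ * C)) 0 R, Sum.elim s r, ?_, ?_, ?_, ?_⟩
  · rw [det_fromBlocks_zero₂₁]
    exact mul_ne_zero hP hR
  · rintro (i | i)
    · exact hs i
    · exact hr i
  · have hd : diagonal (Sum.elim s r) = Matrix.fromBlocks (diagonal s) 0 0 (diagonal r) := by
      rw [fromBlocks_diagonal]
    have h1 : A * (A⁻¹ * C) = C := by rw [← Matrix.mul_assoc, mul_nonsing_inv _ hu, Matrix.one_mul]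
    have h2 : Pᵀ * diagonal s * (P * (A⁻¹ * C)) = C := by
      rw [← Matrix.mul_assoc, ← hPA, h1]
    have h3 : (P * (A⁻¹ * C))ᵀ * diagonal s * P = Cᵀ := by
      have := congrArg transpose h2
      simpa [transpose_mul, Matrix.mul_assoc] using this
    have h4 : (P * (A⁻¹ * C))ᵀ * diagonal s * (P * (A⁻¹ * C)) = Cᵀ * A⁻¹ * C := by
      rw [← Matrix.mul_assoc _ P, h3, Matrix.mul_assoc]
    rw [hd, fromBlocks_transpose, fromBlocks_multiply, fromBlocks_multiply]
    simp only [Matrix.mul_zero, Matrix.zero_mul, add_zero, zero_add, transpose_zero]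
    rw [← hPA, h2, h3, h4, ← hRS]
    simp
  · rw [← hk, ← hl]
    simp only [Finset.card_filter, Fintype.sum_sum_type, Sum.elim_inl, Sum.elim_inr]
    congr

theorem hasIndex_two_of_pos {a b d : ℝ} (ha : 0 < a) (h : 0 < a * d - b ^ 2) :
    HasIndex !![a, b; b, d] 0 := by
  have hs : 0 < d - b ^ 2 / a := by
    have : d - b ^ 2 / a = (a * d - b ^ 2) / a := by field_simp
    rw [this]; positivity
  refine ⟨!![1, b / a; 0, 1], ![a, d - b ^ 2 / a], by simp [det_fin_two], ?_, ?_, ?_⟩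
  · intro i; fin_cases i
    · exact ha.ne'
    · exact hs.ne'
  · ext i j
    fin_cases i <;> fin_cases j <;> simp [Matrix.mul_apply, Fin.sum_univ_two, diagonal_apply] <;>
      field_simp
    ring
  · rw [Finset.card_eq_zero, Finset.filter_eq_empty_iff]
    intro i _; fin_cases i
    · exact not_lt.2 ha.le
    · exact not_lt.2 hs.le

theorem hasIndex_two_of_neg {a b d : ℝ} (ha : a < 0) (h : 0 < a * d - b ^ 2) :
    HasIndex !![a, b; b, d] 2 := by
  have hs : d - b ^ 2 / a < 0 := by
    have : d - b ^ 2 / a = (a * d - b ^ 2) / a := by have := ha.ne; field_simp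
    rw [this]; exact div_neg_of_pos_of_neg h ha
  have ha' := ha.ne
  refine ⟨!![1, b / a; 0, 1], ![a, d - b ^ 2 / a], by simp [det_fin_two], ?_, ?_, ?_⟩
  · intro i; fin_cases i
    · exact ha.ne
    · exact hs.ne
  · ext i j
    fin_cases i <;> fin_cases j <;> simp [Matrix.mul_apply, Fin.sum_univ_two, diagonal_apply] <;>
      field_simp
    ring
  · rw [Finset.filter_true_of_mem]
    · rfl
    · intro i _; fin_cases i
      · exact ha
      · exact hs

theorem hasIndex_two_of_det_neg {a b d : ℝ} (h : a * d - b ^ 2 < 0) :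
    HasIndex !![a, b; b, d] 1 := by
  rcases eq_or_ne a 0 with rfl | ha
  · have hb : b ≠ 0 := by rintro rfl; simp at h
    -- the form is `y (2bx + dy)`, and `uv = ((u + v)² - (u - v)²) / 4`
    refine ⟨!![2 * b, d + 1; 2 * b, d - 1], ![1 / 4, -(1 / 4)], ?_, ?_, ?_, ?_⟩
    · rw [det_fin_two_of]
      have : 2 * b * (d - 1) - (d + 1) * (2 * b) = -4 * b := by ring
      rw [this]; simpa using hb
    · intro i; fin_cases i <;> norm_num
    · ext i j
      fin_cases i <;> fin_cases j <;>
        simp [Matrix.mul_apply, Fin.sum_univ_two, diagonal_apply] <;> ring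
    · rw [Finset.card_eq_one]
      refine ⟨1, ?_⟩
      ext i; fin_cases i <;> norm_num
  · have hs : d - b ^ 2 / a = (a * d - b ^ 2) / a := by field_simp
    refine ⟨!![1, b / a; 0, 1], ![a, d - b ^ 2 / a], by simp [det_fin_two], ?_, ?_, ?_⟩
    · intro i; fin_cases i
      · exact ha
      · exact hs ▸ div_ne_zero h.ne ha
    · ext i j
      fin_cases i <;> fin_cases j <;> simp [Matrix.mul_apply, Fin.sum_univ_two, diagonal_apply] <;>
        field_simp
      ring
    · rw [Finset.card_eq_one]
      rcases lt_or_gt_of_ne ha with h0 | h0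
      · have : 0 < d - b ^ 2 / a := hs ▸ div_pos_of_neg_of_neg h h0
        refine ⟨0, ?_⟩
        ext i; fin_cases i
        · simpa using h0
        · simpa using this.le
      · have : d - b ^ 2 / a < 0 := hs ▸ div_neg_of_neg_of_pos h h0
        refine ⟨1, ?_⟩
        ext i; fin_cases i
        · simpa using h0.le
        · simpa using this

end MatrixIndex

/-! ### The threshold form and its index -/

/-- The number `κ = (4π²)⁻¹ ∫ (cos p₁ - cos p₂)⁴ / 𝓔₀(p) dp`. -/
def kap : ℝ := 128 / (3 * π) - 13

/-- The coefficient of `d²` in the threshold form. -/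
def blockP (μ : ℝ) : ℝ := kap + 1 + 2 * μ * ((5 * kap ^ 2 - 6 * kap + 5) / 16)

/-- Half the coefficient of `d t` in the threshold form. -/
def blockQ (μ : ℝ) : ℝ := -4 + μ * ((kap - 3) / 2)

/-- The threshold form: a quadratic form in real variables `d, t, u₁, u₀`, in this order. Its value
is the infimum of `(4π²)⁻¹ ⟨H f, f⟩` over the functions `f` whose normalized moments against `1`,
`cos p₁`, `cos 2p₁`, `cos p₁ cos p₂` are `u₀`, `u₁`, `(κ - 1) d / 2 + t` and
`-(κ + 1) d / 4 + t`. -/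
def thresholdForm (γ lam μ : ℝ) : Matrix (Fin 4) (Fin 4) ℝ :=
  !![blockP μ, blockQ μ, 4, 0;
    blockQ μ, 12 + 4 * μ, -12, 0;
    4, -12, 16 + 2 * lam, -4;
    0, 0, -4, 4 + γ]

theorem five_pi_lt : 5 * π < 16 := by linarith [Real.pi_lt_d2]

theorem three_kap_sub_one_pos : 0 < 3 * kap - 1 := by
  have h : 3 * kap - 1 = 8 * (16 - 5 * π) / π := by
    unfold kap; field_simp; ring
  rw [h]
  have := five_pi_lt
  have := Real.pi_pos
  apply div_pos <;> linarith

theorem disc0_nonneg : 0 ≤ 666 * π ^ 2 - 4128 * π + 6400 := by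
  nlinarith [sq_nonneg (666 * π - 2064)]

theorem disc1_nonneg : 0 ≤ 801 * π ^ 2 - 4512 * π + 6400 := by
  nlinarith [sq_nonneg (801 * π - 2256)]

theorem Q0Minus_eq (μ : ℝ) :
    Q0Minus μ = 1 / 2 + (40 / (3 * π) - 4) * μ + (4 / π - 5 / 4) * μ ^ 2 := by
  have hs := Real.sq_sqrt disc0_nonneg
  have h1 : (16 - 5 * π) ≠ 0 := by linarith [five_pi_lt]
  have h2 := Real.pi_ne_zero
  unfold Q0Minus mu0Minus mu0Plus
  set s := √(666 * π ^ 2 - 4128 * π + 6400)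
  have h3 : (16 - 5 * π) / (4 * π) * (μ - (-80 + 24 * π - s) / (3 * (16 - 5 * π))) *
      (μ - (-80 + 24 * π + s) / (3 * (16 - 5 * π))) =
      ((3 * (16 - 5 * π) * μ - (-80 + 24 * π)) ^ 2 - s ^ 2) / (36 * π * (16 - 5 * π)) := by
    field_simp; ring
  rw [h3, hs]
  field_simp; ring

theorem Q1Minus_eq (μ : ℝ) :
    Q1Minus μ = 1 + (80 / (3 * π) - 7) * μ + 2 * (16 - 5 * π) / π * μ ^ 2 := by
  have hs := Real.sq_sqrt disc1_nonneg
  have h1 : (16 - 5 * π) ≠ 0 := by linarith [five_pi_lt]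
  have h2 := Real.pi_ne_zero
  unfold Q1Minus mu1Minus mu1Plus
  set s := √(801 * π ^ 2 - 4512 * π + 6400)
  have h3 : 2 * (16 - 5 * π) / π * (μ - (-80 + 21 * π - s) / (12 * (16 - 5 * π))) *
      (μ - (-80 + 21 * π + s) / (12 * (16 - 5 * π))) =
      ((12 * (16 - 5 * π) * μ - (-80 + 21 * π)) ^ 2 - s ^ 2) / (72 * π * (16 - 5 * π)) := by
    field_simp; ring
  rw [h3, hs]
  field_simp; ring

theorem det_block (μ : ℝ) :
    blockP μ * (12 + 4 * μ) - blockQ μ ^ 2 = 8 * (3 * kap - 1) * Q0Minus μ := by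
  rw [Q0Minus_eq]
  unfold blockP blockQ kap
  have h2 := Real.pi_ne_zero
  field_simp; ring

theorem schur_numerator (μ : ℝ) :
    16 * (blockP μ * (12 + 4 * μ) - blockQ μ ^ 2) -
      (16 * (12 + 4 * μ) + 96 * blockQ μ + 144 * blockP μ) = 16 * (3 * kap - 1) * Q1Minus μ := by
  rw [Q1Minus_eq]
  unfold blockP blockQ kap
  have h2 := Real.pi_ne_zero
  field_simp; ring

theorem mu0Minus_le_mu0Plus : mu0Minus ≤ mu0Plus := by
  have h1 : 0 < 16 - 5 * π := by linarith [five_pi_lt]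
  have := Real.sqrt_nonneg (666 * π ^ 2 - 4128 * π + 6400)
  unfold mu0Minus mu0Plus
  gcongr
  linarith

theorem Q0Minus_coeff_pos : 0 < (16 - 5 * π) / (4 * π) := by
  have h1 : 0 < 16 - 5 * π := by linarith [five_pi_lt]
  have := Real.pi_pos
  positivity

/-- The number `-3`, where `12 + 4μ` changes sign, lies between the zeros of `Q₀⁻`. -/
theorem mu0_bounds : mu0Minus < -3 ∧ -3 < mu0Plus := by
  have h : Q0Minus (-3) < 0 := by
    have : Q0Minus (-3) = (5 * π - 16) / (4 * π) := by
      rw [Q0Minus_eq]; have := Real.pi_ne_zero; field_simp; ring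
    rw [this]
    exact div_neg_of_neg_of_pos (by linarith [five_pi_lt]) (by linarith [Real.pi_pos])
  have hle := mu0Minus_le_mu0Plus
  have hc := Q0Minus_coeff_pos
  unfold Q0Minus at h
  rw [mul_assoc] at h
  have h2 : (-3 - mu0Minus) * (-3 - mu0Plus) < 0 := by
    by_contra hn
    exact absurd h (not_lt.2 (mul_nonneg hc.le (not_lt.1 hn)))
  constructor <;> by_contra hn <;> nlinarith

theorem Q0Minus_mu0Plus : Q0Minus mu0Plus = 0 := by simp [Q0Minus]

theorem Q0Minus_mu0Minus : Q0Minus mu0Minus = 0 := by simp [Q0Minus]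

theorem Q0Minus_pos_of_gt {μ : ℝ} (h : mu0Plus < μ) : 0 < Q0Minus μ := by
  have hle := mu0Minus_le_mu0Plus
  have hc := Q0Minus_coeff_pos
  exact mul_pos (mul_pos hc (by linarith)) (by linarith)

theorem Q0Minus_pos_of_lt {μ : ℝ} (h : μ < mu0Minus) : 0 < Q0Minus μ := by
  have hle := mu0Minus_le_mu0Plus
  have hc := Q0Minus_coeff_pos
  exact mul_pos_of_neg_of_neg (mul_neg_of_pos_of_neg hc (by linarith)) (by linarith)

theorem Q0Minus_neg {μ : ℝ} (h : mu0Minus < μ) (h' : μ < mu0Plus) : Q0Minus μ < 0 := by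
  have hc := Q0Minus_coeff_pos
  exact mul_neg_of_pos_of_neg (mul_pos hc (by linarith)) (by linarith)

theorem hasIndex_swap {a b d : ℝ} {k : ℕ} (h : HasIndex !![d, b; b, a] k) :
    HasIndex !![a, b; b, d] k := by
  refine HasIndex.of_submatrix (Equiv.swap (0 : Fin 2) 1) ?_
  convert h using 1
  ext i j; fin_cases i <;> fin_cases j <;> rfl

theorem hasIndex_block_zero {μ : ℝ} (h : μ ∈ IMinus 0) :
    HasIndex !![blockP μ, blockQ μ; blockQ μ, 12 + 4 * μ] 0 := by
  have h' : mu0Plus < μ := h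
  refine hasIndex_swap (hasIndex_two_of_pos ?_ ?_)
  · linarith [mu0_bounds.2]
  · rw [mul_comm (12 + 4 * μ), det_block]
    have := three_kap_sub_one_pos
    have := Q0Minus_pos_of_gt h'
    positivity

theorem hasIndex_block_one {μ : ℝ} (h : μ ∈ IMinus 1) :
    HasIndex !![blockP μ, blockQ μ; blockQ μ, 12 + 4 * μ] 1 := by
  refine hasIndex_two_of_det_neg ?_
  rw [det_block]
  exact mul_neg_of_pos_of_neg (by linarith [three_kap_sub_one_pos]) (Q0Minus_neg h.1 h.2)

theorem hasIndex_block_two {μ : ℝ} (h : μ ∈ IMinus 2) :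
    HasIndex !![blockP μ, blockQ μ; blockQ μ, 12 + 4 * μ] 2 := by
  have h' : μ < mu0Minus := h
  refine hasIndex_swap (hasIndex_two_of_neg ?_ ?_)
  · linarith [mu0_bounds.1]
  · rw [mul_comm (12 + 4 * μ), det_block]
    have := three_kap_sub_one_pos
    have := Q0Minus_pos_of_lt h'
    positivity

theorem Q0Minus_ne_zero {μ : ℝ} {j : Fin 3} (h : μ ∈ IMinus j) : Q0Minus μ ≠ 0 := by
  fin_cases j
  · exact (Q0Minus_pos_of_gt h).ne'
  · exact (Q0Minus_neg h.1 h.2).ne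
  · exact (Q0Minus_pos_of_lt h).ne'

theorem hasIndex_block {μ : ℝ} {j : Fin 3} (h : μ ∈ IMinus j) :
    HasIndex !![blockP μ, blockQ μ; blockQ μ, 12 + 4 * μ] j := by
  fin_cases j
  · exact hasIndex_block_zero h
  · exact hasIndex_block_one h
  · exact hasIndex_block_two h

/-- Away from the zeros of `Q₀⁻`, the threshold form splits into its first block and a Schur
complement in which `λ` and `γ` enter only on the diagonal. -/
theorem hasIndex_thresholdForm_of_ne {γ lam μ : ℝ} {k l : ℕ} (hQ : Q0Minus μ ≠ 0)
    (hk : HasIndex !![blockP μ, blockQ μ; blockQ μ, 12 + 4 * μ] k)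
    (hl : HasIndex !![2 * (lam - lambdaMinus μ), -4; -4, 4 + γ] l) :
    HasIndex (thresholdForm γ lam μ) (k + l) := by
  refine HasIndex.of_submatrix (finSumFinEquiv (m := 2) (n := 2)) ?_
  have h3 := three_kap_sub_one_pos.ne'
  have hd := det_block μ
  have hn := schur_numerator μ
  have hdet : blockP μ * (12 + 4 * μ) - blockQ μ ^ 2 ≠ 0 := by
    rw [hd]; exact mul_ne_zero (mul_ne_zero (by norm_num) h3) hQ
  have h1 : (thresholdForm γ lam μ).submatrix (finSumFinEquiv (m := 2) (n := 2))
      (finSumFinEquiv (m := 2) (n := 2)) =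
      Matrix.fromBlocks !![blockP μ, blockQ μ; blockQ μ, 12 + 4 * μ] !![4, 0; -12, 0]
        (!![4, 0; -12, 0] : Matrix (Fin 2) (Fin 2) ℝ).transpose
        !![16 + 2 * lam, -4; -4, 4 + γ] := by
    ext (i | i) (j | j) <;> fin_cases i <;> fin_cases j <;> rfl
  rw [h1]
  refine HasIndex.fromBlocks hk ?_
  convert hl using 1
  have h2 : 2 * (lam - lambdaMinus μ) = 16 + 2 * lam -
      (16 * (12 + 4 * μ) + 96 * blockQ μ + 144 * blockP μ) /
        (blockP μ * (12 + 4 * μ) - blockQ μ ^ 2) := by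
    have h4 : (16 * (12 + 4 * μ) + 96 * blockQ μ + 144 * blockP μ) =
      16 * (blockP μ * (12 + 4 * μ) - blockQ μ ^ 2) - 16 * (3 * kap - 1) * Q1Minus μ := by
      linarith
    rw [h4, hd]
    unfold lambdaMinus
    field_simp
    ring
  rw [h2, Matrix.inv_def, Matrix.det_fin_two_of, Matrix.adjugate_fin_two_of, Ring.inverse_eq_inv,
    ← pow_two]
  ext i j
  fin_cases i <;> fin_cases j <;>
    simp [Matrix.mul_apply, Fin.sum_univ_two]
  field_simp
  ring

/-- At a zero of `Q₀⁻` the sign of `12 + 4μ` and the position of `γ` relative to `-4` determine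
the index, because the remaining two-dimensional part is a hyperbolic plane. -/
theorem hasIndex_thresholdForm_of_eq {γ lam μ : ℝ} {k : ℕ} (hQ : Q0Minus μ = 0)
    (hμ : μ ≠ -3) (hγ : γ ≠ -4)
    (hk : HasIndex !![12 + 4 * μ, 0; 0, 4 + γ] k) :
    HasIndex (thresholdForm γ lam μ) (k + 1) := by
  have h3 := three_kap_sub_one_pos.ne'
  have hd := det_block μ
  rw [hQ, mul_zero, sub_eq_zero] at hd
  have hμ0 : μ ≠ 0 := by
    rintro rfl; rw [Q0Minus_eq] at hQ; norm_num at hQ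
  have hτ : 12 + 4 * μ ≠ 0 := fun h => hμ (by linarith)
  have hγ' : 4 + γ ≠ 0 := fun h => hγ (by linarith)
  -- eliminate the coordinates of index `1` and `3` first
  let e : Fin 2 ⊕ Fin 2 ≃ Fin 4 :=
    finSumFinEquiv.trans ⟨![1, 3, 0, 2], ![2, 0, 3, 1], by decide, by decide⟩
  refine HasIndex.of_submatrix e ?_
  have h1 : (thresholdForm γ lam μ).submatrix e e =
      Matrix.fromBlocks !![12 + 4 * μ, 0; 0, 4 + γ] !![blockQ μ, -12; 0, -4]
        (!![blockQ μ, -12; 0, -4] : Matrix (Fin 2) (Fin 2) ℝ).transpose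
        !![blockP μ, 4; 4, 16 + 2 * lam] := by
    ext (i | i) (j | j) <;> fin_cases i <;> fin_cases j <;> rfl
  rw [h1]
  refine HasIndex.fromBlocks hk ?_
  have h2 : HasIndex !![0, 4 + 12 * blockQ μ / (12 + 4 * μ); 4 + 12 * blockQ μ / (12 + 4 * μ),
      16 + 2 * lam - (144 / (12 + 4 * μ) + 16 / (4 + γ))] 1 := by
    refine hasIndex_two_of_det_neg ?_
    have h4 : 4 + 12 * blockQ μ / (12 + 4 * μ) = 2 * μ * (3 * kap - 1) / (12 + 4 * μ) := by
      unfold blockQ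
      field_simp; ring
    have : 4 + 12 * blockQ μ / (12 + 4 * μ) ≠ 0 := by
      rw [h4]; exact div_ne_zero (mul_ne_zero (mul_ne_zero two_ne_zero hμ0) h3) hτ
    have := sq_pos_of_ne_zero this
    linarith
  convert h2 using 1
  rw [Matrix.inv_def, Matrix.det_fin_two_of, Matrix.adjugate_fin_two_of, Ring.inverse_eq_inv]
  ext i j
  fin_cases i <;> fin_cases j <;>
    simp [Matrix.mul_apply, Fin.sum_univ_two] <;> field_simp
  · linarith
  · ring

theorem hasIndex_schur_pos_above {γ x : ℝ} (hx : 0 < x) (h : 8 / x - 4 < γ) :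
    HasIndex !![2 * x, -4; -4, 4 + γ] 0 := by
  refine hasIndex_two_of_pos (by linarith) ?_
  have : 8 / x < 4 + γ := by linarith
  rw [div_lt_iff₀ hx] at this
  nlinarith

theorem hasIndex_schur_pos_below {γ x : ℝ} (hx : 0 < x) (h : γ < 8 / x - 4) :
    HasIndex !![2 * x, -4; -4, 4 + γ] 1 := by
  refine hasIndex_two_of_det_neg ?_
  have : 4 + γ < 8 / x := by linarith
  rw [lt_div_iff₀ hx] at this
  nlinarith

theorem hasIndex_schur_neg_above {γ x : ℝ} (hx : x < 0) (h : 8 / x - 4 < γ) :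
    HasIndex !![2 * x, -4; -4, 4 + γ] 1 := by
  refine hasIndex_two_of_det_neg ?_
  have : 8 / x < 4 + γ := by linarith
  rw [div_lt_iff_of_neg hx] at this
  nlinarith

theorem hasIndex_schur_neg_below {γ x : ℝ} (hx : x < 0) (h : γ < 8 / x - 4) :
    HasIndex !![2 * x, -4; -4, 4 + γ] 2 := by
  refine hasIndex_two_of_neg (by linarith) ?_
  have : 4 + γ < 8 / x := by linarith
  rw [lt_div_iff_of_neg hx] at this
  nlinarith

theorem gammaMinus_eq {lam μ : ℝ} (hQ : Q0Minus μ ≠ 0) :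
    gammaMinus lam μ = 8 / (lam - lambdaMinus μ) - 4 := by
  unfold gammaMinus lambdaMinus
  congr 1
  have : lam - -(Q1Minus μ / Q0Minus μ) = (lam * Q0Minus μ + Q1Minus μ) / Q0Minus μ := by
    field_simp; ring
  rw [this, div_div_eq_mul_div]

/-- The components `𝓒⁻_ζ` are regions of constant index of the threshold form. -/
theorem hasIndex_thresholdForm {γ lam μ : ℝ} {ζ : Fin 5} (h : (γ, lam, μ) ∈ CMinus ζ) :
    HasIndex (thresholdForm γ lam μ) ζ := by
  -- the five positions of `(γ, λ)` relative to the critical curves over one of the intervals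
  have pa : ∀ j : Fin 3, lam > lambdaMinus μ → μ ∈ IMinus j → γ > gammaMinus lam μ →
      HasIndex (thresholdForm γ lam μ) (j + 0) := fun j h1 h2 h3 =>
    hasIndex_thresholdForm_of_ne (Q0Minus_ne_zero h2) (hasIndex_block h2)
      (hasIndex_schur_pos_above (sub_pos.2 h1) (by rwa [← gammaMinus_eq (Q0Minus_ne_zero h2)]))
  have pb : ∀ j : Fin 3, lam > lambdaMinus μ → μ ∈ IMinus j → γ < gammaMinus lam μ →
      HasIndex (thresholdForm γ lam μ) (j + 1) := fun j h1 h2 h3 =>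
    hasIndex_thresholdForm_of_ne (Q0Minus_ne_zero h2) (hasIndex_block h2)
      (hasIndex_schur_pos_below (sub_pos.2 h1) (by rwa [← gammaMinus_eq (Q0Minus_ne_zero h2)]))
  have na : ∀ j : Fin 3, lam < lambdaMinus μ → μ ∈ IMinus j → γ > gammaMinus lam μ →
      HasIndex (thresholdForm γ lam μ) (j + 1) := fun j h1 h2 h3 =>
    hasIndex_thresholdForm_of_ne (Q0Minus_ne_zero h2) (hasIndex_block h2)
      (hasIndex_schur_neg_above (sub_neg.2 h1) (by rwa [← gammaMinus_eq (Q0Minus_ne_zero h2)]))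
  have nb : ∀ j : Fin 3, lam < lambdaMinus μ → μ ∈ IMinus j → γ < gammaMinus lam μ →
      HasIndex (thresholdForm γ lam μ) (j + 2) := fun j h1 h2 h3 =>
    hasIndex_thresholdForm_of_ne (Q0Minus_ne_zero h2) (hasIndex_block h2)
      (hasIndex_schur_neg_below (sub_neg.2 h1) (by rwa [← gammaMinus_eq (Q0Minus_ne_zero h2)]))
  have zz : ∀ j : Fin 3, lam = lambdaMinus μ → μ ∈ IMinus j →
      HasIndex (thresholdForm γ lam μ) (j + 1) := fun j h1 h2 =>
    hasIndex_thresholdForm_of_ne (Q0Minus_ne_zero h2) (hasIndex_block h2)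
      (hasIndex_two_of_det_neg (by rw [h1]; norm_num))
  -- over a zero of `Q₀⁻` the numerator in `γ⁻` vanishes, whatever the denominator is
  have g4 : Q0Minus μ = 0 → gammaMinus lam μ = -4 := fun h => by simp [gammaMinus, h]
  have qpa : μ = mu0Plus → γ > gammaMinus lam μ → HasIndex (thresholdForm γ lam μ) 1 := by
    rintro rfl h1
    rw [g4 Q0Minus_mu0Plus] at h1
    have := mu0_bounds.2
    exact hasIndex_thresholdForm_of_eq Q0Minus_mu0Plus this.ne' h1.ne'
      (hasIndex_two_of_pos (by linarith) (by nlinarith))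
  have qpb : μ = mu0Plus → γ < gammaMinus lam μ → HasIndex (thresholdForm γ lam μ) 2 := by
    rintro rfl h1
    rw [g4 Q0Minus_mu0Plus] at h1
    have := mu0_bounds.2
    exact hasIndex_thresholdForm_of_eq Q0Minus_mu0Plus this.ne' h1.ne
      (hasIndex_two_of_det_neg (by nlinarith))
  have qma : μ = mu0Minus → γ > gammaMinus lam μ → HasIndex (thresholdForm γ lam μ) 2 := by
    rintro rfl h1
    rw [g4 Q0Minus_mu0Minus] at h1
    have := mu0_bounds.1
    exact hasIndex_thresholdForm_of_eq Q0Minus_mu0Minus this.ne h1.ne'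
      (hasIndex_two_of_det_neg (by nlinarith))
  have qmb : μ = mu0Minus → γ < gammaMinus lam μ → HasIndex (thresholdForm γ lam μ) 3 := by
    rintro rfl h1
    rw [g4 Q0Minus_mu0Minus] at h1
    have := mu0_bounds.1
    exact hasIndex_thresholdForm_of_eq Q0Minus_mu0Minus this.ne h1.ne
      (hasIndex_two_of_neg (by linarith) (by nlinarith))
  fin_cases ζ
  · obtain ⟨h1, h2, h3⟩ := h
    exact pa 0 h2 h3 h1
  · obtain (⟨h1, h2, h3⟩ | ⟨h1, h2⟩) | ⟨h1, (⟨h2, h3⟩ | h2) | ⟨h2, h3⟩⟩ := h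
    · exact pb 0 h2 h3 h1
    · exact zz 0 h1 h2
    · exact na 0 h2 h3 h1
    · exact qpa h2 h1
    · exact pa 1 h2 h3 h1
  · obtain (⟨h1, (⟨h2, h3⟩ | h2) | ⟨h2, h3⟩⟩ | ⟨h1, h2⟩) | ⟨h1, (⟨h2, h3⟩ | h2) | ⟨h2, h3⟩⟩ := h
    · exact nb 0 h2 h3 h1
    · exact qpb h2 h1
    · exact pb 1 h2 h3 h1
    · exact zz 1 h1 h2
    · exact na 1 h2 h3 h1
    · exact qma h2 h1
    · exact pa 2 h2 h3 h1
  · obtain (⟨h1, (⟨h2, h3⟩ | h2) | ⟨h2, h3⟩⟩ | ⟨h1, h2⟩) | ⟨h1, h2, h3⟩ := h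
    · exact nb 1 h2 h3 h1
    · exact qmb h2 h1
    · exact pb 2 h2 h3 h1
    · exact zz 2 h1 h2
    · exact na 2 h2 h3 h1
  · obtain ⟨h1, h2, h3⟩ := h
    exact nb 2 h2 h3 h1

/-! ### Negative eigenvalues of finite rank perturbations of positive operators -/

section Abstract

variable {E : Type*} [NormedAddCommGroup E] [InnerProductSpace ℂ E]

open LinearMap.FiniteRangeSetoid in
theorem isFredholm_congr {T S : E →L[ℂ] E}
    (h : ((T - S : E →L[ℂ] E) : E →ₗ[ℂ] E).HasFiniteRange) : T.IsFredholm ↔ S.IsFredholm := by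
  have h1 : (T : E →ₗ[ℂ] E) ≈ S := by
    rw [LinearMap.FiniteRangeSetoid.equiv_iff_hasFiniteRange]; exact h
  rw [ContinuousLinearMap.isFredholm_iff_exists_isQuasiInverse,
    ContinuousLinearMap.isFredholm_iff_exists_isQuasiInverse]
  exact exists_congr fun v => LinearMap.isQuasiInverse_congr (Setoid.refl _) (Setoid.symm h1)

theorem isCompactOperator_of_hasFiniteRange {V : E →L[ℂ] E}
    (hV : (V : E →ₗ[ℂ] E).HasFiniteRange) : IsCompactOperator V := by
  have : FiniteDimensional ℂ (V : E →ₗ[ℂ] E).range := .of_fg hV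
  have : LocallyCompactSpace (V : E →ₗ[ℂ] E).range :=
    have := FiniteDimensional.proper ℂ (V : E →ₗ[ℂ] E).range
    inferInstance
  have h : IsCompactOperator (id : (V : E →ₗ[ℂ] E).range → (V : E →ₗ[ℂ] E).range) :=
    isCompactOperator_id
  exact (h.clm_comp (V : E →ₗ[ℂ] E).range.subtypeL).comp_clm
    (V.codRestrict (V : E →ₗ[ℂ] E).range fun x => ⟨x, rfl⟩)

theorem isFredholm_of_isUnit {T : E →L[ℂ] E} (h : IsUnit T) : T.IsFredholm := by
  obtain ⟨u, rfl⟩ := h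
  rw [ContinuousLinearMap.isFredholm_iff_exists_isQuasiInverse]
  exact ⟨_, (ContinuousLinearEquiv.ofUnit u).toLinearEquiv.isQuasiInverse⟩

/-- The linear span of the eigenvectors of `T` with negative eigenvalues. -/
def negSpace (T : E →L[ℂ] E) : Submodule ℂ E :=
  ⨆ x : Set.Iio (0 : ℝ), Module.End.eigenspace (T : E →ₗ[ℂ] E) ((x : ℝ) : ℂ)

theorem eigenvalueCount_Iio_zero (T : E →L[ℂ] E) :
    eigenvalueCount T (Set.Iio 0) = Module.rank ℂ (negSpace T) := by
  classical
  have hind : iSupIndep fun x : Set.Iio (0 : ℝ) =>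
      Module.End.eigenspace (T : E →ₗ[ℂ] E) ((x : ℝ) : ℂ) :=
    (Module.End.eigenspaces_iSupIndep (T : E →ₗ[ℂ] E)).comp
      (f := fun x : Set.Iio (0 : ℝ) => ((x : ℝ) : ℂ))
      (fun x y h => Subtype.ext (Complex.ofReal_injective h))
  unfold eigenvalueCount negSpace
  rw [← rank_directSum, Submodule.iSup_eq_range_dfinsupp_lsum]
  exact (LinearEquiv.ofInjective _ hind.dfinsupp_lsum_injective).rank_eq

theorem re_inner_neg_of_mem_negSpace {T : E →L[ℂ] E} (hT : (T : E →ₗ[ℂ] E).IsSymmetric) {f : E}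
    (hf : f ∈ negSpace T) (hf0 : f ≠ 0) : (inner ℂ (T f) f).re < 0 := by
  classical
  obtain ⟨g, hg, rfl⟩ := (Submodule.mem_iSup_iff_exists_finsupp _ _).1 hf
  have hTg : ∀ x, T (g x) = ((x : ℝ) : ℂ) • g x := fun x => Module.End.mem_eigenspace_iff.1 (hg x)
  have horth : ∀ x y, x ≠ y → inner ℂ (g x) (g y) = 0 := by
    intro x y hxy
    have := hT.orthogonalFamily_eigenspaces (i := ((x : ℝ) : ℂ)) (j := ((y : ℝ) : ℂ))
      (fun h => hxy (Subtype.ext (Complex.ofReal_injective h)))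
    exact this ⟨g x, hg x⟩ ⟨g y, hg y⟩
  have h1 : inner ℂ (T (g.sum fun _ x => x)) (g.sum fun _ x => x) =
      ∑ x ∈ g.support, (((x : ℝ) * ‖g x‖ ^ 2 : ℝ) : ℂ) := by
    rw [Finsupp.sum, map_sum, sum_inner]
    refine Finset.sum_congr rfl fun x hx => ?_
    rw [inner_sum, Finset.sum_eq_single x]
    · rw [hTg, inner_smul_left, inner_self_eq_norm_sq_to_K]; simp
    · intro y _ hy
      rw [hTg, inner_smul_left, horth x y hy.symm, mul_zero]
    · intro h; exact absurd hx h
  rw [h1, ← Complex.ofReal_sum, Complex.ofReal_re]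
  refine Finset.sum_neg (fun x hx => ?_) ?_
  · have := norm_pos_iff.2 (Finsupp.mem_support_iff.1 hx)
    exact mul_neg_of_neg_of_pos x.2 (by positivity)
  · by_contra h
    rw [Finset.not_nonempty_iff_eq_empty, Finsupp.support_eq_empty] at h
    exact hf0 (by simp [h])

/-- If the form of `T` is bounded below by the pull-back of a real matrix of index `k`, there are at
most `k` negative eigenvalues. -/
theorem finrank_negSpace_le {ι : Type*} [Fintype ι] [DecidableEq ι] {T : E →L[ℂ] E}
    (hT : (T : E →ₗ[ℂ] E).IsSymmetric) {A : Matrix ι ι ℝ} {k : ℕ} (hA : HasIndex A k)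
    (x : E →ₗ[ℂ] ι → ℂ)
    (hx : ∀ f, ∑ i, ∑ j, A i j * (star (x f i) * x f j).re ≤ (inner ℂ (T f) f).re) :
    FiniteDimensional ℂ (negSpace T) ∧ Module.finrank ℂ (negSpace T) ≤ k := by
  obtain ⟨P, s, hP, hs, hPA, hk⟩ := hA
  set Pc : Matrix ι ι ℂ := P.map (algebraMap ℝ ℂ) with hPc
  have hform : ∀ z : ι → ℂ, ∑ i, ∑ j, A i j * (star (z i) * z j).re =
      ∑ l, s l * ‖Pc.mulVec z l‖ ^ 2 := by
    intro z
    have h1 : ∀ l, ‖Pc.mulVec z l‖ ^ 2 = ∑ i, ∑ j, P l i * P l j * (star (z i) * z j).re := by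
      intro l
      have h2 : ((‖Pc.mulVec z l‖ ^ 2 : ℝ) : ℂ) = star (Pc.mulVec z l) * Pc.mulVec z l := by
        rw [Complex.star_def, Complex.conj_mul', Complex.ofReal_pow]
      have h3 := congrArg Complex.re h2
      rw [Complex.ofReal_re] at h3
      rw [h3, Matrix.mulVec, dotProduct, star_sum, Finset.sum_mul_sum, Complex.re_sum]
      refine Finset.sum_congr rfl fun i _ => ?_
      rw [Complex.re_sum]
      refine Finset.sum_congr rfl fun j _ => ?_
      have h4 : star (Pc l i * z i) * (Pc l j * z j) =
          ((P l i * P l j : ℝ) : ℂ) * (star (z i) * z j) := by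
        simp [hPc]; ring
      rw [h4, Complex.re_ofReal_mul]
    simp only [h1, Finset.mul_sum]
    have hAij : ∀ i j, A i j = ∑ l, P l i * s l * P l j := by
      intro i j
      rw [hPA]
      simp [Matrix.mul_apply, Matrix.diagonal_apply]
    simp only [hAij, Finset.sum_mul]
    rw [Finset.sum_comm (s := Finset.univ) (t := Finset.univ)
      (f := fun l i => ∑ j, s l * (P l i * P l j * (star (z i) * z j).re))]
    refine Finset.sum_congr rfl fun i _ => ?_
    rw [Finset.sum_comm]
    refine Finset.sum_congr rfl fun l _ => Finset.sum_congr rfl fun j _ => ?_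
    ring
  let L : E →ₗ[ℂ] ({l // s l < 0} → ℂ) :=
    LinearMap.pi fun l => LinearMap.proj l.1 ∘ₗ Pc.mulVecLin ∘ₗ x
  have hinj : Function.Injective (L.domRestrict (negSpace T)) := by
    rw [injective_iff_map_eq_zero]
    intro f hf
    by_contra h0
    have h1 := re_inner_neg_of_mem_negSpace hT f.2 (fun h => h0 (Subtype.ext h))
    have h2 := hx f
    rw [hform] at h2
    have h3 : 0 ≤ ∑ l, s l * ‖Pc.mulVec (x f) l‖ ^ 2 := by
      refine Finset.sum_nonneg fun l _ => ?_
      rcases lt_or_ge (s l) 0 with hl | hl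
      · have : Pc.mulVec (x f) l = 0 := congrFun hf ⟨l, hl⟩
        simp [this]
      · positivity
    linarith
  refine ⟨FiniteDimensional.of_injective _ hinj, ?_⟩
  have := LinearMap.finrank_le_finrank_of_injective hinj
  rw [Module.finrank_pi, Fintype.card_subtype] at this
  rwa [← hk]

open Filter Topology in
/-- If the form of `T` restricted to suitable vectors converges to a real matrix of index `k`,
there are at least `k` negative eigenvalues. -/
theorem le_finrank_negSpace {ι : Type*} [Fintype ι] [DecidableEq ι] {T : E →L[ℂ] E}
    [FiniteDimensional ℂ (negSpace T)]
    (hT : ∀ f ∈ (negSpace T)ᗮ, 0 ≤ (inner ℂ (T f) f).re) {A : Matrix ι ι ℝ} {k : ℕ}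
    (hA : HasIndex A k) (G : ℕ → ι → E)
    (hG : ∀ i j, Tendsto (fun n => inner ℂ (T (G n i)) (G n j)) atTop (𝓝 ((A i j : ℝ) : ℂ))) :
    k ≤ Module.finrank ℂ (negSpace T) := by
  classical
  obtain ⟨P, s, hP, hs, hPA, hk⟩ := hA
  set R := P⁻¹ with hR
  have hPu : IsUnit P.det := isUnit_iff_ne_zero.2 hP
  -- the columns of `P⁻¹` diagonalize the form in the limit
  have hRA : R.transpose * A * R = Matrix.diagonal s := by
    have h1 : P * R = 1 := Matrix.mul_nonsing_inv _ hPu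
    have h2 : R.transpose * P.transpose = 1 := by
      rw [← Matrix.transpose_mul, h1, Matrix.transpose_one]
    rw [hPA]
    calc _ = (R.transpose * P.transpose) * Matrix.diagonal s * (P * R) := by
          simp only [Matrix.mul_assoc]
      _ = _ := by rw [h1, h2, Matrix.one_mul, Matrix.mul_one]
  set H : ℕ → ι → E := fun n l => ∑ i, ((R i l : ℝ) : ℂ) • G n i with hH
  have hHlim : ∀ l m, Tendsto (fun n => inner ℂ (T (H n l)) (H n m)) atTop
      (𝓝 ((Matrix.diagonal s l m : ℝ) : ℂ)) := by
    intro l m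
    have h1 : ∀ n, inner ℂ (T (H n l)) (H n m) =
        ∑ j, ∑ i, ((R i l : ℝ) : ℂ) * inner ℂ (T (G n i)) (G n j) * ((R j m : ℝ) : ℂ) := by
      intro n
      simp only [hH, map_sum, map_smul, sum_inner, inner_sum, inner_smul_left, inner_smul_right,
        Complex.conj_ofReal, Finset.mul_sum]
      refine Finset.sum_congr rfl fun j _ => Finset.sum_congr rfl fun i _ => by ring
    simp only [h1]
    have h2 : ((Matrix.diagonal s l m : ℝ) : ℂ) =
        ∑ j, ∑ i, ((R i l : ℝ) : ℂ) * ((A i j : ℝ) : ℂ) * ((R j m : ℝ) : ℂ) := by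
      rw [← hRA]
      simp [Matrix.mul_apply, Finset.sum_mul]
    rw [h2]
    exact tendsto_finsetSum _ fun j _ => tendsto_finsetSum _ fun i _ =>
      ((hG i j).const_mul _).mul_const _
  -- a common bound for the negative coefficients
  obtain ⟨δ, hδ, hsδ⟩ : ∃ δ > 0, ∀ l, s l < 0 → s l ≤ -δ := by
    rcases isEmpty_or_nonempty ι with h | h
    · exact ⟨1, one_pos, fun l => h.elim l⟩
    · obtain ⟨l₀, -, hl₀⟩ := Finset.exists_min_image Finset.univ (fun l => |s l|)
        Finset.univ_nonempty
      refine ⟨|s l₀|, abs_pos.2 (hs l₀), fun l hl => ?_⟩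
      have := hl₀ l (Finset.mem_univ _)
      rw [abs_of_neg hl] at this
      linarith
  set N : ℝ := Nat.cast (Fintype.card {l // s l < 0}) with hN
  set η : ℝ := δ / (N + 1) with hη
  have hN0 : 0 ≤ N := Nat.cast_nonneg _
  have hη0 : 0 < η := by positivity
  have hev : ∀ᶠ n in atTop, ∀ l m,
      ‖inner ℂ (T (H n l)) (H n m) - ((Matrix.diagonal s l m : ℝ) : ℂ)‖ < η := by
    rw [eventually_all]; intro l
    rw [eventually_all]; intro m
    have := (hHlim l m).sub_const ((Matrix.diagonal s l m : ℝ) : ℂ)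
    rw [sub_self] at this
    exact (this.norm.eventually_lt_const (by simpa using hη0))
  obtain ⟨n, hn⟩ := hev.exists
  let U : ({l // s l < 0} → ℂ) →ₗ[ℂ] E := Fintype.linearCombination ℂ fun l => H n l.1
  have hU : ∀ z, U z = ∑ l, z l • H n l.1 := fun z => Fintype.linearCombination_apply _ _ _
  have hneg : ∀ z, z ≠ 0 → (inner ℂ (T (U z)) (U z)).re < 0 := by
    intro z hz
    set S : ℝ := ∑ l, ‖z l‖ ^ 2 with hS
    have hS0 : 0 < S := by
      obtain ⟨l, hl⟩ := Function.ne_iff.1 hz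
      refine Finset.sum_pos' (fun _ _ => by positivity) ⟨l, Finset.mem_univ _, ?_⟩
      have := norm_pos_iff.2 hl
      positivity
    have h1 : inner ℂ (T (U z)) (U z) =
        ∑ l, ((s l.1 * ‖z l‖ ^ 2 : ℝ) : ℂ) + ∑ l, ∑ m, star (z l) * z m *
          (inner ℂ (T (H n l.1)) (H n m.1) - ((Matrix.diagonal s l.1 m.1 : ℝ) : ℂ)) := by
      have h2 : ∑ l : {l // s l < 0}, ((s l.1 * ‖z l‖ ^ 2 : ℝ) : ℂ) =
          ∑ l : {l // s l < 0}, ∑ m : {l // s l < 0},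
            star (z l) * z m * ((Matrix.diagonal s l.1 m.1 : ℝ) : ℂ) := by
        refine Finset.sum_congr rfl fun l _ => ?_
        rw [Finset.sum_eq_single l]
        · rw [Complex.star_def, Complex.conj_mul', Matrix.diagonal_apply_eq]
          push_cast; ring
        · intro m _ hm
          rw [Matrix.diagonal_apply_ne _ (fun h => hm (Subtype.ext h.symm))]
          simp
        · simp
      rw [h2, ← Finset.sum_add_distrib, hU]
      simp only [map_sum, map_smul, sum_inner, inner_sum, inner_smul_left, inner_smul_right,
        Finset.mul_sum]
      rw [Finset.sum_comm]
      refine Finset.sum_congr rfl fun l _ => ?_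
      rw [← Finset.sum_add_distrib]
      refine Finset.sum_congr rfl fun m _ => ?_
      rw [Complex.star_def]; ring
    have h3 : ‖∑ l : {l // s l < 0}, ∑ m : {l // s l < 0}, star (z l) * z m *
          (inner ℂ (T (H n l.1)) (H n m.1) - ((Matrix.diagonal s l.1 m.1 : ℝ) : ℂ))‖ ≤
        η * (N * S) := by
      calc _ ≤ ∑ l : {l // s l < 0}, ∑ m : {l // s l < 0}, ‖z l‖ * ‖z m‖ * η := by
            refine (norm_sum_le _ _).trans (Finset.sum_le_sum fun l _ => ?_)
            refine (norm_sum_le _ _).trans (Finset.sum_le_sum fun m _ => ?_)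
            rw [norm_mul, norm_mul, norm_star]
            exact mul_le_mul_of_nonneg_left (hn _ _).le (by positivity)
        _ = η * (∑ l, ‖z l‖) ^ 2 := by
            rw [pow_two, Finset.sum_mul_sum, Finset.mul_sum]
            refine Finset.sum_congr rfl fun l _ => ?_
            rw [Finset.mul_sum]
            exact Finset.sum_congr rfl fun m _ => by ring
        _ ≤ _ := by
            refine mul_le_mul_of_nonneg_left ?_ hη0.le
            have := sq_sum_le_card_mul_sum_sq (s := Finset.univ) (f := fun l => ‖z l‖)
            simpa [hN, hS] using this
    have h4 : (∑ l : {l // s l < 0}, ((s l.1 * ‖z l‖ ^ 2 : ℝ) : ℂ)).re ≤ -δ * S := by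
      rw [← Complex.ofReal_sum, Complex.ofReal_re, hS, Finset.mul_sum]
      exact Finset.sum_le_sum fun l _ =>
        mul_le_mul_of_nonneg_right (hsδ l.1 l.2) (by positivity)
    have h5 : η * N < δ := by
      rw [hη, div_mul_eq_mul_div, div_lt_iff₀ (by positivity)]
      nlinarith
    rw [h1, Complex.add_re]
    have h6 := (Complex.re_le_norm _).trans h3
    nlinarith
  have hinj : Function.Injective ((negSpace T).orthogonalProjectionOnto.toLinearMap ∘ₗ U) := by
    rw [injective_iff_map_eq_zero]
    intro z hz
    by_contra h0
    have h1 : U z ∈ (negSpace T)ᗮ :=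
      Submodule.orthogonalProjectionOnto_eq_zero_iff.1 hz
    exact absurd (hneg z h0) (not_lt.2 (hT _ h1))
  have := LinearMap.finrank_le_finrank_of_injective hinj
  rw [Module.finrank_pi, Fintype.card_subtype] at this
  rwa [← hk]

/-- If an operator `M` is arbitrarily small on subspaces of arbitrarily large dimension, then `0`
belongs to the essential spectrum of its finite rank perturbations. -/
theorem zero_mem_essentialSpectrum {T M V : E →L[ℂ] E} (hV : (V : E →ₗ[ℂ] E).HasFiniteRange)
    (hTMV : T = M + V)
    (hM : ∀ δ > 0, ∀ n : ℕ, ∃ g : (Fin n → ℂ) →ₗ[ℂ] E, Function.Injective g ∧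
      ∀ z, ‖M (g z)‖ ≤ δ * ‖g z‖) : (0 : ℂ) ∈ essentialSpectrum T := by
  intro hF
  rw [zero_smul, sub_zero, ContinuousLinearMap.isFredholm_iff_exists_isQuasiInverse] at hF
  obtain ⟨v, hv, -⟩ := hF
  have hF := LinearMap.FiniteRangeSetoid.equiv_iff_hasFiniteRange.1 hv
  set F : E →ₗ[ℂ] E := (v : E →ₗ[ℂ] E) ∘ₗ (T : E →ₗ[ℂ] E) - LinearMap.id with hFdef
  have : FiniteDimensional ℂ F.range := .of_fg hF
  have : FiniteDimensional ℂ (V : E →ₗ[ℂ] E).range := .of_fg hV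
  obtain ⟨g, hg, hgM⟩ := hM (1 / (2 * (‖v‖ + 1))) (by positivity)
    (Module.finrank ℂ (F.range × (V : E →ₗ[ℂ] E).range) + 1)
  -- by dimension some `g z ≠ 0` is killed by both `F` and `V`; there `v M = v T = 1`, while `M`
  -- is small
  have hker := LinearMap.ker_ne_bot_of_finrank_lt
    (f := (F.rangeRestrict.prod (V : E →ₗ[ℂ] E).rangeRestrict) ∘ₗ g) (by simp)
  obtain ⟨z, hz, hz0⟩ := Submodule.exists_mem_ne_zero_of_ne_bot hker
  have hz1 : F (g z) = 0 := congrArg (fun y => (y.1 : E)) hz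
  have hz2 : V (g z) = 0 := congrArg (fun y => (y.2 : E)) hz
  have h1 : v (M (g z)) = g z := by
    have h2 : v (T (g z)) - g z = 0 := hz1
    rw [hTMV, add_apply, hz2, add_zero, sub_eq_zero] at h2
    exact h2
  have hpos : 0 < ‖g z‖ := norm_pos_iff.2 fun h => hz0 (hg (by rw [h, map_zero]))
  have h3 : ‖g z‖ ≤ ‖v‖ * (1 / (2 * (‖v‖ + 1)) * ‖g z‖) :=
    calc ‖g z‖ = ‖v (M (g z))‖ := by rw [h1]
      _ ≤ ‖v‖ * ‖M (g z)‖ := v.le_opNorm _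
      _ ≤ _ := mul_le_mul_of_nonneg_left (hgM z) (norm_nonneg _)
  have h4 : ‖v‖ * (1 / (2 * (‖v‖ + 1))) < 1 := by
    rw [mul_one_div, div_lt_one (by positivity)]
    linarith [norm_nonneg v]
  nlinarith

section Complete

variable [CompleteSpace E]

/-- A positive operator minus a number with negative real part is invertible. -/
theorem isUnit_sub_of_re_neg {M : E →L[ℂ] E} (hM : M.IsPositive) {w : ℂ} (hw : w.re < 0) :
    IsUnit (M - w • ContinuousLinearMap.id ℂ E) := by
  have hc : 0 < -w.re := by linarith
  refine ContinuousLinearMap.isUnit_of_forall_le_norm_inner_map _ (c := (-w.re).toNNReal)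
    (Real.toNNReal_pos.2 hc) fun x => ?_
  have h1 : RCLike.re (inner ℂ ((M - w • ContinuousLinearMap.id ℂ E) x) x) =
      RCLike.re (inner ℂ (M x) x) - w.re * ‖x‖ ^ 2 := by
    rw [sub_apply, smul_apply, ContinuousLinearMap.id_apply, inner_sub_left, inner_smul_left,
      inner_self_eq_norm_sq_to_K, map_sub]
    congr 1
    simp [← Complex.ofReal_pow]
  have h2 := hM.re_inner_nonneg_left x
  refine le_trans ?_ (RCLike.re_le_norm _)
  rw [h1, Real.coe_toNNReal _ hc.le]
  nlinarith

/-- A finite rank perturbation of a positive operator, if self-adjoint and without negative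
eigenvalues, is positive. -/
theorem isPositive_of_no_neg_eigenvalue {T M V : E →L[ℂ] E} (hT : IsSelfAdjoint T)
    (hM : M.IsPositive) (hV : (V : E →ₗ[ℂ] E).HasFiniteRange) (hTMV : T = M + V)
    (hev : ∀ (z : ℝ) (x : E), z < 0 → T x = (z : ℂ) • x → x = 0) : T.IsPositive := by
  rw [← ContinuousLinearMap.nonneg_iff_isPositive]
  rw [StarOrderedRing.nonneg_iff_spectrum_nonneg (R := ℝ) T]
  intro z hz
  by_contra! hz0
  have hu : IsUnit (M - (z : ℂ) • ContinuousLinearMap.id ℂ E) :=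
    isUnit_sub_of_re_neg hM (by simpa using hz0)
  apply hz
  obtain ⟨u, hu⟩ := hu
  -- `T - z = u (1 + u⁻¹ V)` with `u⁻¹ V` compact, so the Fredholm alternative applies
  set K : E →L[ℂ] E := (u⁻¹ : (E →L[ℂ] E)ˣ).1 * V with hK
  have huK : u.1 * K = V := by rw [hK, ← mul_assoc, Units.mul_inv, one_mul]
  have hcomp : IsCompactOperator K :=
    (isCompactOperator_of_hasFiniteRange hV).clm_comp (u⁻¹ : (E →L[ℂ] E)ˣ).1
  have hTz : T - (z : ℂ) • ContinuousLinearMap.id ℂ E = u.1 * (1 + K) := by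
    rw [mul_add, huK, mul_one, hu, hTMV]; abel
  have hmem := (hcomp.hasEigenvalue_or_mem_resolventSet (μ := (-1 : ℂ)) (by norm_num)).resolve_left
    (by
      intro h
      obtain ⟨x, hx⟩ := h.exists_hasEigenvector
      refine hx.2 (hev z x hz0 ?_)
      have h1 : K x = (-1 : ℂ) • x := hx.apply_eq_smul
      have h2 := congrArg (fun A : E →L[ℂ] E => A x) hTz
      simp only [sub_apply, smul_apply, ContinuousLinearMap.id_apply,
        mul_apply_eq_comp, add_apply, one_apply_eq_self, h1] at h2
      rw [neg_one_smul, add_neg_cancel, map_zero, sub_eq_zero] at h2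
      exact h2)
  have h1K : IsUnit (1 + K) := by
    have h3 : IsUnit (algebraMap ℂ (E →L[ℂ] E) (-1) - K) := hmem
    have h4 : algebraMap ℂ (E →L[ℂ] E) (-1) - K = -(1 + K) := by
      rw [map_neg, map_one]; abel
    rw [h4] at h3
    simpa using h3.neg
  have hfin : IsUnit (T - (z : ℂ) • ContinuousLinearMap.id ℂ E) := by
    rw [hTz]; exact u.isUnit.mul h1K
  have h5 : algebraMap ℝ (E →L[ℂ] E) z - T = -(T - (z : ℂ) • ContinuousLinearMap.id ℂ E) := by
    rw [neg_sub]; congr 1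
  change IsUnit (algebraMap ℝ (E →L[ℂ] E) z - T)
  rw [h5]
  exact hfin.neg

/-- The form of a finite rank perturbation of a positive operator is nonnegative on the orthogonal
complement of the eigenvectors with negative eigenvalues. -/
theorem re_inner_nonneg_of_mem_orthogonal {T M V : E →L[ℂ] E} (hT : IsSelfAdjoint T)
    (hM : M.IsPositive) (hV : (V : E →ₗ[ℂ] E).HasFiniteRange) (hTMV : T = M + V)
    {f : E} (hf : f ∈ (negSpace T)ᗮ) : 0 ≤ (inner ℂ (T f) f).re := by
  have hsym : (T : E →ₗ[ℂ] E).IsSymmetric := hT.isSymmetric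
  set K := (negSpace T)ᗮ with hK
  have hinv : ∀ x ∈ K, T x ∈ K := by
    intro x hx
    rw [hK, Submodule.mem_orthogonal] at hx ⊢
    intro u hu
    have h1 : T u ∈ negSpace T := by
      have : negSpace T ≤ (negSpace T).comap (T : E →ₗ[ℂ] E) := by
        refine iSup_le fun y v hv => ?_
        have hv' : T v = ((y : ℝ) : ℂ) • v := Module.End.mem_eigenspace_iff.1 hv
        have : T v ∈ negSpace T := by
          rw [hv']
          exact Submodule.smul_mem _ _ (Submodule.mem_iSup_of_mem y hv)
        exact this
      exact this hu
    have h2 : inner ℂ (T u) x = inner ℂ u (T x) := hsym u x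
    rw [← h2]; exact hx _ h1
  have : CompleteSpace K := (Submodule.isClosed_orthogonal _).completeSpace_coe
  set p := K.orthogonalProjectionOnto
  set T' : K →L[ℂ] K := p ∘L T ∘L K.subtypeL with hT'
  have hT'x : ∀ x : K, ((T' x : K) : E) = T x := by
    intro x
    exact Submodule.orthogonalProjectionOnto_mem_subspace_eq_self (K := K) ⟨T x, hinv x x.2⟩ ▸ rfl
  have hpos : T'.IsPositive := by
    refine isPositive_of_no_neg_eigenvalue (M := p ∘L M ∘L K.subtypeL)
      (V := p ∘L V ∘L K.subtypeL) ?_ (hM.orthogonalProjectionOnto_comp K) ?_ ?_ ?_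
    · rw [ContinuousLinearMap.isSelfAdjoint_iff_isSymmetric]
      intro x y
      change inner ℂ ((T' x : K) : E) (y : E) = inner ℂ (x : E) ((T' y : K) : E)
      rw [hT'x, hT'x]; exact hsym x y
    · exact (hV.comp_right (v := (V : E →ₗ[ℂ] E)) K.subtype).comp_left _
    · rw [hT', hTMV]; ext x; simp
    · intro z x hz hx
      have h1 : T x = (z : ℂ) • (x : E) := by rw [← hT'x, hx]; rfl
      have h2 : (x : E) ∈ negSpace T :=
        Submodule.mem_iSup_of_mem ⟨z, hz⟩ (Module.End.mem_eigenspace_iff.2 h1)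
      have h3 : inner ℂ (x : E) (x : E) = 0 := (Submodule.mem_orthogonal _ _).1 x.2 _ h2
      exact Subtype.ext (inner_self_eq_zero.1 h3)
  have h := hpos.re_inner_nonneg_left ⟨f, hf⟩
  have h4 : inner ℂ (T' ⟨f, hf⟩) (⟨f, hf⟩ : K) = inner ℂ (T f) f := by
    rw [Submodule.coe_inner, hT'x]
  rw [h4] at h
  exact h

open Filter Topology in
/-- A finite rank perturbation of a positive operator has exactly `k` negative eigenvalues,
counted with multiplicity, when its form is bounded below by the pull-back of a real matrix of
index `k` and this bound is asymptotically attained. -/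
theorem eigenvalueCount_eq {ι : Type*} [Fintype ι] [DecidableEq ι] {T M V : E →L[ℂ] E}
    (hT : IsSelfAdjoint T) (hM : M.IsPositive) (hV : (V : E →ₗ[ℂ] E).HasFiniteRange)
    (hTMV : T = M + V) {A : Matrix ι ι ℝ} {k : ℕ} (hA : HasIndex A k) (x : E →ₗ[ℂ] ι → ℂ)
    (hx : ∀ f, ∑ i, ∑ j, A i j * (star (x f i) * x f j).re ≤ (inner ℂ (T f) f).re)
    (G : ℕ → ι → E)
    (hG : ∀ i j, Tendsto (fun n => inner ℂ (T (G n i)) (G n j)) atTop (𝓝 ((A i j : ℝ) : ℂ))) :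
    eigenvalueCount T (Set.Iio 0) = (k : Cardinal) := by
  obtain ⟨h1, h2⟩ := finrank_negSpace_le hT.isSymmetric hA x hx
  have h3 := le_finrank_negSpace
    (fun f hf => re_inner_nonneg_of_mem_orthogonal hT hM hV hTMV hf) hA G hG
  rw [eigenvalueCount_Iio_zero, ← Module.finrank_eq_rank, le_antisymm h2 h3]

theorem re_nonneg_of_mem_essentialSpectrum {T M V : E →L[ℂ] E} (hM : M.IsPositive)
    (hV : (V : E →ₗ[ℂ] E).HasFiniteRange) (hTMV : T = M + V) {w : ℂ}
    (hw : w ∈ essentialSpectrum T) : 0 ≤ w.re := by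
  by_contra! h
  refine hw ((isFredholm_congr ?_).2 (isFredholm_of_isUnit (isUnit_sub_of_re_neg hM h)))
  have : T - w • ContinuousLinearMap.id ℂ E - (M - w • ContinuousLinearMap.id ℂ E) = V := by
    rw [hTMV]; abel
  rwa [this]

theorem belowEss_eq {T M V : E →L[ℂ] E} (hM : M.IsPositive)
    (hV : (V : E →ₗ[ℂ] E).HasFiniteRange) (hTMV : T = M + V)
    (h0 : (0 : ℂ) ∈ essentialSpectrum T) : belowEss T = Set.Iio 0 := by
  ext x
  refine ⟨fun h => by simpa using h 0 h0, fun h w hw => ?_⟩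
  exact lt_of_lt_of_le h (re_nonneg_of_mem_essentialSpectrum hM hV hTMV hw)

end Complete

end Abstract

/-! ### Integrals over the torus -/

theorem integral_torus (f : Torus → ℝ) : ∫ x, f x = ∫ x in (0 : ℝ)..(2 * π), f (x : Torus) := by
  have := AddCircle.intervalIntegral_preimage (2 * π) 0 f
  rw [zero_add] at this
  exact this.symm

theorem integral_torus2 (φ : C(Torus2, ℝ)) : ∫ p, φ p = ∫ x : Torus, ∫ y : Torus, φ (x, y) := by
  refine integral_prod (μ := (volume : Measure Torus)) (ν := (volume : Measure Torus)) φ ?_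
  exact φ.continuous.integrable_of_hasCompactSupport (HasCompactSupport.of_compactSpace _)

theorem integrable_torus2 (φ : C(Torus2, ℝ)) : Integrable (fun p => φ p) volume :=
  φ.continuous.integrable_of_hasCompactSupport (HasCompactSupport.of_compactSpace _)

theorem integral_mul_torus2 (f g : Torus → ℝ) :
    ∫ p : Torus2, f p.1 * g p.2 = (∫ x, f x) * ∫ y, g y :=
  integral_prod_mul (μ := (volume : Measure Torus)) (ν := (volume : Measure Torus)) f g

theorem integral_torus_const (a : ℝ) : ∫ _ : Torus, a = 2 * π * a := by
  rw [integral_torus]; simp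

theorem integral_cosT : ∫ x, cosT x = 0 := by
  rw [integral_torus]; simp

theorem integral_cosT_sq : ∫ x, cosT x ^ 2 = π := by
  rw [integral_torus]; simp [integral_cos_sq]

theorem integral_cosT_pow_three : ∫ x, cosT x ^ 3 = 0 := by
  rw [integral_torus]; simp [integral_cos_pow_three]

theorem cosT_two_smul (x : Torus) : cosT (2 • x) = 2 * cosT x ^ 2 - 1 := by
  induction x using QuotientAddGroup.induction_on with
  | H x =>
    change cosT ((2 • x : ℝ) : Torus) = _
    rw [cosT_coe, two_nsmul, ← two_mul, Real.cos_two_mul]; rfl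

theorem abs_cosT_le_one (x : Torus) : |cosT x| ≤ 1 := by
  induction x using QuotientAddGroup.induction_on with
  | H x => exact Real.abs_cos_le_one x

theorem cosT_le_one (x : Torus) : cosT x ≤ 1 := (abs_le.1 (abs_cosT_le_one x)).2

/-! ### One-dimensional integrals -/

theorem integral_inv_sub_cos {A : ℝ} (hA : 1 < A) :
    ∫ y in (0 : ℝ)..(2 * π), (A - Real.cos y)⁻¹ = 2 * π / √(A ^ 2 - 1) := by
  obtain ⟨s, hs⟩ : ∃ s, s = √(A ^ 2 - 1) := ⟨_, rfl⟩
  rw [← hs]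
  have hs0 : 0 < s := hs ▸ Real.sqrt_pos.2 (by nlinarith)
  have hss : s ^ 2 = A ^ 2 - 1 := hs ▸ Real.sq_sqrt (by nlinarith)
  obtain ⟨r, hr⟩ : ∃ r, r = A - s := ⟨_, rfl⟩
  have hsA : s < A := by nlinarith
  have hr0 : 0 < r := by linarith
  have hr1 : r < 1 := by nlinarith
  have hr2 : r ^ 2 + 1 = 2 * A * r := by rw [hr]; nlinarith
  have hden : ∀ y, 0 < 1 - r * Real.cos y := fun y => by
    nlinarith [Real.cos_le_one y, Real.neg_one_le_cos y]
  have hAc : ∀ y, 0 < A - Real.cos y := fun y => by linarith [Real.cos_le_one y]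
  -- the antiderivative comes from the Poisson kernel with parameter `r`
  have hderiv : ∀ y, HasDerivAt
      (fun y => (y + 2 * Real.arctan (r * Real.sin y / (1 - r * Real.cos y))) / s)
      (A - Real.cos y)⁻¹ y := by
    intro y
    have h1 : HasDerivAt (fun y => r * Real.sin y) (r * Real.cos y) y :=
      (Real.hasDerivAt_sin y).const_mul r
    have h2 : HasDerivAt (fun y => 1 - r * Real.cos y) (-(r * -Real.sin y)) y :=
      ((Real.hasDerivAt_cos y).const_mul r).const_sub 1
    have h3 : HasDerivAt
        (fun y => (y + 2 * Real.arctan (r * Real.sin y / (1 - r * Real.cos y))) / s) _ y :=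
      ((hasDerivAt_id y).add ((h1.div h2 (hden y).ne').arctan.const_mul 2)).div_const s
    refine h3.congr_deriv ?_
    have hd := hden y
    have ha := hAc y
    have hsc := Real.sin_sq_add_cos_sq y
    simp only [Pi.div_apply]
    have h4 : 0 < (1 - r * Real.cos y) ^ 2 + (r * Real.sin y) ^ 2 := by positivity
    have h5 : (1 - r * Real.cos y) ^ 2 + (r * Real.sin y) ^ 2 = 2 * r * (A - Real.cos y) := by
      linear_combination r ^ 2 * hsc + hr2
    have h6 : 1 + (r * Real.sin y / (1 - r * Real.cos y)) ^ 2 =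
        2 * r * (A - Real.cos y) / (1 - r * Real.cos y) ^ 2 := by
      rw [← h5]; field_simp
    rw [h6]
    have h7 : s = A - r := by rw [hr]; ring
    field_simp
    rw [h7]
    linear_combination (-r) * hsc
  rw [intervalIntegral.integral_eq_sub_of_hasDerivAt (fun y _ => hderiv y)]
  · simp
  · apply ContinuousOn.intervalIntegrable
    exact (Continuous.inv₀ (by fun_prop) (fun y => (hAc y).ne')).continuousOn

/-- Evaluated with the antiderivative found by the substitution `v = cos (x / 2)`. The integrand has
the junk value `0` at the zeros `0, 2π` of the square root, in agreement with its limit. -/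
theorem integral_half_angle :
    ∫ x in (0 : ℝ)..(2 * π), 16 * (1 - Real.cos x) ^ 4 /
      √((2 - Real.cos x) ^ 2 - 1) = 512 / 3 := by
  set F : ℝ → ℝ := fun v => v * (1 / 2 - v ^ 2 / 3 + v ^ 4 / 6) * √(2 - v ^ 2) with hF
  have hFd : ∀ v : ℝ, v ^ 2 ≤ 1 → HasDerivAt F ((1 - v ^ 2) ^ 3 / √(2 - v ^ 2)) v := by
    intro v hv
    have hpos : 0 < 2 - v ^ 2 := by linarith
    have hsq := Real.sq_sqrt hpos.le
    have hs0 := Real.sqrt_pos.2 hpos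
    have h1 : HasDerivAt (fun v : ℝ => 2 - v ^ 2) (-(2 * v)) v := by
      simpa using (hasDerivAt_pow 2 v).const_sub 2
    have h2 := h1.sqrt hpos.ne'
    have h3 : HasDerivAt (fun v : ℝ => v * (1 / 2 - v ^ 2 / 3 + v ^ 4 / 6))
        (1 / 2 - v ^ 2 + 5 * v ^ 4 / 6) v := by
      have h4 : HasDerivAt (fun v : ℝ => 1 / 2 - v ^ 2 / 3 + v ^ 4 / 6) _ v :=
        (((hasDerivAt_pow 2 v).div_const 3).const_sub (1 / 2)).add
          ((hasDerivAt_pow 4 v).div_const 6)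
      refine ((hasDerivAt_id v).mul h4).congr_deriv ?_
      simp only [id]; push_cast; ring
    refine (h3.mul h2).congr_deriv ?_
    set q := √(2 - v ^ 2)
    field_simp
    rw [hsq]; ring
  have hderiv : ∀ x ∈ Set.uIcc (0 : ℝ) (2 * π), HasDerivAt (fun x => -256 * F (Real.cos (x / 2)))
      (16 * (1 - Real.cos x) ^ 4 / √((2 - Real.cos x) ^ 2 - 1)) x := by
    intro x hx
    rw [Set.uIcc_of_le Real.two_pi_pos.le] at hx
    have hs : 0 ≤ Real.sin (x / 2) :=
      Real.sin_nonneg_of_nonneg_of_le_pi (by linarith [hx.1]) (by linarith [hx.2])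
    have hsc := Real.sin_sq_add_cos_sq (x / 2)
    have h1 : HasDerivAt (fun x : ℝ => Real.cos (x / 2)) (-Real.sin (x / 2) * (1 / 2)) x :=
      ((hasDerivAt_id x).div_const 2).cos
    have h2 := ((hFd (Real.cos (x / 2)) (by nlinarith)).comp x h1).const_mul (-256)
    refine h2.congr_deriv ?_
    have hc : Real.cos x = 1 - 2 * Real.sin (x / 2) ^ 2 := by
      have := Real.cos_two_mul (x / 2)
      rw [mul_div_cancel₀ x two_ne_zero] at this
      linarith
    have hpos : 0 < 2 - Real.cos (x / 2) ^ 2 := by nlinarith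
    have h3 : √((2 - Real.cos x) ^ 2 - 1) = 2 * Real.sin (x / 2) * √(2 - Real.cos (x / 2) ^ 2) := by
      rw [hc, show (2 - (1 - 2 * Real.sin (x / 2) ^ 2)) ^ 2 - 1 =
        (2 * Real.sin (x / 2)) ^ 2 * (2 - Real.cos (x / 2) ^ 2) by
          rw [show Real.cos (x / 2) ^ 2 = 1 - Real.sin (x / 2) ^ 2 by linarith]; ring,
        Real.sqrt_mul (by positivity), Real.sqrt_sq (by positivity)]
    have h4 : 1 - Real.cos (x / 2) ^ 2 = Real.sin (x / 2) ^ 2 := by linarith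
    rw [h3, h4, hc]
    have h5 := Real.sqrt_pos.2 hpos
    rcases hs.eq_or_lt with h0 | h0
    · rw [← h0]; simp
    · field_simp; ring
  rw [intervalIntegral.integral_eq_sub_of_hasDerivAt hderiv]
  · have : 2 * π / 2 = π := by ring
    simp [hF, this]; norm_num
  · refine intervalIntegral.intervalIntegrable_deriv_of_nonneg
      (fun x hx => (hderiv x hx).continuousAt.continuousWithinAt)
      (fun x hx => hderiv x (Set.Ioo_subset_Icc_self hx)) fun x hx => by positivity

/-- Integration over `p₂` of `(cos p₁ - cos p₂)⁴ / 𝓔₀(p)`, by polynomial division in `cos p₂`. -/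
theorem integral_quartic_div {c : ℝ} (hc : c ≤ 1) :
    ∫ y in (0 : ℝ)..(2 * π), (c - Real.cos y) ^ 4 / (2 * (2 - c - Real.cos y)) =
      π * (16 * (1 - c) ^ 4 / √((2 - c) ^ 2 - 1)) -
        π * (9 - 61 / 2 * c + 34 * c ^ 2 - 15 * c ^ 3) := by
  have hpoly : ∫ y in (0 : ℝ)..(2 * π), (-1 / 2 : ℝ) * ((Real.cos y - c) ^ 3 +
      (Real.cos y - c) ^ 2 * (2 - 2 * c) + (Real.cos y - c) * (2 - 2 * c) ^ 2 + (2 - 2 * c) ^ 3) =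
      - (π * (9 - 61 / 2 * c + 34 * c ^ 2 - 15 * c ^ 3)) := by
    have h1 : ∀ y : ℝ, (-1 / 2 : ℝ) * ((Real.cos y - c) ^ 3 +
        (Real.cos y - c) ^ 2 * (2 - 2 * c) + (Real.cos y - c) * (2 - 2 * c) ^ 2 +
        (2 - 2 * c) ^ 3) = (-1 / 2) * Real.cos y ^ 3 + (5 * c / 2 - 1) * Real.cos y ^ 2 +
        (-11 / 2 * c ^ 2 + 6 * c - 2) * Real.cos y +
        (15 / 2 * c ^ 3 - 17 * c ^ 2 + 14 * c - 4) := by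
      intro y; ring
    simp only [h1]
    have i1 : ∀ (a : ℝ) (n : ℕ), IntervalIntegrable (fun y => a * Real.cos y ^ n) volume
        0 (2 * π) := fun a n => (by fun_prop : Continuous _).intervalIntegrable _ _
    have i2 : ∀ a : ℝ, IntervalIntegrable (fun y => a * Real.cos y) volume
        0 (2 * π) := fun a => (by fun_prop : Continuous _).intervalIntegrable _ _
    rw [intervalIntegral.integral_add (((i1 _ _).add (i1 _ _)).add (i2 _)) (by simp),
      intervalIntegral.integral_add ((i1 _ _).add (i1 _ _)) (i2 _),
      intervalIntegral.integral_add (i1 _ _) (i1 _ _)]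
    simp only [intervalIntegral.integral_const_mul, integral_cos_pow_three, integral_cos_sq,
      integral_cos, intervalIntegral.integral_const]
    simp
    ring
  rcases hc.eq_or_lt with rfl | hc
  · have h1 : ∀ y : ℝ, (1 - Real.cos y) ^ 4 / (2 * (2 - 1 - Real.cos y)) =
      (-1 / 2 : ℝ) * ((Real.cos y - 1) ^ 3 +
      (Real.cos y - 1) ^ 2 * (2 - 2 * 1) + (Real.cos y - 1) * (2 - 2 * 1) ^ 2 +
        (2 - 2 * 1) ^ 3) := by
      intro y
      rcases eq_or_ne (1 - Real.cos y) 0 with h | h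
      · have : Real.cos y = 1 := by linarith
        rw [this]; norm_num
      · rw [show (2 : ℝ) - 1 - Real.cos y = 1 - Real.cos y by ring]
        field_simp; ring
    simp only [h1]
    rw [hpoly]; norm_num
  · have hA : ∀ y, 0 < 2 - c - Real.cos y := fun y => by linarith [Real.cos_le_one y]
    have h1 : ∀ y : ℝ, (c - Real.cos y) ^ 4 / (2 * (2 - c - Real.cos y)) =
      8 * (1 - c) ^ 4 * (2 - c - Real.cos y)⁻¹ +
      (-1 / 2 : ℝ) * ((Real.cos y - c) ^ 3 +
      (Real.cos y - c) ^ 2 * (2 - 2 * c) + (Real.cos y - c) * (2 - 2 * c) ^ 2 +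
        (2 - 2 * c) ^ 3) := by
      intro y
      have := (hA y).ne'
      field_simp; ring
    simp only [h1]
    rw [intervalIntegral.integral_add, hpoly, intervalIntegral.integral_const_mul,
      integral_inv_sub_cos (by linarith)]
    · ring
    · exact (Continuous.intervalIntegrable
        (continuous_const.mul (Continuous.inv₀ (by fun_prop) fun y => (hA y).ne')) _ _)
    · exact (by fun_prop : Continuous _).intervalIntegrable _ _

theorem dispersion_apply (p : Torus2) :
    dispersion p = 2 * ((1 - cosT p.1) + (1 - cosT p.2)) := rfl

theorem dispersion_nonneg (p : Torus2) : 0 ≤ dispersion p := by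
  rw [dispersion_apply]; linarith [cosT_le_one p.1, cosT_le_one p.2]

/-- The function `(cos p₁ - cos p₂)² / 𝓔₀(p)`, which extends continuously by `0` to the zero of the
dispersion function. -/
def ratio : C(Torus2, ℝ) where
  toFun p := (cosT p.1 - cosT p.2) ^ 2 / dispersion p
  continuous_toFun := by
    rw [continuous_iff_continuousAt]
    intro p
    rcases eq_or_ne (dispersion p) 0 with h | h
    · have hle : ∀ q : Torus2, (cosT q.1 - cosT q.2) ^ 2 / dispersion q ≤ dispersion q / 4 := by
        intro q
        have h0 := dispersion_nonneg q
        rcases h0.eq_or_lt with h1 | h1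
        · rw [← h1]; simp
        · rw [div_le_iff₀ h1, dispersion_apply]
          nlinarith [mul_nonneg (sub_nonneg.2 (cosT_le_one q.1)) (sub_nonneg.2 (cosT_le_one q.2))]
      have hlim : Filter.Tendsto (fun q => dispersion q / 4) (nhds p) (nhds 0) := by
        have := (dispersion.continuous.tendsto p).div_const 4
        rwa [h, zero_div] at this
      change Filter.Tendsto _ _ (nhds ((cosT p.1 - cosT p.2) ^ 2 / dispersion p))
      rw [h, div_zero]
      exact squeeze_zero (fun q => div_nonneg (sq_nonneg _) (dispersion_nonneg q)) hle hlim
    · exact ContinuousAt.div (by fun_prop) dispersion.continuous.continuousAt h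

theorem ratio_apply (p : Torus2) :
    ratio p = (cosT p.1 - cosT p.2) ^ 2 / dispersion p := rfl

theorem dispersion_mul_ratio (p : Torus2) :
    dispersion p * ratio p = (cosT p.1 - cosT p.2) ^ 2 := by
  rw [ratio_apply]
  rcases eq_or_ne (dispersion p) 0 with h | h
  · have h1 := dispersion_apply p
    rw [h] at h1
    have h2 : cosT p.1 - cosT p.2 = 0 := by linarith [cosT_le_one p.1, cosT_le_one p.2]
    rw [h, h2]; simp
  · field_simp

theorem integral_ratio : ∫ p, (cosT p.1 - cosT p.2) ^ 2 * ratio p = 4 * π ^ 2 * kap := by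
  have h0 := integral_torus2 (⟨fun p => (cosT p.1 - cosT p.2) ^ 2, by fun_prop⟩ * ratio)
  simp only [ContinuousMap.mul_apply, ContinuousMap.coe_mk] at h0
  rw [h0, integral_torus]
  have h1 : ∀ x : ℝ, ∫ y : Torus, (cosT (x : Torus) - cosT y) ^ 2 * ratio ((x : Torus), y) =
      π * (16 * (1 - Real.cos x) ^ 4 / √((2 - Real.cos x) ^ 2 - 1)) -
        π * (9 - 61 / 2 * Real.cos x + 34 * Real.cos x ^ 2 - 15 * Real.cos x ^ 3) := by
    intro x
    rw [integral_torus, ← integral_quartic_div (Real.cos_le_one x)]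
    congr 1
    ext y
    simp only [ratio_apply, dispersion_apply, cosT_coe]
    rw [mul_div_assoc', show (2 : ℝ) * (1 - Real.cos x + (1 - Real.cos y)) =
      2 * (2 - Real.cos x - Real.cos y) by ring]
    congr 1; ring
  simp only [h1]
  have hne : ∫ x in (0 : ℝ)..(2 * π), 16 * (1 - Real.cos x) ^ 4 /
      √((2 - Real.cos x) ^ 2 - 1) ≠ 0 := by rw [integral_half_angle]; norm_num
  have hint : IntervalIntegrable (fun x => 16 * (1 - Real.cos x) ^ 4 /
      √((2 - Real.cos x) ^ 2 - 1)) volume 0 (2 * π) := by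
    by_contra h
    exact hne (intervalIntegral.integral_undef h)
  rw [intervalIntegral.integral_sub (hint.const_mul _)
    ((by fun_prop : Continuous _).intervalIntegrable _ _), intervalIntegral.integral_const_mul,
    integral_half_angle, intervalIntegral.integral_const_mul]
  have i1 : ∀ (a : ℝ) (n : ℕ), IntervalIntegrable (fun y => a * Real.cos y ^ n) volume
        0 (2 * π) := fun a n => (by fun_prop : Continuous _).intervalIntegrable _ _
  have i2 : ∀ a : ℝ, IntervalIntegrable (fun y => a * Real.cos y) volume
        0 (2 * π) := fun a => (by fun_prop : Continuous _).intervalIntegrable _ _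
  rw [intervalIntegral.integral_sub (((by simp : IntervalIntegrable (fun _ : ℝ => (9 : ℝ)) volume
    0 (2 * π)).sub (i2 _)).add (i1 _ _)) (i1 _ _),
    intervalIntegral.integral_add ((by simp : IntervalIntegrable (fun _ : ℝ => (9 : ℝ)) volume
    0 (2 * π)).sub (i2 _)) (i1 _ _), intervalIntegral.integral_sub (by simp) (i2 _)]
  simp only [intervalIntegral.integral_const_mul, integral_cos_pow_three, integral_cos_sq,
      integral_cos, intervalIntegral.integral_const]
  unfold kap
  have := Real.pi_ne_zero
  simp
  field_simp
  ring

/-! ### Divergence of the Green function at the threshold -/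

/-- The continuous function `(𝓔₀ + ε²)⁻¹`. -/
def green (ε : ℝ) (hε : 0 < ε) : C(Torus2, ℝ) :=
  ⟨fun p => (dispersion p + ε ^ 2)⁻¹, Continuous.inv₀ (by fun_prop) fun p => by
    have := dispersion_nonneg p
    positivity⟩

theorem green_apply (ε : ℝ) (hε : 0 < ε) (p : Torus2) :
    green ε hε p = (dispersion p + ε ^ 2)⁻¹ := rfl

theorem green_pos (ε : ℝ) (hε : 0 < ε) (p : Torus2) : 0 < green ε hε p := by
  have := dispersion_nonneg p
  rw [green_apply]; positivity

/-- In dimension two the Green function at the threshold diverges logarithmically. -/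
theorem log_le_integral_green {ε : ℝ} (hε : 0 < ε) (hε1 : ε ≤ 1) :
    π / 2 * Real.log ((1 + ε) / ε) ≤ ∫ p, green ε hε p := by
  rw [integral_torus2, integral_torus]
  have h1 : ∀ x : ℝ, ∫ y : Torus, green ε hε ((x : Torus), y) =
      π / √((2 - Real.cos x + ε ^ 2 / 2) ^ 2 - 1) := by
    intro x
    have h2 : 1 < 2 - Real.cos x + ε ^ 2 / 2 := by
      have := Real.cos_le_one x
      have : 0 < ε ^ 2 := by positivity
      linarith
    rw [integral_torus]
    have h3 : ∀ y : ℝ, green ε hε ((x : Torus), (y : Torus)) =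
        1 / 2 * (2 - Real.cos x + ε ^ 2 / 2 - Real.cos y)⁻¹ := by
      intro y
      rw [green_apply, dispersion_apply, one_div, ← mul_inv]
      simp only [cosT_coe]
      congr 1; ring
    simp only [h3]
    rw [intervalIntegral.integral_const_mul, integral_inv_sub_cos h2]
    ring
  simp only [h1]
  have hpos : ∀ x : ℝ, 0 < (2 - Real.cos x + ε ^ 2 / 2) ^ 2 - 1 := by
    intro x
    have := Real.cos_le_one x
    have : 0 < ε ^ 2 := by positivity
    nlinarith
  have hcont : Continuous fun x : ℝ => π / √((2 - Real.cos x + ε ^ 2 / 2) ^ 2 - 1) :=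
    Continuous.div (by fun_prop) (by fun_prop) fun x => (Real.sqrt_pos.2 (hpos x)).ne'
  have hpi : (1 : ℝ) ≤ 2 * π := by linarith [Real.pi_gt_three]
  have h4 : ∫ x in (0 : ℝ)..1, π / √((2 - Real.cos x + ε ^ 2 / 2) ^ 2 - 1) ≤
      ∫ x in (0 : ℝ)..(2 * π), π / √((2 - Real.cos x + ε ^ 2 / 2) ^ 2 - 1) := by
    refine intervalIntegral.integral_mono_interval le_rfl zero_le_one hpi ?_
      (hcont.intervalIntegrable _ _)
    refine Filter.Eventually.of_forall fun x => ?_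
    have := Real.pi_pos
    simp only [Pi.zero_apply]
    positivity
  refine le_trans ?_ h4
  have h5 : ∫ x in (0 : ℝ)..1, π / 2 * (x + ε)⁻¹ = π / 2 * Real.log ((1 + ε) / ε) := by
    rw [intervalIntegral.integral_const_mul]
    congr 1
    rw [intervalIntegral.integral_comp_add_right (fun x => x⁻¹), zero_add,
      integral_inv_of_pos hε (by linarith)]
  rw [← h5]
  refine intervalIntegral.integral_mono_on zero_le_one ?_ (hcont.intervalIntegrable _ _) ?_
  · refine ContinuousOn.intervalIntegrable ?_
    rw [Set.uIcc_of_le zero_le_one]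
    refine ContinuousOn.mul continuousOn_const (ContinuousOn.inv₀ (by fun_prop) fun x hx => ?_)
    have := hx.1
    positivity
  · intro x hx
    have hx0 := hx.1
    rw [← div_eq_mul_inv, div_div]
    refine div_le_div_of_nonneg_left Real.pi_pos.le (Real.sqrt_pos.2 (hpos x)) ?_
    refine Real.sqrt_le_iff.2 ⟨by positivity, ?_⟩
    have h6 := Real.one_sub_sq_div_two_le_cos (x := x)
    have h7 := Real.neg_one_le_cos x
    have h8 := Real.cos_le_one x
    have h9 : ε ^ 2 ≤ 1 := by nlinarith
    have h10 : (2 - Real.cos x + ε ^ 2 / 2) ^ 2 - 1 =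
      (1 - Real.cos x + ε ^ 2 / 2) * (3 - Real.cos x + ε ^ 2 / 2) := by ring
    have h11 : (1 - Real.cos x + ε ^ 2 / 2) * (3 - Real.cos x + ε ^ 2 / 2) ≤
        ((x ^ 2 + ε ^ 2) / 2) * 5 := by
      refine mul_le_mul ?_ ?_ ?_ ?_
      · linarith
      · linarith
      · nlinarith
      · positivity
    rw [h10]
    refine h11.trans ?_
    nlinarith [mul_nonneg hx0 hε.le, sq_nonneg x, sq_nonneg ε]

/-! ### Quadratic forms of the operators -/

theorem toL2_add (φ ψ : C(Torus2, ℝ)) : toL2 (φ + ψ) = toL2 φ + toL2 ψ := by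
  unfold toL2
  rw [← map_add]
  congr 1
  ext p
  simp [toComplex]

theorem toL2_smul (a : ℝ) (φ : C(Torus2, ℝ)) : toL2 (a • φ) = (a : ℂ) • toL2 φ := by
  unfold toL2
  rw [← map_smul]
  congr 1
  ext p
  simp [toComplex]

theorem inner_toL2_toL2 (φ ψ : C(Torus2, ℝ)) :
    inner ℂ (toL2 φ) (toL2 ψ) = ((∫ p, φ p * ψ p : ℝ) : ℂ) := by
  rw [inner_toL2, ← integral_complex_ofReal]
  refine integral_congr_ae ?_
  filter_upwards [coeFn_toL2 ψ] with p hp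
  rw [hp]; push_cast; rfl

theorem mulOp_toL2 (φ ψ : C(Torus2, ℝ)) : mulOp φ (toL2 ψ) = toL2 (φ * ψ) := by
  apply Lp.ext
  filter_upwards [coeFn_mulOp φ (toL2 ψ), coeFn_toL2 ψ, coeFn_toL2 (φ * ψ)] with p h1 h2 h3
  rw [h1, h2, h3]; simp

theorem inner_mulOp_left (φ : C(Torus2, ℝ)) (f g : L2) :
    inner ℂ (mulOp φ f) g = inner ℂ f (mulOp φ g) := by
  rw [L2.inner_def, L2.inner_def]
  refine integral_congr_ae ?_
  filter_upwards [coeFn_mulOp φ f, coeFn_mulOp φ g] with p h1 h2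
  rw [h1, h2]
  simp; ring

theorem re_inner_mulOp_nonneg {φ : C(Torus2, ℝ)} (hφ : ∀ p, 0 ≤ φ p) (f : L2) :
    0 ≤ (inner ℂ (mulOp φ f) f).re := by
  rw [L2.inner_def]
  have h : (∫ p, inner ℂ (mulOp φ f p) (f p)) = ∫ p, ((φ p * ‖f p‖ ^ 2 : ℝ) : ℂ) := by
    refine integral_congr_ae ?_
    filter_upwards [coeFn_mulOp φ f] with p h1
    rw [h1]
    have h2 := Complex.conj_mul' (f p)
    simp only [RCLike.inner_apply, map_mul, Complex.conj_ofReal]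
    push_cast
    rw [← h2]; ring
  rw [h, integral_complex_ofReal, Complex.ofReal_re]
  exact integral_nonneg fun p => mul_nonneg (hφ p) (by positivity)

theorem inner_intOp_left (φ : C(Torus2, ℝ)) (f g : L2) :
    inner ℂ (intOp φ f) g = star (inner ℂ (toL2 φ) f) * inner ℂ (toL2 φ) g := by
  change inner ℂ (inner ℂ (toL2 φ) f • toL2 φ) g = _
  rw [inner_smul_left]; rfl

theorem inner_toL2_of_compOp_eq (σ : Torus2 → Torus2) (hσ : MeasurePreserving σ volume volume)
    {φ ψ : C(Torus2, ℝ)} (h : ∀ p, φ (σ p) = ψ p) {f : L2} (hf : compOp σ hσ f = f) :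
    inner ℂ (toL2 ψ) f = inner ℂ (toL2 φ) f := by
  rw [← compOp_toL2 σ hσ φ ψ h]
  nth_rewrite 1 [← hf]
  exact (compOp σ hσ).inner_map_map _ _

theorem isClosed_L2ees : IsClosed (L2ees : Set L2) := by
  have h : (L2ees : Set L2) = {f | compOp _ mp_neg f = f} ∩ {f | compOp _ mp_swap f = f} ∩
      {f | compOp _ mp_refl f = f} := by
    ext f
    simp only [SetLike.mem_coe, mem_L2ees, Set.mem_inter_iff, Set.mem_ofPred_eq, and_assoc]
  rw [h]
  exact ((isClosed_eq (compOp _ mp_neg).continuous continuous_id).inter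
    (isClosed_eq (compOp _ mp_swap).continuous continuous_id)).inter
    (isClosed_eq (compOp _ mp_refl).continuous continuous_id)

instance completeSpaceL2ees : CompleteSpace L2ees := isClosed_L2ees.completeSpace_coe

theorem four_pi_sq_pos : 0 < 4 * π ^ 2 := by
  have := Real.pi_pos
  positivity

theorem four_pi_sq_ne_zero : ((4 * π ^ 2 : ℝ) : ℂ) ≠ 0 :=
  Complex.ofReal_ne_zero.2 four_pi_sq_pos.ne'

/-- The normalized moment `(4π²)⁻¹ ∫ φ f` of `f ∈ L^{2,ees}(𝕋²)`. -/
def moment (φ : C(Torus2, ℝ)) : L2ees →ₗ[ℂ] ℂ :=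
  ((4 * π ^ 2 : ℝ) : ℂ)⁻¹ • ((innerSL ℂ (toL2 φ)).toLinearMap ∘ₗ L2ees.subtype)

theorem inner_toL2_eq_moment (φ : C(Torus2, ℝ)) (f : L2ees) :
    inner ℂ (toL2 φ) (f : L2) = ((4 * π ^ 2 : ℝ) : ℂ) * moment φ f := by
  have h := four_pi_sq_ne_zero
  simp only [moment, LinearMap.smul_apply, LinearMap.comp_apply, smul_eq_mul,
    mul_inv_cancel_left₀ h]
  rfl

theorem moment_add (φ ψ : C(Torus2, ℝ)) (f : L2ees) :
    moment (φ + ψ) f = moment φ f + moment ψ f := by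
  simp only [moment, LinearMap.smul_apply, LinearMap.comp_apply, smul_eq_mul, toL2_add, map_add,
    ContinuousLinearMap.coe_coe, add_apply, mul_add]

theorem moment_smul (a : ℝ) (φ : C(Torus2, ℝ)) (f : L2ees) :
    moment (a • φ) f = a * moment φ f := by
  have h := four_pi_sq_ne_zero
  refine mul_left_cancel₀ h ?_
  rw [← inner_toL2_eq_moment, toL2_smul, inner_smul_left, Complex.conj_ofReal,
    inner_toL2_eq_moment]
  ring

theorem moment_cosSnd (f : L2ees) : moment cosSnd f = moment cosFst f := by
  have h := four_pi_sq_ne_zero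
  refine mul_left_cancel₀ h ?_
  rw [← inner_toL2_eq_moment, ← inner_toL2_eq_moment]
  exact inner_toL2_of_compOp_eq _ mp_swap (fun p => rfl) ((mem_L2ees _).1 f.2).2.1

theorem moment_cosTwoSnd (f : L2ees) : moment cosTwoSnd f = moment cosTwoFst f := by
  have h := four_pi_sq_ne_zero
  refine mul_left_cancel₀ h ?_
  rw [← inner_toL2_eq_moment, ← inner_toL2_eq_moment]
  exact inner_toL2_of_compOp_eq _ mp_swap (fun p => rfl) ((mem_L2ees _).1 f.2).2.1

theorem moment_sinSin (f : L2ees) : moment sinSin f = 0 := by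
  have h := four_pi_sq_ne_zero
  have h1 : moment ((-1 : ℝ) • sinSin) f = moment sinSin f := by
    refine mul_left_cancel₀ h ?_
    rw [← inner_toL2_eq_moment, ← inner_toL2_eq_moment]
    exact inner_toL2_of_compOp_eq _ mp_refl (fun p => by simp [sinSin]) ((mem_L2ees _).1 f.2).2.2
  rw [moment_smul] at h1
  push_cast at h1
  linear_combination (-1 / 2 : ℂ) * h1

theorem coe_hamiltonianEes (γ lam μ : ℝ) (f : L2ees) :
    ((hamiltonianEes γ lam μ f : L2ees) : L2) = hamiltonian γ lam μ f := rfl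

theorem potential_zero : potential 0 0 0 = 0 := by
  simp [potential]

/-- The form of the Hamiltonian on `L^{2,ees}(𝕋²)` in terms of moments. -/
theorem inner_hamiltonianEes (γ lam μ : ℝ) (f g : L2ees) :
    inner ℂ (hamiltonianEes γ lam μ f) g = inner ℂ (mulOp dispersion f) (g : L2) +
      ((4 * π ^ 2 : ℝ) : ℂ) * (γ * (star (moment 1 f) * moment 1 g) +
        2 * lam * (star (moment cosFst f) * moment cosFst g) +
        2 * μ * (star (moment cosTwoFst f) * moment cosTwoFst g) +
        2 * μ * (star (moment cosCos f) * moment cosCos g)) := by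
  rw [Submodule.coe_inner, coe_hamiltonianEes, hamiltonian, add_apply, inner_add_left]
  congr 1
  simp only [potential, add_apply, smul_apply, inner_add_left, inner_smul_left,
    Complex.conj_ofReal, inner_intOp_left, moment_sinSin, inner_toL2_eq_moment, moment_cosSnd,
    moment_cosTwoSnd, star_mul', mul_zero]
  have h := Complex.ofReal_ne_zero.2 Real.pi_ne_zero
  simp only [Complex.star_def, Complex.conj_ofReal]
  push_cast
  field_simp
  ring

theorem isSelfAdjoint_hamiltonianEes (γ lam μ : ℝ) : IsSelfAdjoint (hamiltonianEes γ lam μ) := by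
  rw [ContinuousLinearMap.isSelfAdjoint_iff_isSymmetric]
  intro f g
  have h1 := inner_hamiltonianEes γ lam μ f g
  have h2 := congrArg star (inner_hamiltonianEes γ lam μ g f)
  have h3 : star (inner ℂ (hamiltonianEes γ lam μ g) f) =
    inner ℂ f (hamiltonianEes γ lam μ g) :=
    inner_conj_symm (𝕜 := ℂ) f (hamiltonianEes γ lam μ g)
  have h4 : star (inner ℂ (mulOp dispersion g) (f : L2)) =
      inner ℂ (mulOp dispersion f) (g : L2) := by
    rw [inner_mulOp_left]; exact inner_conj_symm (𝕜 := ℂ) (mulOp dispersion (f : L2)) (g : L2)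
  rw [h3] at h2
  change inner ℂ (hamiltonianEes γ lam μ f) g = inner ℂ f (hamiltonianEes γ lam μ g)
  rw [h1, h2, star_add, h4]
  simp only [Complex.star_def, map_mul, map_add, Complex.conj_ofReal, Complex.conj_conj, map_ofNat]
  ring

/-- The kinetic energy operator in `L^{2,ees}(𝕋²)`. -/
def kineticEes : L2ees →L[ℂ] L2ees := hamiltonianEes 0 0 0

theorem coe_kineticEes (f : L2ees) : ((kineticEes f : L2ees) : L2) = mulOp dispersion f := by
  rw [kineticEes, coe_hamiltonianEes, hamiltonian, potential_zero, add_zero]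

theorem isPositive_kineticEes : kineticEes.IsPositive := by
  refine ⟨(isSelfAdjoint_hamiltonianEes 0 0 0).isSymmetric, fun f => ?_⟩
  have h : inner ℂ (kineticEes f) f = inner ℂ (mulOp dispersion f) (f : L2) := by
    rw [Submodule.coe_inner, coe_kineticEes]
  have := re_inner_mulOp_nonneg dispersion_nonneg (f : L2)
  rw [← h] at this
  exact this

theorem hasFiniteRange_intOp (φ : C(Torus2, ℝ)) : (intOp φ : L2 →ₗ[ℂ] L2).HasFiniteRange := by
  have h : (intOp φ : L2 →ₗ[ℂ] L2).range ≤ Submodule.span ℂ {toL2 φ} := by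
    rintro _ ⟨f, rfl⟩
    change inner ℂ (toL2 φ) f • toL2 φ ∈ _
    exact Submodule.smul_mem _ _ (Submodule.mem_span_singleton_self _)
  have : FiniteDimensional ℂ (intOp φ : L2 →ₗ[ℂ] L2).range :=
    Submodule.finiteDimensional_of_le h
  exact .of_finite

theorem hasFiniteRange_potential (γ lam μ : ℝ) :
    (potential γ lam μ : L2 →ₗ[ℂ] L2).HasFiniteRange := by
  have h := hasFiniteRange_intOp
  unfold potential
  simp only [ContinuousLinearMap.toLinearMap_add, ContinuousLinearMap.toLinearMap_smul]
  exact (((((h _).smul _).add (((h _).add (h _)).smul _)).add (((h _).add (h _)).smul _)).add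
    ((h _).smul _)).add ((h _).smul _)

theorem hasFiniteRange_sub_kineticEes (γ lam μ : ℝ) :
    ((hamiltonianEes γ lam μ - kineticEes : L2ees →L[ℂ] L2ees) :
      L2ees →ₗ[ℂ] L2ees).HasFiniteRange := by
  set V := ((hamiltonianEes γ lam μ - kineticEes : L2ees →L[ℂ] L2ees) : L2ees →ₗ[ℂ] L2ees)
  have hV : ∀ f : L2ees, ((V f : L2ees) : L2) = potential γ lam μ f := by
    intro f
    change ((hamiltonianEes γ lam μ f : L2ees) : L2) - ((kineticEes f : L2ees) : L2) = _
    rw [coe_hamiltonianEes, coe_kineticEes, hamiltonian, add_apply, add_sub_cancel_left]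
  have : FiniteDimensional ℂ (potential γ lam μ : L2 →ₗ[ℂ] L2).range :=
    .of_fg (hasFiniteRange_potential γ lam μ)
  have h1 : FiniteDimensional ℂ V.range := by
    have hle : V.range.map L2ees.subtype ≤ (potential γ lam μ : L2 →ₗ[ℂ] L2).range := by
      rintro _ ⟨_, ⟨f, rfl⟩, rfl⟩
      exact ⟨f, (hV f).symm⟩
    have := Submodule.finiteDimensional_of_le hle
    exact LinearEquiv.finiteDimensional
      (Submodule.equivMapOfInjective L2ees.subtype L2ees.injective_subtype V.range).symm
  exact .of_finite

/-! ### Trial functions -/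

/-- Invariance of a continuous function under the symmetries defining `L^{2,ees}(𝕋²)`. -/
def IsEes (φ : C(Torus2, ℝ)) : Prop :=
  (∀ p, φ (-p) = φ p) ∧ (∀ p, φ (p.2, p.1) = φ p) ∧ ∀ p, φ (-p.1, p.2) = φ p

/-- An invariant continuous function as an element of `L^{2,ees}(𝕋²)`. -/
def toEes (φ : C(Torus2, ℝ)) (h : IsEes φ) : L2ees :=
  ⟨toL2 φ, (mem_L2ees _).2 ⟨compOp_toL2 _ mp_neg φ φ h.1, compOp_toL2 _ mp_swap φ φ h.2.1,
    compOp_toL2 _ mp_refl φ φ h.2.2⟩⟩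

/-- `cos p₁ + cos p₂`. -/
def cosSum : C(Torus2, ℝ) := cosFst + cosSnd

theorem cosSum_apply (p : Torus2) : cosSum p = cosT p.1 + cosT p.2 := rfl

theorem isEes_dispersion : IsEes dispersion :=
  ⟨fun p => by simp [dispersion_apply], fun p => by simp [dispersion_apply, add_comm],
    fun p => by simp [dispersion_apply]⟩

theorem isEes_one : IsEes 1 := ⟨fun _ => rfl, fun _ => rfl, fun _ => rfl⟩

theorem isEes_cosSum : IsEes cosSum :=
  ⟨fun p => by simp [cosSum_apply], fun p => by simp [cosSum_apply, add_comm],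
    fun p => by simp [cosSum_apply]⟩

theorem isEes_ratio : IsEes ratio := by
  refine ⟨fun p => ?_, fun p => ?_, fun p => ?_⟩
  · rw [ratio_apply, ratio_apply, isEes_dispersion.1]; simp
  · rw [ratio_apply, ratio_apply, isEes_dispersion.2.1]; simp only; ring
  · rw [ratio_apply, ratio_apply, isEes_dispersion.2.2]; simp

/-- The moment of a product of two real functions. -/
def pairing (φ ψ : C(Torus2, ℝ)) : ℝ := (∫ p, φ p * ψ p) / (4 * π ^ 2)

theorem moment_toEes (φ ψ : C(Torus2, ℝ)) (h : IsEes ψ) :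
    moment φ (toEes ψ h) = (pairing φ ψ : ℂ) := by
  have h0 := four_pi_sq_ne_zero
  refine mul_left_cancel₀ h0 ?_
  rw [← inner_toL2_eq_moment]
  change inner ℂ (toL2 φ) (toL2 ψ) = _
  rw [inner_toL2_toL2, pairing, ← Complex.ofReal_mul, mul_div_cancel₀]
  have := Real.pi_pos; positivity

theorem pairing_mul_comm (φ ψ χ : C(Torus2, ℝ)) :
    pairing (φ * ψ) χ = pairing (φ * χ) ψ := by
  unfold pairing
  congr 2; ext p; simp; ring

/-- The kinetic energy of `f` against a real function, by self-adjointness a moment. -/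
theorem inner_mulOp_dispersion_toL2 (f : L2ees) (ψ : C(Torus2, ℝ)) :
    inner ℂ (mulOp dispersion f) (toL2 ψ) =
      ((4 * π ^ 2 : ℝ) : ℂ) * star (moment (dispersion * ψ) f) := by
  rw [inner_mulOp_left, mulOp_toL2, ← inner_conj_symm, inner_toL2_eq_moment, map_mul,
    Complex.conj_ofReal]
  rfl

theorem moment_dispersion_one (f : L2ees) :
    moment (dispersion * 1) f = 4 * moment 1 f - 4 * moment cosFst f := by
  have h : dispersion * 1 = (4 : ℝ) • (1 : C(Torus2, ℝ)) + (-2 : ℝ) • cosFst +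
      (-2 : ℝ) • cosSnd := by
    ext p
    simp only [ContinuousMap.mul_apply, ContinuousMap.add_apply, ContinuousMap.smul_apply,
      ContinuousMap.one_apply, dispersion_apply, cosFst, cosSnd, ContinuousMap.coe_mk, smul_eq_mul]
    ring
  rw [h]
  simp only [moment_add, moment_smul, moment_cosSnd]
  push_cast; ring

theorem moment_dispersion_cosSum (f : L2ees) :
    moment (dispersion * cosSum) f = 8 * moment cosFst f - 2 * moment 1 f -
      2 * moment cosTwoFst f - 4 * moment cosCos f := by
  have h : dispersion * cosSum = (4 : ℝ) • cosFst + (4 : ℝ) • cosSnd +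
      (-2 : ℝ) • (1 : C(Torus2, ℝ)) + (-1 : ℝ) • cosTwoFst + (-1 : ℝ) • cosTwoSnd +
      (-4 : ℝ) • cosCos := by
    ext p
    simp only [ContinuousMap.mul_apply, ContinuousMap.add_apply, ContinuousMap.smul_apply,
      ContinuousMap.one_apply, dispersion_apply, cosSum_apply, cosFst, cosSnd, cosTwoFst,
      cosTwoSnd, cosCos, cosT_two_smul, ContinuousMap.coe_mk, smul_eq_mul]
    ring
  rw [h]
  simp only [moment_add, moment_smul, moment_cosSnd, moment_cosTwoSnd]
  push_cast; ring

theorem moment_dispersion_ratio (f : L2ees) :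
    moment (dispersion * ratio) f = moment 1 f + moment cosTwoFst f - 2 * moment cosCos f := by
  have h : dispersion * ratio = (1 : ℝ) • (1 : C(Torus2, ℝ)) + (1 / 2 : ℝ) • cosTwoFst +
      (1 / 2 : ℝ) • cosTwoSnd + (-2 : ℝ) • cosCos := by
    ext p
    simp only [ContinuousMap.mul_apply, ContinuousMap.add_apply, ContinuousMap.smul_apply,
      ContinuousMap.one_apply, dispersion_mul_ratio, cosTwoFst,
      cosTwoSnd, cosCos, cosT_two_smul, ContinuousMap.coe_mk, smul_eq_mul]
    ring
  rw [h]
  simp only [moment_add, moment_smul, moment_cosTwoSnd]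
  push_cast; ring

theorem integral_monomial (m n : ℕ) :
    ∫ p : Torus2, cosT p.1 ^ m * cosT p.2 ^ n = (∫ x, cosT x ^ m) * ∫ x, cosT x ^ n :=
  integral_mul_torus2 (fun x => cosT x ^ m) (fun x => cosT x ^ n)

theorem integrable_monomial (a : ℝ) (m n : ℕ) :
    Integrable (fun p : Torus2 => a * (cosT p.1 ^ m * cosT p.2 ^ n)) volume :=
  integrable_torus2 ⟨fun p => a * (cosT p.1 ^ m * cosT p.2 ^ n), by fun_prop⟩

theorem integral_cosT_pow_zero : ∫ x : Torus, cosT x ^ 0 = 2 * π := by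
  simp only [pow_zero]; rw [integral_torus_const]; ring

theorem integral_cosT_pow_one : ∫ x : Torus, cosT x ^ 1 = 0 := by
  simp only [pow_one]; exact integral_cosT

theorem pairing_one_one : pairing 1 1 = 1 := by
  have h := integral_monomial 0 0
  have := Real.pi_ne_zero
  rw [integral_cosT_pow_zero] at h
  simp only [pow_zero, mul_one] at h
  unfold pairing
  simp only [ContinuousMap.one_apply, mul_one]
  rw [h]; field_simp; norm_num

theorem pairing_cosFst_one : pairing cosFst 1 = 0 := by
  have h := integral_monomial 1 0
  rw [integral_cosT_pow_one, zero_mul] at h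
  simp only [pow_zero, mul_one, pow_one] at h
  unfold pairing
  simp only [ContinuousMap.one_apply, mul_one]
  exact (congrArg (· / (4 * π ^ 2)) h).trans (zero_div _)

theorem pairing_cosCos_one : pairing cosCos 1 = 0 := by
  have h := integral_monomial 1 1
  rw [integral_cosT_pow_one, zero_mul] at h
  simp only [pow_one] at h
  unfold pairing
  simp only [ContinuousMap.one_apply, mul_one]
  exact (congrArg (· / (4 * π ^ 2)) h).trans (zero_div _)

theorem pairing_cosTwoFst_one : pairing cosTwoFst 1 = 0 := by
  have h : ∀ p : Torus2, cosTwoFst p * (1 : C(Torus2, ℝ)) p =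
      2 * (cosT p.1 ^ 2 * cosT p.2 ^ 0) + (-1) * (cosT p.1 ^ 0 * cosT p.2 ^ 0) := by
    intro p
    simp only [cosTwoFst, ContinuousMap.coe_mk, cosT_two_smul, ContinuousMap.one_apply]; ring
  unfold pairing
  simp only [h]
  rw [integral_add (integrable_monomial _ _ _) (integrable_monomial _ _ _), integral_const_mul,
    integral_const_mul, integral_monomial, integral_monomial, integral_cosT_pow_zero,
    integral_cosT_sq]
  ring

theorem pairing_one_cosSum : pairing 1 cosSum = 0 := by
  have h : ∀ p : Torus2, (1 : C(Torus2, ℝ)) p * cosSum p =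
      1 * (cosT p.1 ^ 1 * cosT p.2 ^ 0) + 1 * (cosT p.1 ^ 0 * cosT p.2 ^ 1) := by
    intro p
    simp only [cosSum_apply, ContinuousMap.one_apply]; ring
  unfold pairing
  simp only [h]
  rw [integral_add (integrable_monomial _ _ _) (integrable_monomial _ _ _), integral_const_mul,
    integral_const_mul, integral_monomial, integral_monomial, integral_cosT_pow_zero,
    integral_cosT_pow_one]
  ring

theorem pairing_cosFst_cosSum : pairing cosFst cosSum = 1 / 2 := by
  have h : ∀ p : Torus2, cosFst p * cosSum p =
      1 * (cosT p.1 ^ 2 * cosT p.2 ^ 0) + 1 * (cosT p.1 ^ 1 * cosT p.2 ^ 1) := by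
    intro p
    simp only [cosSum_apply, cosFst, ContinuousMap.coe_mk]; ring
  unfold pairing
  simp only [h]
  rw [integral_add (integrable_monomial _ _ _) (integrable_monomial _ _ _), integral_const_mul,
    integral_const_mul, integral_monomial, integral_monomial, integral_cosT_pow_zero,
    integral_cosT_pow_one, integral_cosT_sq]
  have := Real.pi_ne_zero
  field_simp
  ring

theorem pairing_cosCos_cosSum : pairing cosCos cosSum = 0 := by
  have h : ∀ p : Torus2, cosCos p * cosSum p =
      1 * (cosT p.1 ^ 2 * cosT p.2 ^ 1) + 1 * (cosT p.1 ^ 1 * cosT p.2 ^ 2) := by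
    intro p
    simp only [cosSum_apply, cosCos, ContinuousMap.coe_mk]; ring
  unfold pairing
  simp only [h]
  rw [integral_add (integrable_monomial _ _ _) (integrable_monomial _ _ _), integral_const_mul,
    integral_const_mul, integral_monomial, integral_monomial, integral_cosT_pow_one]
  ring

theorem pairing_cosTwoFst_cosSum : pairing cosTwoFst cosSum = 0 := by
  have h : ∀ p : Torus2, cosTwoFst p * cosSum p =
      (2 * (cosT p.1 ^ 3 * cosT p.2 ^ 0) + (-1) * (cosT p.1 ^ 1 * cosT p.2 ^ 0)) +
        (2 * (cosT p.1 ^ 2 * cosT p.2 ^ 1) + (-1) * (cosT p.1 ^ 0 * cosT p.2 ^ 1)) := by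
    intro p
    simp only [cosTwoFst, ContinuousMap.coe_mk, cosT_two_smul, cosSum_apply]; ring
  unfold pairing
  simp only [h]
  have i : ∀ (a b : ℝ) (m n k l : ℕ), Integrable (fun p : Torus2 =>
      a * (cosT p.1 ^ m * cosT p.2 ^ n) + b * (cosT p.1 ^ k * cosT p.2 ^ l)) volume :=
    fun a b m n k l => (integrable_monomial a m n).add (integrable_monomial b k l)
  rw [integral_add (i _ _ _ _ _ _) (i _ _ _ _ _ _),
    integral_add (integrable_monomial _ _ _) (integrable_monomial _ _ _),
    integral_add (integrable_monomial _ _ _) (integrable_monomial _ _ _)]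
  simp only [integral_const_mul, integral_monomial, integral_cosT_pow_one,
    integral_cosT_pow_three]
  ring

theorem pairing_dispersion_ratio_ratio : pairing (dispersion * ratio) ratio = kap := by
  unfold pairing
  simp only [ContinuousMap.mul_apply, dispersion_mul_ratio]
  rw [integral_ratio]
  have := Real.pi_ne_zero
  field_simp

/-! ### Reduction to the threshold form: the lower bound -/

theorem pairing_dispersion_one {φ : C(Torus2, ℝ)} (h : IsEes φ) :
    pairing (dispersion * 1) φ = 4 * pairing 1 φ - 4 * pairing cosFst φ := by
  have := moment_dispersion_one (toEes φ h)
  simp only [moment_toEes] at this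
  exact_mod_cast this

theorem pairing_dispersion_cosSum {φ : C(Torus2, ℝ)} (h : IsEes φ) :
    pairing (dispersion * cosSum) φ = 8 * pairing cosFst φ - 2 * pairing 1 φ -
      2 * pairing cosTwoFst φ - 4 * pairing cosCos φ := by
  have := moment_dispersion_cosSum (toEes φ h)
  simp only [moment_toEes] at this
  exact_mod_cast this

theorem pairing_dispersion_ratio {φ : C(Torus2, ℝ)} (h : IsEes φ) :
    pairing (dispersion * ratio) φ = pairing 1 φ + pairing cosTwoFst φ - 2 * pairing cosCos φ := by
  have := moment_dispersion_ratio (toEes φ h)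
  simp only [moment_toEes] at this
  exact_mod_cast this

/-- The kinetic energies of `1`, `cos p₁ + cos p₂` and `ratio`. -/
theorem kinetic_table :
    pairing (dispersion * 1) 1 = 4 ∧ pairing (dispersion * 1) cosSum = -2 ∧
    pairing (dispersion * 1) ratio = 1 ∧ pairing (dispersion * cosSum) 1 = -2 ∧
    pairing (dispersion * cosSum) cosSum = 4 ∧ pairing (dispersion * cosSum) ratio = 0 ∧
    pairing (dispersion * ratio) 1 = 1 ∧ pairing (dispersion * ratio) cosSum = 0 := by
  have h1 : pairing (dispersion * ratio) 1 = 1 := by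
    rw [pairing_dispersion_ratio isEes_one, pairing_one_one, pairing_cosTwoFst_one,
      pairing_cosCos_one]; norm_num
  have h2 : pairing (dispersion * ratio) cosSum = 0 := by
    rw [pairing_dispersion_ratio isEes_cosSum, pairing_one_cosSum, pairing_cosTwoFst_cosSum,
      pairing_cosCos_cosSum]; norm_num
  have h3 : pairing (dispersion * 1) cosSum = -2 := by
    rw [pairing_dispersion_one isEes_cosSum, pairing_one_cosSum, pairing_cosFst_cosSum]; norm_num
  refine ⟨?_, h3, ?_, ?_, ?_, ?_, h1, h2⟩
  · rw [pairing_dispersion_one isEes_one, pairing_one_one, pairing_cosFst_one]; norm_num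
  · rw [pairing_mul_comm, h1]
  · rw [pairing_mul_comm, h3]
  · rw [pairing_dispersion_cosSum isEes_cosSum, pairing_one_cosSum, pairing_cosFst_cosSum,
      pairing_cosTwoFst_cosSum, pairing_cosCos_cosSum]; norm_num
  · rw [pairing_mul_comm, h2]

/-- Dirichlet principle: among all functions with prescribed moments against `𝓔₀`,
`𝓔₀ (cos p₁ + cos p₂)` and `(cos p₁ - cos p₂)²`, the kinetic energy is minimal at a combination of
`1`, `cos p₁ + cos p₂` and `ratio`. -/
theorem kinetic_lower_bound (f : L2ees) (a b d : ℂ)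
    (h0 : moment (dispersion * 1) f = 4 * a - 2 * b + d)
    (h1 : moment (dispersion * cosSum) f = -2 * a + 4 * b)
    (h2 : moment (dispersion * ratio) f = a + kap * d) :
    4 * π ^ 2 * (a * star (4 * a - 2 * b + d) + b * star (-2 * a + 4 * b) +
      d * star (a + kap * d)).re ≤ (inner ℂ (mulOp dispersion f) (f : L2)).re := by
  obtain ⟨t1, t2, t3, t4, t5, t6, t7, t8⟩ := kinetic_table
  set G : L2ees := a • toEes 1 isEes_one + b • toEes cosSum isEes_cosSum +
    d • toEes ratio isEes_ratio with hG
  have hGc : (G : L2) = a • toL2 1 + b • toL2 cosSum + d • toL2 ratio := rfl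
  have g0 : moment (dispersion * 1) G = 4 * a - 2 * b + d := by
    simp only [hG, map_add, map_smul, moment_toEes, t1, t2, t3, smul_eq_mul]
    push_cast; ring
  have g1 : moment (dispersion * cosSum) G = -2 * a + 4 * b := by
    simp only [hG, map_add, map_smul, moment_toEes, t4, t5, t6, smul_eq_mul]
    push_cast; ring
  have g2 : moment (dispersion * ratio) G = a + kap * d := by
    simp only [hG, map_add, map_smul, moment_toEes, t7, t8, pairing_dispersion_ratio_ratio,
      smul_eq_mul]
    push_cast; ring
  set X : ℂ := a * star (4 * a - 2 * b + d) + b * star (-2 * a + 4 * b) +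
      d * star (a + kap * d) with hX
  have hinner : ∀ u : L2ees, moment (dispersion * 1) u = 4 * a - 2 * b + d →
      moment (dispersion * cosSum) u = -2 * a + 4 * b →
      moment (dispersion * ratio) u = a + kap * d →
      inner ℂ (mulOp dispersion u) (G : L2) = ((4 * π ^ 2 : ℝ) : ℂ) * X := by
    intro u k0 k1 k2
    rw [hGc, inner_add_right, inner_add_right, inner_smul_right, inner_smul_right,
      inner_smul_right, inner_mulOp_dispersion_toL2, inner_mulOp_dispersion_toL2,
      inner_mulOp_dispersion_toL2, k0, k1, k2, hX]
    ring
  have hfG := hinner f h0 h1 h2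
  have hGG := hinner G g0 g1 g2
  have hGf : inner ℂ (mulOp dispersion G) (f : L2) = star (((4 * π ^ 2 : ℝ) : ℂ) * X) := by
    rw [← hfG, inner_mulOp_left]
    exact (inner_conj_symm (𝕜 := ℂ) _ _).symm
  have hpos := re_inner_mulOp_nonneg dispersion_nonneg ((f : L2) - (G : L2))
  rw [map_sub, inner_sub_left, inner_sub_right, inner_sub_right, hfG, hGG, hGf] at hpos
  simp only [Complex.sub_re, Complex.star_def, Complex.conj_re, Complex.re_ofReal_mul] at hpos
  linarith

/-- The variables `d, t, u₁, u₀` of the threshold form as functions of `f`. The last two are the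
moments against `cos p₁` and `1`; the first two are found by solving for them the equations
`(κ - 1) d / 2 + t = u₂` and `-(κ + 1) d / 4 + t = u₃`, where `u₂, u₃` are the moments against
`cos 2p₁` and `cos p₁ cos p₂`. -/
def thresholdCoord : L2ees →ₗ[ℂ] Fin 4 → ℂ :=
  LinearMap.pi ![((4 / (3 * kap - 1) : ℝ) : ℂ) • (moment cosTwoFst - moment cosCos),
    moment cosTwoFst - ((2 * (kap - 1) / (3 * kap - 1) : ℝ) : ℂ) •
      (moment cosTwoFst - moment cosCos),
    moment cosFst, moment 1]

/-- The threshold form as the kinetic energy of `a + b (cos p₁ + cos p₂) + d · ratio`, where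
`a = u₀ - t` and `b = 2 u₁ + d / 2 - 2 t`, plus the interaction. -/
theorem sum_thresholdForm (γ lam μ : ℝ) (x : Fin 4 → ℂ) :
    ∑ i, ∑ j, thresholdForm γ lam μ i j * (star (x i) * x j).re =
      ((x 3 - x 1) * star (4 * (x 3 - x 1) - 2 * (2 * x 2 + x 0 / 2 - 2 * x 1) + x 0) +
        (2 * x 2 + x 0 / 2 - 2 * x 1) *
          star (-2 * (x 3 - x 1) + 4 * (2 * x 2 + x 0 / 2 - 2 * x 1)) +
        x 0 * star (x 3 - x 1 + kap * x 0)).re +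
      (γ * (star (x 3) * x 3) + 2 * lam * (star (x 2) * x 2) +
        2 * μ * (star ((kap - 1) / 2 * x 0 + x 1) * ((kap - 1) / 2 * x 0 + x 1)) +
        2 * μ * (star (-(kap + 1) / 4 * x 0 + x 1) * (-(kap + 1) / 4 * x 0 + x 1))).re := by
  have h2 : (2 : ℂ) * x 2 + x 0 / 2 - 2 * x 1 = 2 * x 2 + ((1 / 2 : ℝ) : ℂ) * x 0 - 2 * x 1 := by
    push_cast; ring
  have h3 : ((kap : ℂ) - 1) / 2 * x 0 = (((kap - 1) / 2 : ℝ) : ℂ) * x 0 := by push_cast; ring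
  have h4 : -((kap : ℂ) + 1) / 4 * x 0 = ((-(kap + 1) / 4 : ℝ) : ℂ) * x 0 := by push_cast; ring
  rw [h2, h3, h4]
  simp [Fin.sum_univ_four, thresholdForm, blockP, blockQ]
  ring

/-- The energy is bounded below by the threshold form of the moments. -/
theorem thresholdForm_le (γ lam μ : ℝ) (f : L2ees) :
    ∑ i, ∑ j, ((4 * π ^ 2) • thresholdForm γ lam μ) i j *
      (star (thresholdCoord f i) * thresholdCoord f j).re ≤
      (inner ℂ (hamiltonianEes γ lam μ f) f).re := by
  have h3 : ((3 * kap - 1 : ℝ) : ℂ) ≠ 0 := Complex.ofReal_ne_zero.2 three_kap_sub_one_pos.ne'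
  set x := thresholdCoord f with hx
  have x0 : x 0 = ((4 / (3 * kap - 1) : ℝ) : ℂ) * (moment cosTwoFst f - moment cosCos f) := rfl
  have x1 : x 1 = moment cosTwoFst f - ((2 * (kap - 1) / (3 * kap - 1) : ℝ) : ℂ) *
    (moment cosTwoFst f - moment cosCos f) := rfl
  have x2 : x 2 = moment cosFst f := rfl
  have x3 : x 3 = moment 1 f := rfl
  have m2 : moment cosTwoFst f = (kap - 1) / 2 * x 0 + x 1 := by
    rw [x0, x1]; push_cast at h3 ⊢; field_simp; ring
  have m3 : moment cosCos f = -(kap + 1) / 4 * x 0 + x 1 := by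
    have h5 : (3 * (kap : ℂ) - 1) * x 0 = 4 * (moment cosTwoFst f - moment cosCos f) := by
      rw [x0]; push_cast at h3 ⊢; field_simp
    linear_combination m2 + h5 / 4
  have hk := kinetic_lower_bound f (x 3 - x 1) (2 * x 2 + x 0 / 2 - 2 * x 1) (x 0)
    (by rw [moment_dispersion_one, ← x2, ← x3]; ring)
    (by rw [moment_dispersion_cosSum, m2, m3, ← x2, ← x3]; ring)
    (by rw [moment_dispersion_ratio, m2, m3, ← x3]; ring)
  rw [inner_hamiltonianEes, Complex.add_re, Complex.re_ofReal_mul, m2, m3, ← x2, ← x3]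
  have hs : ∑ i, ∑ j, ((4 * π ^ 2) • thresholdForm γ lam μ) i j * (star (x i) * x j).re =
      4 * π ^ 2 * ∑ i, ∑ j, thresholdForm γ lam μ i j * (star (x i) * x j).re := by
    simp only [Matrix.smul_apply, smul_eq_mul, Finset.mul_sum, mul_assoc]
  rw [hs, sum_thresholdForm, mul_add]
  linarith

/-! ### Reduction to the threshold form: trial functions concentrating at the threshold -/

/-- The normalizing constant of `chi n`, which tends to `0`. -/
def chiScale (n : ℕ) : ℝ := 4 * π ^ 2 / ∫ p, green (1 / (n + 1)) Nat.one_div_pos_of_nat p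

/-- Resolvents of the kinetic energy with mean `1`, concentrating at the minimum of the
dispersion function. -/
def chi (n : ℕ) : C(Torus2, ℝ) := chiScale n • green (1 / (n + 1)) Nat.one_div_pos_of_nat

theorem log_le_integral_green_nat (n : ℕ) :
    π / 2 * Real.log (n + 2) ≤ ∫ p, green (1 / (n + 1)) Nat.one_div_pos_of_nat p := by
  have h := log_le_integral_green (ε := 1 / ((n : ℝ) + 1)) Nat.one_div_pos_of_nat
    (by rw [div_le_one (by positivity)]; linarith [(Nat.cast_nonneg n : (0 : ℝ) ≤ n)])
  have h2 : (1 + 1 / ((n : ℝ) + 1)) / (1 / (n + 1)) = n + 2 := by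
    have : (n : ℝ) + 1 ≠ 0 := by positivity
    field_simp; ring
  rwa [h2] at h

theorem integral_green_pos (n : ℕ) :
    0 < ∫ p, green (1 / (n + 1)) Nat.one_div_pos_of_nat p := by
  refine lt_of_lt_of_le ?_ (log_le_integral_green_nat n)
  have : 0 < Real.log ((n : ℝ) + 2) :=
    Real.log_pos (by linarith [(Nat.cast_nonneg n : (0 : ℝ) ≤ n)])
  have := Real.pi_pos
  positivity

theorem chiScale_pos (n : ℕ) : 0 < chiScale n := div_pos four_pi_sq_pos (integral_green_pos n)

open Filter Topology in
theorem tendsto_chiScale : Tendsto chiScale atTop (𝓝 0) := by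
  refine Tendsto.div_atTop tendsto_const_nhds ?_
  refine tendsto_atTop_mono log_le_integral_green_nat ?_
  refine Tendsto.const_mul_atTop (by have := Real.pi_pos; positivity) ?_
  exact Real.tendsto_log_atTop.comp
    (tendsto_atTop_add_const_right _ _ tendsto_natCast_atTop_atTop)

theorem chi_apply (n : ℕ) (p : Torus2) :
    chi n p = chiScale n * (dispersion p + (1 / (n + 1)) ^ 2)⁻¹ := rfl

theorem chi_nonneg (n : ℕ) (p : Torus2) : 0 ≤ chi n p :=
  mul_nonneg (chiScale_pos n).le (green_pos _ _ p).le

theorem isEes_chi (n : ℕ) : IsEes (chi n) :=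
  ⟨fun p => by rw [chi_apply, chi_apply, isEes_dispersion.1],
    fun p => by rw [chi_apply, chi_apply, isEes_dispersion.2.1],
    fun p => by rw [chi_apply, chi_apply, isEes_dispersion.2.2]⟩

theorem pairing_one_chi (n : ℕ) : pairing 1 (chi n) = 1 := by
  unfold pairing
  simp only [ContinuousMap.one_apply, one_mul]
  have h : ∫ p, chi n p = chiScale n * ∫ p, green (1 / (n + 1)) Nat.one_div_pos_of_nat p :=
    integral_const_mul _ _
  rw [h, chiScale, div_mul_cancel₀ _ (integral_green_pos n).ne', div_self four_pi_sq_pos.ne']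

theorem abs_dispersion_mul_chi_le (n : ℕ) (p : Torus2) :
    |dispersion p * chi n p| ≤ chiScale n := by
  have h1 := dispersion_nonneg p
  have h2 : (0 : ℝ) < (1 / ((n : ℝ) + 1)) ^ 2 := by positivity
  rw [abs_of_nonneg (mul_nonneg h1 (chi_nonneg n p)), chi_apply, mul_left_comm,
    ← div_eq_mul_inv]
  refine mul_le_of_le_one_right (chiScale_pos n).le ?_
  rw [div_le_one (by positivity)]
  linarith

theorem abs_pairing_chi_le (n : ℕ) (ψ : C(Torus2, ℝ)) :
    |pairing (dispersion * chi n) ψ| ≤ chiScale n * pairing 1 |ψ| := by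
  unfold pairing
  rw [abs_div, abs_of_pos four_pi_sq_pos, mul_div_assoc']
  refine div_le_div_of_nonneg_right ?_ four_pi_sq_pos.le
  rw [← integral_const_mul]
  refine (abs_integral_le_integral_abs).trans ?_
  refine integral_mono (integrable_torus2 |dispersion * chi n * ψ|)
    (integrable_torus2 (chiScale n • (1 * |ψ|))) fun p => ?_
  have := abs_dispersion_mul_chi_le n p
  simp only [ContinuousMap.mul_apply, ContinuousMap.one_apply, ContinuousMap.abs_apply, one_mul]
  rw [abs_mul]
  exact mul_le_mul_of_nonneg_right this (abs_nonneg _)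

open Filter Topology in
theorem tendsto_pairing_chi (ψ : C(Torus2, ℝ)) :
    Tendsto (fun n => pairing (dispersion * chi n) ψ) atTop (𝓝 0) := by
  refine squeeze_zero_norm (fun n => abs_pairing_chi_le n ψ) ?_
  simpa using tendsto_chiScale.mul_const (pairing 1 |ψ|)

open Filter Topology in
theorem tendsto_pairing_chi_chi :
    Tendsto (fun n => pairing (dispersion * chi n) (chi n)) atTop (𝓝 0) := by
  refine squeeze_zero_norm (fun n => ?_) tendsto_chiScale
  have h : |chi n| = chi n := by
    ext p; rw [ContinuousMap.abs_apply, abs_of_nonneg (chi_nonneg n p)]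
  have := abs_pairing_chi_le n (chi n)
  rwa [h, pairing_one_chi, mul_one] at this

open Filter Topology in
/-- Against the moments defining the interaction, `chi n` converges to a point mass. -/
theorem tendsto_moments_chi :
    Tendsto (fun n => pairing cosFst (chi n)) atTop (𝓝 1) ∧
    Tendsto (fun n => pairing cosTwoFst (chi n)) atTop (𝓝 1) ∧
    Tendsto (fun n => pairing cosCos (chi n)) atTop (𝓝 1) := by
  have h0 : Tendsto (fun n => pairing (dispersion * 1) (chi n)) atTop (𝓝 0) := by
    simpa only [pairing_mul_comm dispersion 1] using tendsto_pairing_chi 1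
  have h1 : Tendsto (fun n => pairing (dispersion * cosSum) (chi n)) atTop (𝓝 0) := by
    simpa only [pairing_mul_comm dispersion cosSum] using tendsto_pairing_chi cosSum
  have h2 : Tendsto (fun n => pairing (dispersion * ratio) (chi n)) atTop (𝓝 0) := by
    simpa only [pairing_mul_comm dispersion ratio] using tendsto_pairing_chi ratio
  have e0 := fun n => pairing_dispersion_one (isEes_chi n)
  have e1 := fun n => pairing_dispersion_cosSum (isEes_chi n)
  have e2 := fun n => pairing_dispersion_ratio (isEes_chi n)
  simp only [pairing_one_chi] at e0 e1 e2
  have c1 : Tendsto (fun n => pairing cosFst (chi n)) atTop (𝓝 1) := by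
    have := (h0.const_mul (-1 / 4)).const_add 1
    rw [mul_zero, add_zero] at this
    refine this.congr fun n => ?_
    rw [e0]; ring
  refine ⟨c1, ?_, ?_⟩
  · have := ((c1.const_mul 2).sub (h1.const_mul (1 / 4))).add
      ((h2.const_mul (1 / 2)).sub_const 1)
    norm_num at this
    refine this.congr fun n => ?_
    rw [e1, e2]; ring
  · have := (c1.sub (h1.const_mul (1 / 8))).sub (h2.const_mul (1 / 4))
    norm_num at this
    refine this.congr fun n => ?_
    rw [e1, e2]; ring

/-- The functions spanning the trial spaces: `1`, `cos p₁ + cos p₂`, `ratio` and `chi n`. -/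
def trialBase (n : ℕ) : Fin 4 → C(Torus2, ℝ) := ![1, cosSum, ratio, chi n]

theorem isEes_trialBase (n : ℕ) : ∀ a, IsEes (trialBase n a)
  | 0 => isEes_one
  | 1 => isEes_cosSum
  | 2 => isEes_ratio
  | 3 => isEes_chi n

/-- The coefficients of the trial functions in terms of `trialBase n`, chosen such that the values
of `d, t, u₁, u₀` on them tend to the four unit vectors. In particular `ratio` enters after
subtraction of a multiple of `chi n` which makes its mean vanish. -/
def trialCoeff : Fin 4 → Fin 4 → ℝ :=
  ![![0, 1 / 2, 1, -pairing 1 ratio],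
    ![-1, -2, 0, 1],
    ![0, 2, 0, 0],
    ![1, 0, 0, 0]]

/-- The limiting kinetic energies of the functions `trialBase n`. -/
def trialKinetic : Fin 4 → Fin 4 → ℝ :=
  ![![4, -2, 1, 0],
    ![-2, 4, 0, 0],
    ![1, 0, kap, 0],
    ![0, 0, 0, 0]]

/-- The limiting moments of the functions `trialBase n` against `1`, `cos p₁`, `cos 2p₁` and
`cos p₁ cos p₂`. -/
def trialMoment : Fin 4 → Fin 4 → ℝ :=
  ![![1, 0, 0, 0],
    ![0, 1 / 2, 0, 0],
    ![pairing 1 ratio, pairing 1 ratio - 1 / 4, pairing 1 ratio + (kap - 1) / 2,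
      pairing 1 ratio - (kap + 1) / 4],
    ![1, 1, 1, 1]]

/-- The trial functions. -/
def trial (n : ℕ) (i : Fin 4) : L2ees :=
  ∑ a, (trialCoeff i a : ℂ) • toEes (trialBase n a) (isEes_trialBase n a)

/-- The moments of `ratio`, in terms of its mean, by self-adjointness of the kinetic energy. -/
theorem moments_ratio :
    pairing cosFst ratio = pairing 1 ratio - 1 / 4 ∧
    pairing cosTwoFst ratio = pairing 1 ratio + (kap - 1) / 2 ∧
    pairing cosCos ratio = pairing 1 ratio - (kap + 1) / 4 := by
  obtain ⟨-, -, t3, -, -, t6, -, -⟩ := kinetic_table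
  have t9 := pairing_dispersion_ratio_ratio
  rw [pairing_dispersion_one isEes_ratio] at t3
  rw [pairing_dispersion_cosSum isEes_ratio] at t6
  rw [pairing_dispersion_ratio isEes_ratio] at t9
  refine ⟨?_, ?_, ?_⟩ <;> linarith

open Filter Topology in
theorem tendsto_trialKinetic (a b : Fin 4) :
    Tendsto (fun n => pairing (dispersion * trialBase n a) (trialBase n b)) atTop
      (𝓝 (trialKinetic a b)) := by
  obtain ⟨t1, t2, t3, t4, t5, t6, t7, t8⟩ := kinetic_table
  have t9 := pairing_dispersion_ratio_ratio
  have c := tendsto_pairing_chi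
  have c' : ∀ ψ, Tendsto (fun n => pairing (dispersion * ψ) (chi n)) atTop (𝓝 0) := fun ψ => by
    simpa only [pairing_mul_comm dispersion ψ] using c ψ
  fin_cases a <;> fin_cases b
  · exact tendsto_const_nhds.congr fun _ => t1.symm
  · exact tendsto_const_nhds.congr fun _ => t2.symm
  · exact tendsto_const_nhds.congr fun _ => t3.symm
  · exact c' 1
  · exact tendsto_const_nhds.congr fun _ => t4.symm
  · exact tendsto_const_nhds.congr fun _ => t5.symm
  · exact tendsto_const_nhds.congr fun _ => t6.symm
  · exact c' cosSum
  · exact tendsto_const_nhds.congr fun _ => t7.symm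
  · exact tendsto_const_nhds.congr fun _ => t8.symm
  · exact tendsto_const_nhds.congr fun _ => t9.symm
  · exact c' ratio
  · exact c 1
  · exact c cosSum
  · exact c ratio
  · exact tendsto_pairing_chi_chi

open Filter Topology in
theorem tendsto_trialMoment (a : Fin 4) (j : Fin 4) :
    Tendsto (fun n => pairing ((![1, cosFst, cosTwoFst, cosCos] : Fin 4 → C(Torus2, ℝ)) j)
      (trialBase n a)) atTop (𝓝 (trialMoment a j)) := by
  obtain ⟨r1, r2, r3⟩ := moments_ratio
  obtain ⟨c1, c2, c3⟩ := tendsto_moments_chi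
  fin_cases a <;> fin_cases j
  · exact tendsto_const_nhds.congr fun _ => pairing_one_one.symm
  · exact tendsto_const_nhds.congr fun _ => pairing_cosFst_one.symm
  · exact tendsto_const_nhds.congr fun _ => pairing_cosTwoFst_one.symm
  · exact tendsto_const_nhds.congr fun _ => pairing_cosCos_one.symm
  · exact tendsto_const_nhds.congr fun _ => pairing_one_cosSum.symm
  · exact tendsto_const_nhds.congr fun _ => pairing_cosFst_cosSum.symm
  · exact tendsto_const_nhds.congr fun _ => pairing_cosTwoFst_cosSum.symm
  · exact tendsto_const_nhds.congr fun _ => pairing_cosCos_cosSum.symm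
  · exact tendsto_const_nhds
  · exact tendsto_const_nhds.congr fun _ => r1.symm
  · exact tendsto_const_nhds.congr fun _ => r2.symm
  · exact tendsto_const_nhds.congr fun _ => r3.symm
  · exact tendsto_const_nhds.congr fun n => (pairing_one_chi n).symm
  · exact c1
  · exact c2
  · exact c3

theorem inner_hamiltonianEes_toEes (γ lam μ : ℝ) {φ ψ : C(Torus2, ℝ)} (hφ : IsEes φ)
    (hψ : IsEes ψ) :
    inner ℂ (hamiltonianEes γ lam μ (toEes φ hφ)) (toEes ψ hψ) =
      ((4 * π ^ 2 * (pairing (dispersion * φ) ψ + (γ * (pairing 1 φ * pairing 1 ψ) +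
        2 * lam * (pairing cosFst φ * pairing cosFst ψ) +
        2 * μ * (pairing cosTwoFst φ * pairing cosTwoFst ψ) +
        2 * μ * (pairing cosCos φ * pairing cosCos ψ))) : ℝ) : ℂ) := by
  rw [inner_hamiltonianEes]
  have h : inner ℂ (mulOp dispersion (toEes φ hφ)) ((toEes ψ hψ : L2ees) : L2) =
      ((4 * π ^ 2 * pairing (dispersion * φ) ψ : ℝ) : ℂ) := by
    change inner ℂ (mulOp dispersion (toL2 φ)) (toL2 ψ) = _
    rw [mulOp_toL2, inner_toL2_toL2, pairing, mul_div_cancel₀ _ four_pi_sq_pos.ne']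
  rw [h]
  simp only [moment_toEes, Complex.star_def, Complex.conj_ofReal]
  push_cast
  ring

/-- The limiting form of the Hamiltonian on the trial functions. -/
theorem sum_trialCoeff (γ lam μ : ℝ) (i j : Fin 4) :
    ∑ a, ∑ b, trialCoeff i a * trialCoeff j b * (4 * π ^ 2 * (trialKinetic a b +
      (γ * (trialMoment a 0 * trialMoment b 0) + 2 * lam * (trialMoment a 1 * trialMoment b 1) +
        2 * μ * (trialMoment a 2 * trialMoment b 2) +
        2 * μ * (trialMoment a 3 * trialMoment b 3)))) =
      ((4 * π ^ 2) • thresholdForm γ lam μ) i j := by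
  simp only [Fin.sum_univ_four, Matrix.smul_apply, smul_eq_mul]
  fin_cases i <;> fin_cases j <;>
    simp [trialCoeff, trialKinetic, trialMoment, thresholdForm, blockP, blockQ] <;> ring

open Filter Topology in
/-- On the trial functions the energy tends to the threshold form. -/
theorem tendsto_trial (γ lam μ : ℝ) (i j : Fin 4) :
    Tendsto (fun n => inner ℂ (hamiltonianEes γ lam μ (trial n i)) (trial n j)) atTop
      (𝓝 ((((4 * π ^ 2) • thresholdForm γ lam μ) i j : ℝ) : ℂ)) := by
  rw [← sum_trialCoeff]
  have h : ∀ n, inner ℂ (hamiltonianEes γ lam μ (trial n i)) (trial n j) =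
      ((∑ a, ∑ b, trialCoeff i a * trialCoeff j b * (4 * π ^ 2 *
        (pairing (dispersion * trialBase n a) (trialBase n b) +
          (γ * (pairing 1 (trialBase n a) * pairing 1 (trialBase n b)) +
          2 * lam * (pairing cosFst (trialBase n a) * pairing cosFst (trialBase n b)) +
          2 * μ * (pairing cosTwoFst (trialBase n a) * pairing cosTwoFst (trialBase n b)) +
          2 * μ * (pairing cosCos (trialBase n a) * pairing cosCos (trialBase n b))))) : ℝ) :
            ℂ) := by
    intro n
    simp only [trial, map_sum, map_smul, sum_inner, inner_sum]
    push_cast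
    rw [Finset.sum_comm]
    refine Finset.sum_congr rfl fun a _ => Finset.sum_congr rfl fun b _ => ?_
    refine (inner_smul_left (𝕜 := ℂ) (E := L2ees) _ _ _).trans ?_
    refine (congrArg _ (inner_smul_right (𝕜 := ℂ) (E := L2ees) _ _ _)).trans ?_
    rw [inner_hamiltonianEes_toEes, Complex.conj_ofReal]
    push_cast
    ring
  simp only [h]
  refine (Complex.continuous_ofReal.tendsto _).comp ?_
  refine tendsto_finsetSum _ fun a _ => tendsto_finsetSum _ fun b _ => ?_
  have m := fun a j => tendsto_trialMoment a j
  exact (((tendsto_trialKinetic a b).add ((((((m a 0).mul (m b 0)).const_mul γ).add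
    (((m a 1).mul (m b 1)).const_mul (2 * lam))).add
    (((m a 2).mul (m b 2)).const_mul (2 * μ))).add
    (((m a 3).mul (m b 3)).const_mul (2 * μ)))).const_mul (4 * π ^ 2)).const_mul _

/-! ### The bottom of the essential spectrum -/

/-- A tent function of the kinetic energy, of height `r` and centred at `s`. -/
def tent (r s : ℝ) : C(Torus2, ℝ) := ⟨fun p => max 0 (r - |dispersion p - s|), by fun_prop⟩

theorem tent_apply (r s : ℝ) (p : Torus2) : tent r s p = max 0 (r - |dispersion p - s|) := rfl

theorem isEes_tent (r s : ℝ) : IsEes (tent r s) :=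
  ⟨fun p => by rw [tent_apply, tent_apply, isEes_dispersion.1],
    fun p => by rw [tent_apply, tent_apply, isEes_dispersion.2.1],
    fun p => by rw [tent_apply, tent_apply, isEes_dispersion.2.2]⟩

theorem exists_dispersion_eq {s : ℝ} (h0 : 0 ≤ s) (h1 : s ≤ 4) : ∃ p, dispersion p = s := by
  refine ⟨((Real.arccos (1 - s / 2) : ℝ), (0 : ℝ)), ?_⟩
  rw [dispersion_apply, cosT_coe, cosT_coe, Real.cos_arccos (by linarith) (by linarith),
    Real.cos_zero]
  ring

/-- Functions supported where the kinetic energy is small span spaces of any dimension. -/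
theorem exists_kineticEes_small (δ : ℝ) (hδ : 0 < δ) (n : ℕ) :
    ∃ g : (Fin n → ℂ) →ₗ[ℂ] L2ees, Function.Injective g ∧
      ∀ z, ‖kineticEes (g z)‖ ≤ δ * ‖g z‖ := by
  -- the tents centred at `r, 2r, …, nr` are supported where `𝓔₀ < δ`, and each of them vanishes at
  -- the centres of the others
  set r : ℝ := min δ 1 / (n + 2) with hr
  have hn : (0 : ℝ) < n + 2 := by positivity
  have hr0 : 0 < r := div_pos (lt_min hδ one_pos) hn
  have hrn : r * (n + 2) = min δ 1 := div_mul_cancel₀ _ hn.ne'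
  have hkn : ∀ k : Fin n, ((k : ℕ) : ℝ) + 1 ≤ n := fun k => by exact_mod_cast k.2
  set φ : Fin n → C(Torus2, ℝ) := fun k => tent r ((k + 1) * r) with hφ
  set g : (Fin n → ℂ) →ₗ[ℂ] L2ees :=
    Fintype.linearCombination ℂ fun k => toEes (φ k) (isEes_tent _ _) with hg
  set F : (Fin n → ℂ) → C(Torus2, ℂ) := fun z => ∑ k, z k • toComplex (φ k) with hF
  have hFa : ∀ z p, F z p = ∑ k, z k * (φ k p : ℂ) := by
    intro z p
    simp only [hF, ContinuousMap.coe_sum, Finset.sum_apply, ContinuousMap.smul_apply, smul_eq_mul]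
    rfl
  have hgF : ∀ z, ((g z : L2ees) : L2) = ContinuousMap.toLp 2 volume ℂ (F z) := by
    intro z
    rw [hg, Fintype.linearCombination_apply, hF, map_sum]
    simp only [map_smul]
    rw [AddSubmonoidClass.coe_finsetSum]
    rfl
  refine ⟨g, ?_, fun z => ?_⟩
  · refine (injective_iff_map_eq_zero g).2 fun z hz => ?_
    have h1 : F z = 0 := by
      refine ContinuousMap.toLp_injective (p := 2) (𝕜 := ℂ) (volume : Measure Torus2) ?_
      rw [← hgF, hz, map_zero]; rfl
    ext k
    have hk := hkn k
    obtain ⟨p, hp⟩ := exists_dispersion_eq (s := (k + 1) * r) (by positivity)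
      (by nlinarith [min_le_right δ 1])
    have h2 : F z p = z k * r := by
      rw [hFa, Finset.sum_eq_single k]
      · rw [hφ, tent_apply, hp]; simp [hr0.le]
      · intro j _ hj
        have h3 : (1 : ℝ) ≤ |((k : ℕ) : ℝ) - (j : ℕ)| := by
          have : ((k : ℕ) : ℤ) - (j : ℕ) ≠ 0 := by
            intro h; exact hj (Fin.ext (by omega))
          exact_mod_cast Int.one_le_abs this
        have h4 : φ j p = 0 := by
          rw [hφ, tent_apply, hp, max_eq_left]
          rw [show ((k : ℕ) + 1 : ℝ) * r - ((j : ℕ) + 1) * r =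
              (((k : ℕ) : ℝ) - (j : ℕ)) * r by ring, abs_mul, abs_of_pos hr0]
          nlinarith
        rw [h4]; simp
      · simp
    rw [h1, ContinuousMap.zero_apply] at h2
    exact (mul_eq_zero.1 h2.symm).resolve_right (by exact_mod_cast hr0.ne')
  · change ‖((kineticEes (g z) : L2ees) : L2)‖ ≤ δ * ‖((g z : L2ees) : L2)‖
    rw [coe_kineticEes]
    refine Lp.norm_le_mul_norm_of_ae_le_mul ?_
    rw [hgF]
    filter_upwards [coeFn_mulOp dispersion (ContinuousMap.toLp 2 volume ℂ (F z)),
      ContinuousMap.coeFn_toLp (p := 2) (𝕜 := ℂ) (volume : Measure Torus2) (F z)] with p h1 h2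
    rw [h1, h2, norm_mul, Complex.norm_real, Real.norm_of_nonneg (dispersion_nonneg p)]
    rcases le_total (dispersion p) δ with h | h
    · exact mul_le_mul_of_nonneg_right h (norm_nonneg _)
    · have h3 : F z p = 0 := by
        rw [hFa]
        refine Finset.sum_eq_zero fun k _ => ?_
        have hk := hkn k
        have h4 : φ k p = 0 := by
          rw [hφ, tent_apply, max_eq_left]
          have : ((k : ℕ) + 1 : ℝ) * r + r ≤ dispersion p := by
            nlinarith [min_le_left δ 1]
          linarith [le_abs_self (dispersion p - ((k : ℕ) + 1) * r)]
        rw [h4]; simp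
      rw [h3]; simp

theorem hamiltonianEes_eq_kineticEes_add (γ lam μ : ℝ) :
    hamiltonianEes γ lam μ = kineticEes + (hamiltonianEes γ lam μ - kineticEes) :=
  (add_sub_cancel _ _).symm

theorem belowEss_hamiltonianEes (γ lam μ : ℝ) :
    belowEss (hamiltonianEes γ lam μ) = Set.Iio 0 :=
  belowEss_eq isPositive_kineticEes (hasFiniteRange_sub_kineticEes γ lam μ)
    (hamiltonianEes_eq_kineticEes_add γ lam μ)
    (zero_mem_essentialSpectrum (hasFiniteRange_sub_kineticEes γ lam μ)
      (hamiltonianEes_eq_kineticEes_add γ lam μ) exists_kineticEes_small)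

theorem eigenvalueCount_of_mem_CMinus {γ lam μ : ℝ} {ζ : Fin 5} (h : (γ, lam, μ) ∈ CMinus ζ) :
    eigenvalueCount (hamiltonianEes γ lam μ) (belowEss (hamiltonianEes γ lam μ)) =
      ((ζ : ℕ) : Cardinal) := by
  rw [belowEss_hamiltonianEes]
  exact eigenvalueCount_eq (isSelfAdjoint_hamiltonianEes γ lam μ) isPositive_kineticEes
    (hasFiniteRange_sub_kineticEes γ lam μ) (hamiltonianEes_eq_kineticEes_add γ lam μ)
    ((hasIndex_thresholdForm h).smul four_pi_sq_pos) thresholdCoord (thresholdForm_le γ lam μ)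
    trial (tendsto_trial γ lam μ)

/-! ### Reflection of the spectrum -/

section Reflection

variable {E : Type*} [NormedAddCommGroup E] [InnerProductSpace ℂ E]

theorem isFredholm_mul {T S : E →L[ℂ] E} (hT : T.IsFredholm) (hS : S.IsFredholm) :
    (T * S).IsFredholm := by
  rw [ContinuousLinearMap.isFredholm_iff_exists_isQuasiInverse] at *
  obtain ⟨v, hv⟩ := hT
  obtain ⟨w, hw⟩ := hS
  exact ⟨w * v, hw.comp hv⟩

/-- An involution `W` conjugating `T` to `c - S` reflects the essential spectrum. -/
theorem isFredholm_of_reflection {T S W : E →L[ℂ] E} {c : ℝ} (hW : ∀ f, W (W f) = f)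
    (h : ∀ f, W (T f) = (c : ℂ) • W f - S (W f)) {z : ℂ}
    (hF : (T - z • ContinuousLinearMap.id ℂ E).IsFredholm) :
    (S - ((c : ℂ) - z) • ContinuousLinearMap.id ℂ E).IsFredholm := by
  have hu : IsUnit W := ⟨⟨W, W, by ext f; exact hW f, by ext f; exact hW f⟩, rfl⟩
  have he : S - ((c : ℂ) - z) • ContinuousLinearMap.id ℂ E =
      (-W) * ((T - z • ContinuousLinearMap.id ℂ E) * W) := by
    ext f
    change S f - ((c : ℂ) - z) • f = -W (T (W f) - z • W f)
    rw [map_sub, h, map_smul, hW, sub_smul]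
    abel
  rw [he]
  exact isFredholm_mul (isFredholm_of_isUnit hu.neg) (isFredholm_mul hF (isFredholm_of_isUnit hu))

theorem reflection_symm {T S W : E →L[ℂ] E} {c : ℝ} (hW : ∀ f, W (W f) = f)
    (h : ∀ f, W (T f) = (c : ℂ) • W f - S (W f)) (f : E) :
    W (S f) = (c : ℂ) • W f - T (W f) := by
  have h1 := congrArg W (h (W f))
  rw [hW, map_sub, map_smul, hW, hW] at h1
  rw [h1]; abel

theorem mem_aboveEss_iff {T S W : E →L[ℂ] E} {c : ℝ} (hW : ∀ f, W (W f) = f)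
    (h : ∀ f, W (T f) = (c : ℂ) • W f - S (W f)) (x : ℝ) :
    x ∈ aboveEss T ↔ c - x ∈ belowEss S := by
  have h' := reflection_symm hW h
  constructor
  · intro hx w hw
    have := hx ((c : ℂ) - w) fun hF => hw (by
      have := isFredholm_of_reflection hW h hF
      rwa [sub_sub_cancel] at this)
    rw [Complex.sub_re, Complex.ofReal_re] at this
    linarith
  · intro hx w hw
    have := hx ((c : ℂ) - w) fun hF => hw (by
      have := isFredholm_of_reflection hW h' hF
      rwa [sub_sub_cancel] at this)
    rw [Complex.sub_re, Complex.ofReal_re] at this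
    linarith

theorem rank_eigenspace_of_reflection {T S W : E →L[ℂ] E} {c : ℝ} (hW : ∀ f, W (W f) = f)
    (h : ∀ f, W (T f) = (c : ℂ) • W f - S (W f)) (x : ℝ) :
    Module.rank ℂ (Module.End.eigenspace (T : E →ₗ[ℂ] E) (x : ℂ)) =
      Module.rank ℂ (Module.End.eigenspace (S : E →ₗ[ℂ] E) ((c - x : ℝ) : ℂ)) := by
  set e : E ≃ₗ[ℂ] E := LinearEquiv.ofInvolutive (W : E →ₗ[ℂ] E) hW
  have he : (Module.End.eigenspace (T : E →ₗ[ℂ] E) (x : ℂ)).map (e : E →ₗ[ℂ] E) =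
      Module.End.eigenspace (S : E →ₗ[ℂ] E) ((c - x : ℝ) : ℂ) := by
    ext f
    rw [Module.End.mem_eigenspace_iff]
    constructor
    · rintro ⟨g, hg, rfl⟩
      rw [SetLike.mem_coe, Module.End.mem_eigenspace_iff] at hg
      change S (W g) = _ • W g
      have h1 := h g
      rw [show T g = (x : ℂ) • g from hg, map_smul] at h1
      push_cast
      rw [sub_smul, h1]; abel
    · intro hf
      refine ⟨W f, ?_, hW f⟩
      rw [SetLike.mem_coe, Module.End.mem_eigenspace_iff]
      change T (W f) = (x : ℂ) • W f
      have h1 := reflection_symm hW h f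
      rw [show S f = ((c - x : ℝ) : ℂ) • f from hf, map_smul] at h1
      push_cast at h1
      rw [sub_smul] at h1
      exact (sub_right_inj.1 h1).symm
  rw [← he]
  exact (LinearEquiv.rank_map_eq e _).symm

/-- If an involution conjugates `T` to `c - S`, the eigenvalues of `T` above its essential spectrum
correspond to those of `S` below its essential spectrum. -/
theorem eigenvalueCount_aboveEss {T S W : E →L[ℂ] E} {c : ℝ} (hW : ∀ f, W (W f) = f)
    (h : ∀ f, W (T f) = (c : ℂ) • W f - S (W f)) :
    eigenvalueCount T (aboveEss T) = eigenvalueCount S (belowEss S) := by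
  let e : aboveEss T ≃ belowEss S :=
    (Equiv.subLeft c).subtypeEquiv fun x => mem_aboveEss_iff hW h x
  unfold eigenvalueCount
  exact Cardinal.mk_sigma_congr' e fun x =>
    congrArg (fun a : Cardinal => Cardinal.mk a.out) (rank_eigenspace_of_reflection hW h x)

end Reflection

/-- The shift of the torus by `(π, π)`. -/
def shift (p : Torus2) : Torus2 := (p.1 + (π : ℝ), p.2 + (π : ℝ))

theorem mp_shift : MeasurePreserving shift volume volume :=
  (measurePreserving_add_right (volume : Measure Torus) _).prod
    (measurePreserving_add_right (volume : Measure Torus) _)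

theorem neg_pi_torus : -((π : ℝ) : Torus) = (π : ℝ) := by
  rw [neg_eq_iff_add_eq_zero, ← AddCircle.coe_add, ← two_mul]
  exact AddCircle.coe_period _

theorem cosT_add_pi (x : Torus) : cosT (x + (π : ℝ)) = -cosT x := by
  induction x using QuotientAddGroup.induction_on with
  | H x => exact Real.cos_add_pi x

theorem sinT_add_pi (x : Torus) : sinT (x + (π : ℝ)) = -sinT x := by
  induction x using QuotientAddGroup.induction_on with
  | H x => exact Real.sin_add_pi x

theorem compOp_compOp (σ τ ρ : Torus2 → Torus2) (hσ : MeasurePreserving σ volume volume)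
    (hτ : MeasurePreserving τ volume volume) (hρ : MeasurePreserving ρ volume volume)
    (h : ∀ p, τ (σ p) = ρ p) (f : L2) : compOp σ hσ (compOp τ hτ f) = compOp ρ hρ f := by
  apply Lp.ext
  filter_upwards [coeFn_compOp σ hσ (compOp τ hτ f), coeFn_compOp ρ hρ f,
    hσ.quasiMeasurePreserving.ae (coeFn_compOp τ hτ f)] with p h1 h2 h3
  rw [h1, h2, h3, h]

theorem compOp_comm (σ τ : Torus2 → Torus2) (hσ : MeasurePreserving σ volume volume)
    (hτ : MeasurePreserving τ volume volume) (h : ∀ p, τ (σ p) = σ (τ p)) (f : L2) :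
    compOp σ hσ (compOp τ hτ f) = compOp τ hτ (compOp σ hσ f) := by
  rw [compOp_compOp σ τ _ hσ hτ (hτ.comp hσ) (fun _ => rfl),
    compOp_compOp τ σ _ hτ hσ (hτ.comp hσ) (fun p => (h p).symm)]

theorem compOp_shift_mem (f : L2) (hf : f ∈ L2ees) : compOp shift mp_shift f ∈ L2ees := by
  rw [mem_L2ees] at hf ⊢
  obtain ⟨h1, h2, h3⟩ := hf
  refine ⟨?_, ?_, ?_⟩
  · rw [← compOp_comm shift _ mp_shift mp_neg, h1]
    intro p
    ext <;> simp [shift, neg_pi_torus, add_comm]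
  · rw [← compOp_comm shift _ mp_shift mp_swap, h2]
    intro p
    ext <;> simp [shift]
  · rw [← compOp_comm shift _ mp_shift mp_refl, h3]
    intro p
    ext <;> simp [shift, neg_pi_torus, add_comm]

/-- Composition with the shift by `(π, π)` in `L^{2,ees}(𝕋²)`. -/
def shiftEes : L2ees →L[ℂ] L2ees :=
  (compOp shift mp_shift).toContinuousLinearMap.restrict compOp_shift_mem

theorem coe_shiftEes (f : L2ees) :
    ((shiftEes f : L2ees) : L2) = compOp shift mp_shift f := rfl

theorem shiftEes_shiftEes (f : L2ees) : shiftEes (shiftEes f) = f := by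
  refine Subtype.ext ?_
  rw [coe_shiftEes, coe_shiftEes,
    compOp_compOp shift shift id mp_shift mp_shift (MeasurePreserving.id _)]
  · rw [compOp_eq_iff]
    exact .of_forall fun _ => rfl
  · intro p
    have h : ((π : ℝ) : Torus) + (π : ℝ) = 0 := by
      nth_rewrite 1 [← neg_pi_torus]; exact neg_add_cancel _
    ext <;> simp [shift, add_assoc, h]

theorem compOp_shift_mulOp_dispersion (f : L2) :
    compOp shift mp_shift (mulOp dispersion f) =
      (8 : ℂ) • compOp shift mp_shift f - mulOp dispersion (compOp shift mp_shift f) := by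
  apply Lp.ext
  filter_upwards [coeFn_compOp shift mp_shift (mulOp dispersion f),
    coeFn_compOp shift mp_shift f, coeFn_mulOp dispersion (compOp shift mp_shift f),
    mp_shift.quasiMeasurePreserving.ae (coeFn_mulOp dispersion f),
    Lp.coeFn_sub ((8 : ℂ) • compOp shift mp_shift f) (mulOp dispersion (compOp shift mp_shift f)),
    Lp.coeFn_smul (8 : ℂ) (compOp shift mp_shift f)] with p h1 h2 h3 h4 h5 h6
  rw [h1, h4, h5, Pi.sub_apply, h6, Pi.smul_apply, h3, h2, dispersion_apply, dispersion_apply]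
  simp only [shift, cosT_add_pi, smul_eq_mul]
  push_cast
  ring

theorem compOp_intOp_eq (σ : Torus2 → Torus2) (hσ : MeasurePreserving σ volume volume)
    (φ ψ : C(Torus2, ℝ)) (h : ∀ p, φ (σ p) = ψ p) (f : L2) :
    compOp σ hσ (intOp φ f) = intOp ψ (compOp σ hσ f) := by
  change compOp σ hσ (inner ℂ (toL2 φ) f • toL2 φ) =
    inner ℂ (toL2 ψ) (compOp σ hσ f) • toL2 ψ
  rw [map_smul, compOp_toL2 σ hσ φ ψ h, ← compOp_toL2 σ hσ φ ψ h]
  congr 1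
  exact ((compOp σ hσ).inner_map_map _ _).symm

theorem compOp_shift_potential (γ lam μ : ℝ) (f : L2) :
    compOp shift mp_shift (potential γ lam μ f) = potential γ lam μ (compOp shift mp_shift f) := by
  have h2 : ∀ x : Torus, cosT (2 • (x + (π : ℝ))) = cosT (2 • x) := fun x => by
    rw [cosT_two_smul, cosT_two_smul, cosT_add_pi, neg_sq]
  simp only [potential, add_apply, smul_apply, map_add, map_smul]
  rw [compOp_intOp_eq _ mp_shift 1 1 (fun _ => rfl),
    compOp_intOp_eq _ mp_shift cosFst (-cosFst) (fun p => cosT_add_pi p.1),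
    compOp_intOp_eq _ mp_shift cosSnd (-cosSnd) (fun p => cosT_add_pi p.2),
    compOp_intOp_eq _ mp_shift cosTwoFst cosTwoFst (fun p => h2 p.1),
    compOp_intOp_eq _ mp_shift cosTwoSnd cosTwoSnd (fun p => h2 p.2),
    compOp_intOp_eq _ mp_shift cosCos cosCos
      (fun p => by simp [cosCos, shift, cosT_add_pi]),
    compOp_intOp_eq _ mp_shift sinSin sinSin
      (fun p => by simp [sinSin, shift, sinT_add_pi]), intOp_neg, intOp_neg]

theorem potential_neg (γ lam μ : ℝ) : potential (-γ) (-lam) (-μ) = -potential γ lam μ := by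
  simp only [potential, neg_div, Complex.ofReal_neg, neg_smul]
  abel

/-- The shift by `(π, π)` turns the Hamiltonian into `8` minus the Hamiltonian with the opposite
coupling constants. -/
theorem shiftEes_hamiltonianEes (γ lam μ : ℝ) (f : L2ees) :
    shiftEes (hamiltonianEes γ lam μ f) = ((8 : ℝ) : ℂ) • shiftEes f -
      hamiltonianEes (-γ) (-lam) (-μ) (shiftEes f) := by
  refine Subtype.ext ?_
  rw [coe_shiftEes, coe_hamiltonianEes]
  change _ = ((8 : ℝ) : ℂ) • compOp shift mp_shift f -
    hamiltonian (-γ) (-lam) (-μ) (compOp shift mp_shift f)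
  rw [hamiltonian, hamiltonian, potential_neg, add_apply, add_apply, neg_apply, map_add,
    compOp_shift_mulOp_dispersion, compOp_shift_potential]
  push_cast
  abel

/-! ### The components above the spectrum -/

theorem Q0Plus_eq_neg (μ : ℝ) : Q0Plus μ = Q0Minus (-μ) := by
  unfold Q0Plus Q0Minus; ring

theorem Q1Plus_eq_neg (μ : ℝ) : Q1Plus μ = Q1Minus (-μ) := by
  unfold Q1Plus Q1Minus; ring

theorem lambdaPlus_eq_neg (μ : ℝ) : lambdaPlus μ = -lambdaMinus (-μ) := by
  rw [lambdaPlus, lambdaMinus, Q0Plus_eq_neg, Q1Plus_eq_neg, neg_neg]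

theorem gammaPlus_eq_neg (lam μ : ℝ) : gammaPlus lam μ = -gammaMinus (-lam) (-μ) := by
  rw [gammaPlus, gammaMinus, Q0Plus_eq_neg, Q1Plus_eq_neg, neg_sub]
  rw [show -lam * Q0Minus (-μ) + Q1Minus (-μ) = -(lam * Q0Minus (-μ) - Q1Minus (-μ)) by ring,
    div_neg]
  ring

theorem neg_mem_IMinus {μ : ℝ} {j : Fin 3} (h : μ ∈ IPlus j) : -μ ∈ IMinus j := by
  fin_cases j
  · have h1 : μ < -mu0Plus := h
    exact lt_neg_of_lt_neg h1
  · exact ⟨lt_neg_of_lt_neg h.2, neg_lt_of_neg_lt h.1⟩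
  · have h1 : -mu0Minus < μ := h
    exact neg_lt_of_neg_lt h1

theorem neg_mem_tauMinus {lam μ : ℝ} {j : Fin 3} (h : (lam, μ) ∈ tauPlus j) :
    (-lam, -μ) ∈ tauMinus j := by
  refine ⟨?_, neg_mem_IMinus h.2⟩
  have h1 : lam = lambdaPlus μ := h.1
  simp only [h1, lambdaPlus_eq_neg, neg_neg]

theorem neg_mem_DMinus {lam μ : ℝ} {j : Fin 4} (h : (lam, μ) ∈ DPlus j) :
    (-lam, -μ) ∈ DMinus j := by
  have l : ∀ {i : Fin 3}, lam < lambdaPlus μ ∧ μ ∈ IPlus i →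
      -lam > lambdaMinus (-μ) ∧ -μ ∈ IMinus i := fun h => by
    rw [lambdaPlus_eq_neg] at h
    exact ⟨lt_neg_of_lt_neg h.1, neg_mem_IMinus h.2⟩
  have g : ∀ {i : Fin 3}, lam > lambdaPlus μ ∧ μ ∈ IPlus i →
      -lam < lambdaMinus (-μ) ∧ -μ ∈ IMinus i := fun h => by
    rw [lambdaPlus_eq_neg] at h
    exact ⟨neg_lt_of_neg_lt h.1, neg_mem_IMinus h.2⟩
  fin_cases j
  · exact l h
  · rcases h with (h | h) | h
    · exact .inl (.inl (g h))
    · exact .inl (.inr (neg_eq_iff_eq_neg.2 h))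
    · exact .inr (l h)
  · rcases h with (h | h) | h
    · exact .inl (.inl (g h))
    · exact .inl (.inr (neg_eq_iff_eq_neg.2 h))
    · exact .inr (l h)
  · exact g h

theorem neg_mem_CMinus {γ lam μ : ℝ} {ζ : Fin 5} (h : (γ, lam, μ) ∈ CPlus ζ) :
    (-γ, -lam, -μ) ∈ CMinus ζ := by
  have l : ∀ {i : Fin 4}, (γ, lam, μ) ∈ belowGraph gammaPlus (DPlus i) →
      (-γ, -lam, -μ) ∈ aboveGraph gammaMinus (DMinus i) := fun h => by
    refine ⟨?_, neg_mem_DMinus h.2⟩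
    have h1 : γ < gammaPlus lam μ := h.1
    rw [gammaPlus_eq_neg] at h1
    exact lt_neg_of_lt_neg h1
  have g : ∀ {i : Fin 4}, (γ, lam, μ) ∈ aboveGraph gammaPlus (DPlus i) →
      (-γ, -lam, -μ) ∈ belowGraph gammaMinus (DMinus i) := fun h => by
    refine ⟨?_, neg_mem_DMinus h.2⟩
    have h1 : γ > gammaPlus lam μ := h.1
    rw [gammaPlus_eq_neg] at h1
    exact neg_lt_of_neg_lt h1
  fin_cases ζ
  · exact l h
  · rcases h with (h | h) | h
    · exact .inl (.inl (g h))
    · exact .inl (.inr (neg_mem_tauMinus h))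
    · exact .inr (l h)
  · rcases h with (h | h) | h
    · exact .inl (.inl (g h))
    · exact .inl (.inr (neg_mem_tauMinus h))
    · exact .inr (l h)
  · rcases h with (h | h) | h
    · exact .inl (.inl (g h))
    · exact .inl (.inr (neg_mem_tauMinus h))
    · exact .inr (l h)
  · exact g h

end LatticeBosons

end

theorem mainTheorem3 (γ lam μ : ℝ) (ζ : Fin 5) :
    ((γ, lam, μ) ∈ LatticeBosons.CMinus ζ →
      LatticeBosons.eigenvalueCount (LatticeBosons.hamiltonianEes γ lam μ)
        (LatticeBosons.belowEss (LatticeBosons.hamiltonianEes γ lam μ)) = ((ζ : ℕ) : Cardinal)) ∧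
    ((γ, lam, μ) ∈ LatticeBosons.CPlus ζ →
      LatticeBosons.eigenvalueCount (LatticeBosons.hamiltonianEes γ lam μ)
        (LatticeBosons.aboveEss (LatticeBosons.hamiltonianEes γ lam μ)) = ((ζ : ℕ) : Cardinal)) := by
  refine ⟨LatticeBosons.eigenvalueCount_of_mem_CMinus, fun h => ?_⟩
  rw [LatticeBosons.eigenvalueCount_aboveEss LatticeBosons.shiftEes_shiftEes
    (LatticeBosons.shiftEes_hamiltonianEes γ lam μ)]
  exact LatticeBosons.eigenvalueCount_of_mem_CMinus (LatticeBosons.neg_mem_CMinus h)
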